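/- **Setting.** Let $\mathcal N$ be a finite ground set with $n$ elements, $f\colon 2^{\mathcal N}\to\mathbb R_{\ge 0}$ a monotone submodular function, $\ell\colon 2^{\mathcal N}\to\mathbb R$ a linear function (i.e. $\ell(S)=\sum_{u\in S}\ell(\{u\})$; negative values are allowed), and $\mathcal M=(\mathcal N,\mathcal I)$ a matroid of rank $r$. An algorithm knows $\mathcal N$ and accesses $f$, $\ell$ and $\mathcal M$ through value oracles for $f$ and $\ell$ and an independence oracle for $\mathcal M$; its query complexity is the total number of oracle queries, in the worst case. A *non-oblivious local search* with parameters $L\ge 2$, $\alpha_0=0$, $\alpha_1,\dots,\alpha_L>0$ and $c>0$ maintains disjoint sets $S_1,\dots,S_L$ with $S_1\cup\dots\cup S_L\in\mathcal I$. These are encoded as $A=\{(u,i): u\in S_i\}$, and any $A\subseteq\mathcal N\times\{1,\dots,L\}$ of this form is called a solution. The search goes through a sequence of solutions, from one to the next by removing at most one pair and adding at most one pair so that the auxiliary function $$\Phi(A)=g(A)+c\sum_{i=1}^{L}\ell(S_i),\qquad g(A)=\sum_{J\subseteq\{1,\dots,L\}}\alpha_{|J|}\,f\Big(\bigcup_{i\in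 J}S_i\Big)$$ strictly increases, and it returns $S=S_1\cup\dots\cup S_L$ for its last solution. (For a set $A$ of pairs that is not a solution, $\Phi(A)$ is given by the same formula with $S_i=\{u:(u,i)\in A\}$.) The last solution $A$ is *$\varepsilon$-locally optimal* if, with $\Phi(p\mid D)=\Phi(D\cup\{p\})-\Phi(D)$, for every solution $T$ $$\sum_{p\in T}\Phi(p\mid A\setminus\{p\})-\sum_{p\in A}\Phi(p\mid A\setminus\{p\})\le\varepsilon\cdot\max\{g(B): B\text{ a solution}\}.$$ **Theorem.** There is an absolute constant $k$, and for every $\varepsilon>0$ there are parameters $L,\alpha_1,\dots,\alpha_L,c$ as above and a constant $C$, all depending only on $\varepsilon$, such that for every finite set $\mathcal N$ the following hold for all $f$, $\ell$, $\mathcal M$ as above. 1. There is a deterministic non-oblivious local search algorithm with these parameters (the algorithm depending only on $\varepsilon$ and $\mathcal N$) that ends with an $\varepsilon$-locally optimal solution and returns a set $S\in\mathcal I$ with $$f(S)+\ell(S)\ge(1-1/e-\varepsilon)\,f(OPT)+\ell(OPT)\qquad\text{for every } OPT\in\mathcal I,$$ using at most $C\cdot n\max\{1,r\}\,(1+\log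 n)^k=\tilde O_\varepsilon(nr)$ queries. 2. There is a randomized non-oblivious local search algorithm with these parameters (again depending only on $\varepsilon$ and $\mathcal N$) that always performs only such strictly improving steps and returns a set $S\in\mathcal I$, and uses at most $C\,(n+r\sqrt n)(1+\log n)^k=\tilde O_\varepsilon(n+r\sqrt n)$ queries. With probability at least $1-\varepsilon$ its last solution is $\varepsilon$-locally optimal and the inequality of part 1 holds for every $OPT\in\mathcal I$ simultaneously. Moreover $\mathbb E[f(S)+\ell(S)]\ge(1-1/e-\varepsilon)f(OPT)+\ell(OPT)$ for every $OPT\in\mathcal I$. (For $n=0$, the factor $(1+\log n)^k$ is read as $1$.) -/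

import Mathlib

universe u v

/-- Submodularity of a set function. -/
def IsSubmodular {N : Type u} [DecidableEq N] (f : Finset N → ℝ) : Prop :=
  ∀ S T : Finset N, f (S ∩ T) + f (S ∪ T) ≤ f S + f T

/-- A linear set function: the value of a set is the sum of the values of its singletons
(in particular the value of the empty set is `0`). -/
def IsLinearSetFun {N : Type u} (w : Finset N → ℝ) : Prop :=
  ∀ S : Finset N, w S = ∑ x ∈ S, w {x}

/-! ### Algorithms with oracle access -/

/-- Algorithms with results in `β` that have access to the ground set `N` and to three oracles:
the value oracle of a set function `f`, the value oracle of a set function `w`, and the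
independence oracle of a matroid. Every query may depend on all the earlier answers and random
choices. A node `sample m next` draws a uniformly random element of `{0, …, m}`.
Only queries are counted, computations between queries are free. -/
inductive OracleAlg (N : Type u) (β : Type v) : Type (max u v)
  | output (b : β) : OracleAlg N β
  | queryValue (S : Finset N) (next : ℝ → OracleAlg N β) : OracleAlg N β
  | queryLinear (S : Finset N) (next : ℝ → OracleAlg N β) : OracleAlg N β
  | queryIndep (S : Finset N) (next : Bool → OracleAlg N β) : OracleAlg N β
  | sample (m : ℕ) (next : Fin (m + 1) → OracleAlg N β) : OracleAlg N β

namespace OracleAlg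

variable {N : Type u} {β : Type v}

/-- A deterministic algorithm makes no random choice. -/
def Deterministic : OracleAlg N β → Prop
  | output _ => True
  | queryValue _ next => ∀ x, (next x).Deterministic
  | queryLinear _ next => ∀ x, (next x).Deterministic
  | queryIndep _ next => ∀ b, (next b).Deterministic
  | sample _ _ => False

open Classical in
/-- The set of results that are produced with positive probability when the oracles are those of
`f`, `w` and `M`. -/
noncomputable def outcomes (f w : Finset N → ℝ) (M : Matroid N) : OracleAlg N β → Set β
  | output b => {b}
  | queryValue S next => (next (f S)).outcomes f w M
  | queryLinear S next => (next (w S)).outcomes f w M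
  | queryIndep S next => (next (decide (M.Indep (S : Set N)))).outcomes f w M
  | sample _ next => ⋃ i, (next i).outcomes f w M

open Classical in
/-- The number of oracle queries (to all three oracles together), in the worst case over the
random choices. -/
noncomputable def queries (f w : Finset N → ℝ) (M : Matroid N) : OracleAlg N β → ℕ
  | output _ => 0
  | queryValue S next => (next (f S)).queries f w M + 1
  | queryLinear S next => (next (w S)).queries f w M + 1
  | queryIndep S next => (next (decide (M.Indep (S : Set N)))).queries f w M + 1
  | sample _ next => Finset.univ.sup fun i => (next i).queries f w M

open Classical in
/-- The expectation of `φ` of the result. -/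
noncomputable def expect (f w : Finset N → ℝ) (M : Matroid N) (φ : β → ℝ) : OracleAlg N β → ℝ
  | output b => φ b
  | queryValue S next => (next (f S)).expect f w M φ
  | queryLinear S next => (next (w S)).expect f w M φ
  | queryIndep S next => (next (decide (M.Indep (S : Set N)))).expect f w M φ
  | sample m next => (∑ i, (next i).expect f w M φ) / ((m : ℝ) + 1)

open Classical in
/-- The probability that the result satisfies `P`. -/
noncomputable def prob (f w : Finset N → ℝ) (M : Matroid N) (P : β → Prop)
    (A : OracleAlg N β) : ℝ :=
  A.expect f w M fun b => if P b then 1 else 0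

end OracleAlg

/-! ### Non-oblivious local search

A solution consists of `L` disjoint sets `S_1, …, S_L` whose union is independent. It is written
as a set `A` of pairs `(x, i)`, the pair `(x, i)` meaning that `x` belongs to `S_i`. -/

/-- The union of the sets `S_i` with `i ∈ J`. -/
def unionPart {N : Type u} [DecidableEq N] {L : ℕ} (J : Finset (Fin L))
    (A : Finset (N × Fin L)) : Finset N :=
  (A.filter fun p => p.2 ∈ J).image Prod.fst

/-- `A` is a solution: the sets `S_i` are disjoint and their union is independent in `M`. -/
def IsSolution {N : Type u} [DecidableEq N] {L : ℕ} (M : Matroid N)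
    (A : Finset (N × Fin L)) : Prop :=
  Set.InjOn Prod.fst (A : Set (N × Fin L)) ∧ M.Indep (unionPart Finset.univ A : Set N)

/-- The weighted sum `∑_{J ⊆ [L]} α_{|J|} f(⋃_{i ∈ J} S_i)`. -/
def auxSubmodular {N : Type u} [DecidableEq N] {L : ℕ} (α : ℕ → ℝ) (f : Finset N → ℝ)
    (A : Finset (N × Fin L)) : ℝ :=
  ∑ J : Finset (Fin L), α J.card * f (unionPart J A)

/-- The auxiliary function that guides the search:
`∑_{J ⊆ [L]} α_{|J|} f(⋃_{i ∈ J} S_i) + c ∑_i w(S_i)`. -/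
def auxFun {N : Type u} [DecidableEq N] {L : ℕ} (α : ℕ → ℝ) (c : ℝ) (f w : Finset N → ℝ)
    (A : Finset (N × Fin L)) : ℝ :=
  auxSubmodular α f A + c * ∑ p ∈ A, w {p.1}

/-- `B` arises from `A` by a local step: at most one pair is removed and at most one is added
(so an element is moved to another set, exchanged, inserted or deleted). -/
def IsLocalStep {σ : Type u} [DecidableEq σ] (A B : Finset σ) : Prop :=
  (A \ B).card ≤ 1 ∧ (B \ A).card ≤ 1

/-- The solutions through which a local search went, in order. -/
structure SearchRun (N : Type u) (L : ℕ) : Type u where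
  start : Finset (N × Fin L)
  steps : List (Finset (N × Fin L))

namespace SearchRun

variable {N : Type u} {L : ℕ}

/-- The last solution. -/
def final (R : SearchRun N L) : Finset (N × Fin L) := R.steps.getLastD R.start

/-- The set that the search returns: the union of the `L` sets of its last solution. -/
def result [DecidableEq N] (R : SearchRun N L) : Finset N := unionPart Finset.univ R.final

/-- All members of the run are solutions, and each is obtained from the previous one by a local
step that strictly increases `Φ`. -/
def IsImproving [DecidableEq N] (M : Matroid N) (Φ : Finset (N × Fin L) → ℝ)
    (R : SearchRun N L) : Prop :=
  (∀ A ∈ R.start :: R.steps, IsSolution M A) ∧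
    (R.start :: R.steps).IsChain fun A B => IsLocalStep A B ∧ Φ A < Φ B

/-- The last solution `A` is an approximate local maximum of the guiding function
`Φ = auxFun α c f w`: with `Φ(p ∣ D) = Φ(D ∪ {p}) - Φ(D)`,
`∑_{p ∈ T} Φ(p ∣ A \ {p}) - ∑_{p ∈ A} Φ(p ∣ A \ {p})` is, for every solution `T`, at most `ε` times
the largest value of `auxSubmodular α f` on a solution. -/
def IsLocallyOptimal [DecidableEq N] (M : Matroid N) (α : ℕ → ℝ) (c : ℝ) (f w : Finset N → ℝ)
    (ε : ℝ) (R : SearchRun N L) : Prop :=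
  ∃ B : Finset (N × Fin L), IsSolution M B ∧ ∀ T : Finset (N × Fin L), IsSolution M T →
    ∑ p ∈ T, (auxFun α c f w (insert p (R.final.erase p)) - auxFun α c f w (R.final.erase p)) -
      ∑ p ∈ R.final, (auxFun α c f w R.final - auxFun α c f w (R.final.erase p)) ≤
    ε * auxSubmodular α f B

end SearchRun

/-! Approximation. Normalize f by f(∅) = 0, let S_J be the union of the S_i with i ∈ J and S the
union of all parts, and write a for `singleCoeff` and c for `linearCoeff`. Compare a local optimum
with the L solutions that put all of OPT into one part, and add the L inequalities. The recurrence
`searchCoeff_succ` makes the terms f(S_J) cancel for every proper nonempty J, and what remains is a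
f(OPT) + c ℓ(OPT) ≤ c (f(S) + ℓ(S)); this is `local_optimum_bound`. Since a / c = 1 - (1 + 1/L)^(-L)
tends to 1 - 1/e, a large L suffices. A small multiple b f(S) is kept as slack. It absorbs the error
of approximate local optima and, later, the effect of rare failures on the expectation.

Progress. Solutions are the independent sets of a matroid on pairs. By Hall's theorem
(`exists_slot_matching`) the new elements of any competitor can be assigned to distinct slots of the
current solution A with which they can be exchanged. By submodularity the exchange gains add up to
at least the violation E of local optimality, so with R = rank + 1 slots some exchange gains E / R.
If A is not η-locally optimal, then E > η g(A), while the maximum of Φ exceeds Φ(A) by at most E +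
g(A). Hence each step removes a fraction of order η / R of the gap, and the logarithm of the gap is
a potential (`exists_large_gain`, `exists_potential`).

Scale. The linear part can be negative and can dwarf f, so the logarithm needs a reference scale.
`scan` restricts the search to a part of the elements, with a bound v on their f-values, such that
little is lost outside (`outside`) and a solution violating local optimality does so by at least η δ
v / (R + 2) (a consequence of `relevant`). The initial set of maximal weight is within a R v of the
maximum of Φ. The ratio of these bounds is polynomial in n, which leaves R times a logarithmic
number of steps.

Cost. For a fixed element to be added, the best element to be removed is found by binary search over
the slots sorted by marginal value, so a full step and a test of local optimality both cost n up to
logarithms. The randomized step looks at about s = min(R, √n) slots and n L / s random candidates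
and still gains E / (2R) in expectation; R such steps cost n + R √n up to logarithms. Tests are too
expensive to be made after each cheap step. They are made after a random number of steps, when the
state is bad with probability at most 1/2, and this is repeated logarithmically often. The remaining
failure probability is so small that its product with the worst possible loss is below the slack,
which gives the bound in expectation. -/

namespace OracleAlg

variable {N : Type u} {β : Type v}

/-! ### Composition of algorithms -/

/-- Run an algorithm and continue with its result. -/
def bind {γ : Type*} : OracleAlg N β → (β → OracleAlg N γ) → OracleAlg N γ
  | output b, F => F b
  | queryValue S next, F => queryValue S fun x => (next x).bind F
  | queryLinear S next, F => queryLinear S fun x => (next x).bind F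
  | queryIndep S next, F => queryIndep S fun x => (next x).bind F
  | sample m next, F => sample m fun i => (next i).bind F

/-! ### Outcomes, query counts and expectations of composed algorithms -/

section semantics

variable {γ : Type*} (f w : Finset N → ℝ) (M : Matroid N)

theorem mem_outcomes_bind {A : OracleAlg N β} {F : β → OracleAlg N γ} {x : γ} :
    x ∈ (A.bind F).outcomes f w M ↔
      ∃ b ∈ A.outcomes f w M, x ∈ (F b).outcomes f w M := by
  induction A with
  | output b => simp [bind, outcomes]
  | queryValue S next ih => simpa [bind, outcomes] using ih _
  | queryLinear S next ih => simpa [bind, outcomes] using ih _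
  | queryIndep S next ih => simpa [bind, outcomes] using ih _
  | sample m next ih =>
    simp only [bind, outcomes, Set.mem_iUnion, ih]
    constructor
    · rintro ⟨i, b, hb, hx⟩
      exact ⟨b, ⟨i, hb⟩, hx⟩
    · rintro ⟨b, ⟨i, hb⟩, hx⟩
      exact ⟨i, b, hb, hx⟩

theorem expect_bind (A : OracleAlg N β) (F : β → OracleAlg N γ) (φ : γ → ℝ) :
    (A.bind F).expect f w M φ = A.expect f w M fun b => (F b).expect f w M φ := by
  induction A with
  | output b => rfl
  | queryValue S next ih => exact ih _
  | queryLinear S next ih => exact ih _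
  | queryIndep S next ih => exact ih _
  | sample m next ih => simp only [bind, expect, ih]

variable {f w M}

theorem queries_bind_le {A : OracleAlg N β} {F : β → OracleAlg N γ} {a k : ℕ}
    (hA : A.queries f w M ≤ a) (hF : ∀ b ∈ A.outcomes f w M, (F b).queries f w M ≤ k) :
    (A.bind F).queries f w M ≤ a + k := by
  induction A generalizing a with
  | output b => exact (hF b rfl).trans (Nat.le_add_left _ _)
  | queryValue S next ih =>
    simp only [bind, queries] at hA ⊢
    have := ih (f S) (a := a - 1) (by omega) hF
    omega
  | queryLinear S next ih =>
    simp only [bind, queries] at hA ⊢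
    have := ih (w S) (a := a - 1) (by omega) hF
    omega
  | queryIndep S next ih =>
    simp only [bind, queries] at hA ⊢
    have := ih _ (a := a - 1) (by omega) hF
    omega
  | sample m next ih =>
    simp only [bind, queries] at hA ⊢
    refine Finset.sup_le fun i _ => ih i ?_ fun b hb => hF b (Set.mem_iUnion.2 ⟨i, hb⟩)
    exact (Finset.le_sup (f := fun i => (next i).queries f w M) (Finset.mem_univ i)).trans hA

theorem expect_mono {A : OracleAlg N β} {φ ψ : β → ℝ}
    (h : ∀ b ∈ A.outcomes f w M, φ b ≤ ψ b) : A.expect f w M φ ≤ A.expect f w M ψ := by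
  induction A with
  | output b => exact h b rfl
  | queryValue S next ih => exact ih _ h
  | queryLinear S next ih => exact ih _ h
  | queryIndep S next ih => exact ih _ h
  | sample m next ih =>
    simp only [expect]
    gcongr with i
    exact ih i fun b hb => h b (Set.mem_iUnion.2 ⟨i, hb⟩)

theorem expect_congr {A : OracleAlg N β} {φ ψ : β → ℝ}
    (h : ∀ b ∈ A.outcomes f w M, φ b = ψ b) : A.expect f w M φ = A.expect f w M ψ :=
  le_antisymm (expect_mono fun b hb => (h b hb).le) (expect_mono fun b hb => (h b hb).ge)

variable (f w M)

theorem expect_const (A : OracleAlg N β) (r : ℝ) : A.expect f w M (fun _ => r) = r := by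
  induction A with
  | output b => rfl
  | queryValue S next ih => exact ih _
  | queryLinear S next ih => exact ih _
  | queryIndep S next ih => exact ih _
  | sample m next ih =>
    simp only [expect, ih, Finset.sum_const, Finset.card_univ, Fintype.card_fin, nsmul_eq_mul]
    push_cast
    field_simp

theorem expect_add (A : OracleAlg N β) (φ ψ : β → ℝ) :
    A.expect f w M (fun b => φ b + ψ b) = A.expect f w M φ + A.expect f w M ψ := by
  induction A with
  | output b => rfl
  | queryValue S next ih => exact ih _
  | queryLinear S next ih => exact ih _
  | queryIndep S next ih => exact ih _
  | sample m next ih => simp only [expect, ih, Finset.sum_add_distrib, add_div]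

theorem expect_const_mul (A : OracleAlg N β) (r : ℝ) (φ : β → ℝ) :
    A.expect f w M (fun b => r * φ b) = r * A.expect f w M φ := by
  induction A with
  | output b => rfl
  | queryValue S next ih => exact ih _
  | queryLinear S next ih => exact ih _
  | queryIndep S next ih => exact ih _
  | sample m next ih => simp only [expect, ih, ← Finset.mul_sum, mul_div_assoc]

open Classical in
theorem prob_compl (A : OracleAlg N β) (P : β → Prop) :
    A.prob f w M P = 1 - A.prob f w M (fun b => ¬ P b) := by
  rw [eq_sub_iff_add_eq, prob, prob, ← expect_add]
  refine Eq.trans (expect_congr fun b _ => ?_) (expect_const f w M A 1)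
  by_cases h : P b <;> simp [h]

/-! ### Making an algorithm deterministic -/

/-- Replace every random choice by the first possibility. -/
def derandomize : OracleAlg N β → OracleAlg N β
  | output b => output b
  | queryValue S next => queryValue S fun x => (next x).derandomize
  | queryLinear S next => queryLinear S fun x => (next x).derandomize
  | queryIndep S next => queryIndep S fun x => (next x).derandomize
  | sample _ next => (next 0).derandomize

theorem deterministic_derandomize (A : OracleAlg N β) : A.derandomize.Deterministic := by
  induction A with
  | output b => trivial
  | queryValue S next ih => exact ih
  | queryLinear S next ih => exact ih
  | queryIndep S next ih => exact ih
  | sample m next ih => exact ih 0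

/-- Whatever holds for all outcomes of an algorithm thereby holds for the one result of its
derandomization. -/
theorem exists_outcomes_derandomize_eq (A : OracleAlg N β) :
    ∃ b ∈ A.outcomes f w M, A.derandomize.outcomes f w M = {b} := by
  induction A with
  | output b => exact ⟨b, rfl, rfl⟩
  | queryValue S next ih => exact ih _
  | queryLinear S next ih => exact ih _
  | queryIndep S next ih => exact ih _
  | sample m next ih =>
    obtain ⟨b, hb, h⟩ := ih 0
    exact ⟨b, Set.mem_iUnion.2 ⟨0, hb⟩, h⟩

theorem queries_derandomize_le (A : OracleAlg N β) :
    A.derandomize.queries f w M ≤ A.queries f w M := by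
  induction A with
  | output b => exact le_rfl
  | queryValue S next ih => exact Nat.succ_le_succ (ih _)
  | queryLinear S next ih => exact Nat.succ_le_succ (ih _)
  | queryIndep S next ih => exact Nat.succ_le_succ (ih _)
  | sample m next ih =>
    exact (ih 0).trans
      (Finset.le_sup (f := fun i => (next i).queries f w M) (Finset.mem_univ 0))

/-! ### Shifting the answers of the value oracle -/

/-- Subtract `y` from all answers of the first value oracle. -/
def shiftValue (y : ℝ) : OracleAlg N β → OracleAlg N β
  | output b => output b
  | queryValue S next => queryValue S fun x => (next (x - y)).shiftValue y
  | queryLinear S next => queryLinear S fun x => (next x).shiftValue y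
  | queryIndep S next => queryIndep S fun x => (next x).shiftValue y
  | sample m next => sample m fun i => (next i).shiftValue y

theorem outcomes_shiftValue (y : ℝ) (A : OracleAlg N β) :
    (A.shiftValue y).outcomes f w M = A.outcomes (fun S => f S - y) w M := by
  induction A with
  | output b => rfl
  | queryValue S next ih => exact ih _
  | queryLinear S next ih => exact ih _
  | queryIndep S next ih => exact ih _
  | sample m next ih => simp only [shiftValue, outcomes, ih]

theorem queries_shiftValue (y : ℝ) (A : OracleAlg N β) :
    (A.shiftValue y).queries f w M = A.queries (fun S => f S - y) w M := by
  induction A with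
  | output b => rfl
  | queryValue S next ih => exact congrArg (· + 1) (ih _)
  | queryLinear S next ih => exact congrArg (· + 1) (ih _)
  | queryIndep S next ih => exact congrArg (· + 1) (ih _)
  | sample m next ih => simp only [shiftValue, queries, ih]

theorem expect_shiftValue (y : ℝ) (A : OracleAlg N β) (φ : β → ℝ) :
    (A.shiftValue y).expect f w M φ = A.expect (fun S => f S - y) w M φ := by
  induction A with
  | output b => rfl
  | queryValue S next ih => exact ih _
  | queryLinear S next ih => exact ih _
  | queryIndep S next ih => exact ih _
  | sample m next ih => simp only [shiftValue, expect, ih]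

/-! ### Algorithms with a certain result -/

/-- The algorithm certainly returns `b`, after at most `k` queries. -/
structure Computes (A : OracleAlg N β) (b : β) (k : ℕ) : Prop where
  outcomes_eq : A.outcomes f w M = {b}
  queries_le : A.queries f w M ≤ k
  expect_eq : ∀ φ : β → ℝ, A.expect f w M φ = φ b

variable {f w M}

theorem computes_output (b : β) (k : ℕ) : Computes f w M (output b) b k :=
  ⟨rfl, Nat.zero_le _, fun _ => rfl⟩

theorem computes_queryValue (S : Finset N) : Computes f w M (queryValue S output) (f S) 1 :=
  ⟨rfl, le_rfl, fun _ => rfl⟩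

theorem computes_queryLinear (S : Finset N) : Computes f w M (queryLinear S output) (w S) 1 :=
  ⟨rfl, le_rfl, fun _ => rfl⟩

open Classical in
theorem computes_queryIndep (S : Finset N) :
    Computes f w M (queryIndep S output) (decide (M.Indep (S : Set N))) 1 :=
  ⟨rfl, le_rfl, fun _ => rfl⟩

theorem Computes.mono {A : OracleAlg N β} {b : β} {k k' : ℕ} (h : Computes f w M A b k)
    (hk : k ≤ k') : Computes f w M A b k' :=
  ⟨h.outcomes_eq, h.queries_le.trans hk, h.expect_eq⟩

theorem Computes.bind {A : OracleAlg N β} {F : β → OracleAlg N γ} {b : β} {x : γ} {k k' : ℕ}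
    (hA : Computes f w M A b k) (hF : Computes f w M (F b) x k') :
    Computes f w M (A.bind F) x (k + k') := by
  refine ⟨?_, ?_, fun φ => ?_⟩
  · ext y
    rw [mem_outcomes_bind, hA.outcomes_eq]
    simp [hF.outcomes_eq]
  · refine queries_bind_le hA.queries_le ?_
    rw [hA.outcomes_eq]
    rintro _ rfl
    exact hF.queries_le
  · rw [expect_bind, hA.expect_eq, hF.expect_eq]

theorem Computes.outcomes_bind {A : OracleAlg N β} {b : β} {k : ℕ} (hA : Computes f w M A b k)
    (F : β → OracleAlg N γ) : (A.bind F).outcomes f w M = (F b).outcomes f w M := by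
  ext y
  rw [mem_outcomes_bind, hA.outcomes_eq]
  simp

theorem Computes.queries_bind {A : OracleAlg N β} {b : β} {k k' : ℕ}
    (hA : Computes f w M A b k) {F : β → OracleAlg N γ} (hF : (F b).queries f w M ≤ k') :
    (A.bind F).queries f w M ≤ k + k' := by
  refine queries_bind_le hA.queries_le ?_
  rw [hA.outcomes_eq]
  rintro _ rfl
  exact hF

theorem Computes.expect_bind {A : OracleAlg N β} {b : β} {k : ℕ} (hA : Computes f w M A b k)
    (F : β → OracleAlg N γ) (φ : γ → ℝ) :
    (A.bind F).expect f w M φ = (F b).expect f w M φ := by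
  rw [OracleAlg.expect_bind, hA.expect_eq]

/-! ### Tables -/

/-- Compute a table of the results of `F` at the members of a list. -/
def tabulate {X : Type*} [DecidableEq X] [Inhabited β] (F : X → OracleAlg N β) :
    List X → OracleAlg N (X → β)
  | [] => output fun _ => default
  | x :: l => (F x).bind fun b => (tabulate F l).bind fun t => output (Function.update t x b)

theorem exists_computes_tabulate {X : Type*} [DecidableEq X] [Inhabited β]
    {F : X → OracleAlg N β} {val : X → β} {k : ℕ} (l : List X)
    (h : ∀ x ∈ l, Computes f w M (F x) (val x) k) :
    ∃ t : X → β, Computes f w M (tabulate F l) t (l.length * k) ∧ ∀ x ∈ l, t x = val x := by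
  induction l with
  | nil => exact ⟨_, computes_output _ _, by simp⟩
  | cons x l ih =>
    obtain ⟨t, ht, hv⟩ := ih fun y hy => h y (List.mem_cons_of_mem _ hy)
    refine ⟨Function.update t x (val x), ?_, fun y hy => ?_⟩
    · refine ((h x List.mem_cons_self).bind (k' := l.length * k + 0)
        (ht.bind (F := fun t => output (Function.update t x (val x)))
          (computes_output _ 0))).mono ?_
      rw [List.length_cons]
      linarith
    · by_cases hyx : y = x
      · simp [hyx]
      · rw [Function.update_of_ne hyx]
        exact hv y ((List.mem_cons.1 hy).resolve_left hyx)

theorem computes_tabulate_univ {X : Type*} [Fintype X] [DecidableEq X] [Inhabited β]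
    {F : X → OracleAlg N β} {val : X → β} {k : ℕ} (h : ∀ x, Computes f w M (F x) (val x) k) :
    Computes f w M (tabulate F Finset.univ.toList) val (Fintype.card X * k) := by
  obtain ⟨t, ht, hv⟩ := exists_computes_tabulate Finset.univ.toList fun x _ => h x
  rw [Finset.length_toList] at ht
  obtain rfl : t = val := funext fun x => hv x (by simp)
  exact ht

/-! ### Random choices from a finite type -/

/-- A uniformly random element of a finite type. -/
noncomputable def uniform (X : Type*) [Fintype X] [Nonempty X] : OracleAlg N X :=
  sample (Fintype.card X - 1) fun i =>
    output ((Fintype.equivFin X).symm (Fin.cast (Nat.sub_add_cancel Fintype.card_pos) i))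

theorem expect_uniform (X : Type*) [Fintype X] [Nonempty X] (φ : X → ℝ) :
    (uniform X : OracleAlg N X).expect f w M φ = (∑ x, φ x) / Fintype.card X := by
  have h : Fintype.card X - 1 + 1 = Fintype.card X := Nat.sub_add_cancel Fintype.card_pos
  simp only [uniform, expect]
  congr 1
  · exact Fintype.sum_equiv ((finCongr h).trans (Fintype.equivFin X).symm) _ _ fun i => rfl
  · exact_mod_cast h

theorem queries_uniform (X : Type*) [Fintype X] [Nonempty X] :
    (uniform X : OracleAlg N X).queries f w M = 0 := by
  simp [uniform, queries]

/-- A list of independent uniformly random elements of a finite type. -/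
noncomputable def uniformList (X : Type*) [Fintype X] [Nonempty X] :
    ℕ → OracleAlg N (List X)
  | 0 => output []
  | m + 1 => (uniform X).bind fun x => (uniformList X m).bind fun l => output (x :: l)

theorem queries_uniformList (X : Type*) [Fintype X] [Nonempty X] (m : ℕ) :
    (uniformList X m : OracleAlg N (List X)).queries f w M = 0 := by
  induction m with
  | zero => rfl
  | succ m ih =>
    refine Nat.le_zero.1 (queries_bind_le (a := 0) (k := 0) (queries_uniform X).le fun x _ => ?_)
    exact queries_bind_le (a := 0) (k := 0) ih.le fun l _ => le_rfl

theorem length_of_mem_outcomes_uniformList {X : Type*} [Fintype X] [Nonempty X] {m : ℕ}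
    {l : List X} (hl : l ∈ (uniformList X m : OracleAlg N (List X)).outcomes f w M) :
    l.length = m := by
  induction m generalizing l with
  | zero => simpa [uniformList, outcomes] using hl
  | succ m ih =>
    obtain ⟨x, -, h⟩ := (mem_outcomes_bind ..).1 hl
    obtain ⟨l', h', h''⟩ := (mem_outcomes_bind ..).1 h
    obtain rfl : l = x :: l' := h''
    simp [ih h']

end semantics

end OracleAlg

/-! ### Exchanges in matroids on a finite type -/

section exchange

variable {σ : Type u} {M : Matroid σ}

theorem Matroid.Indep.card_le_of_subset_closure {X Y : Finset σ} (hX : M.Indep (X : Set σ))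
    (h : (X : Set σ) ⊆ M.closure Y) : X.card ≤ Y.card := by
  have h1 := hX.encard_le_eRk_of_subset h
  rw [M.eRk_closure_eq] at h1
  have h2 := h1.trans (M.eRk_le_encard Y)
  rw [Set.encard_coe_eq_coe_finsetCard, Set.encard_coe_eq_coe_finsetCard] at h2
  exact_mod_cast h2

theorem Matroid.Indep.card_le_eRank_toNat [Finite σ] {X : Finset σ} (hX : M.Indep (X : Set σ)) :
    X.card ≤ M.eRank.toNat := by
  have h := hX.encard_le_eRank
  rw [Set.encard_coe_eq_coe_finsetCard] at h
  have hfin : M.eRank ≠ ⊤ := by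
    have := M.eRank_le_encard_ground
    exact ne_top_of_le_ne_top (Set.encard_ne_top_iff.2 (Set.toFinite _)) this
  exact (ENat.natCast_le_natCast.1 ((ENat.natCast_toNat hfin).symm ▸ h))

theorem Matroid.Indep.mem_closure_of_not_indep_insert (hE : M.E = Set.univ) {A : Set σ}
    (hA : M.Indep A) {x : σ} (h : ¬ M.Indep (insert x A)) : x ∈ M.closure A := by
  by_contra hx
  exact h ((hA.notMem_closure_iff (by rw [hE]; trivial)).1 hx).1

theorem Matroid.Indep.not_indep_insert_of_mem_closure {A : Set σ} (hA : M.Indep A) {x : σ}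
    (hx : x ∉ A) (h : x ∈ M.closure A) : ¬ M.Indep (insert x A) := by
  intro hi
  exact ((hA.insert_indep_iff_of_notMem hx).1 hi).2 h

/-- A certificate for `S` being an independent subset of maximal weight of the members of `l`. -/
structure IsWeightCert (M : Matroid σ) (ω : σ → ℝ) (l : List σ) (S : Finset σ) : Prop where
  indep : M.Indep (S : Set σ)
  mem : ∀ x ∈ S, x ∈ l
  pos : ∀ x ∈ S, 0 < ω x
  -- Spanning by the elements that are at least as heavy is a form of optimality that survives
  -- single exchanges and yields Hall's condition in `IsWeightCert.sum_le`.
  mem_closure : ∀ x ∈ l, 0 < ω x →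
    x ∈ M.closure ((S.filter fun s => ω x ≤ ω s : Finset σ) : Set σ)

theorem isWeightCert_nil (ω : σ → ℝ) : IsWeightCert M ω [] ∅ :=
  ⟨by simp, by simp, by simp, by simp⟩

variable [DecidableEq σ]

/-- Remove `p` (if it is an element) and add `q` (if it is an element). -/
def swapSet (A : Finset σ) (p q : Option σ) : Finset σ := A \ p.toFinset ∪ q.toFinset

/-- The members of a list of optional elements. -/
def listElems (ps : List (Option σ)) : Finset σ := ps.reduceOption.toFinset

theorem mem_listElems {ps : List (Option σ)} {x : σ} : x ∈ listElems ps ↔ some x ∈ ps := by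
  simp [listElems, List.reduceOption_mem_iff]

/-- In the closure of an independent set, one may delete all elements that are not needed
individually. -/
theorem Matroid.Indep.mem_closure_sdiff {A : Finset σ} (hA : M.Indep (A : Set σ)) {x : σ}
    (hx : x ∈ M.closure A) (Z : Finset σ) (h : ∀ p ∈ Z, x ∈ M.closure ((A.erase p : Finset σ) : Set σ)) :
    x ∈ M.closure ((A \ Z : Finset σ) : Set σ) := by
  induction Z using Finset.induction_on with
  | empty => simpa using hx
  | insert p Z hp ih =>
    have h1 := ih fun p' hp' => h p' (Finset.mem_insert_of_mem hp')
    have h2 := h p (Finset.mem_insert_self _ _)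
    have h3 : M.Indep (((A \ Z : Finset σ) : Set σ) ∪ (A.erase p : Finset σ)) := by
      refine hA.subset ?_
      rw [← Finset.coe_union]
      exact_mod_cast Finset.union_subset Finset.sdiff_subset (Finset.erase_subset _ _)
    have h4 : A \ insert p Z = (A \ Z) ∩ A.erase p := by
      ext y
      simp only [Finset.mem_sdiff, Finset.mem_insert, Finset.mem_inter, Finset.mem_erase]
      tauto
    -- For sets with an independent union, closure commutes with intersection.
    rw [h4, Finset.coe_inter, h3.closure_inter_eq_inter_closure]
    exact ⟨h1, h2⟩

/-- The candidate found by a binary search for the number of elements that have to be removed. -/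
theorem swap_feasible_of_search (hE : M.E = Set.univ) {A : Finset σ} (hA : M.Indep (A : Set σ))
    {ps : List (Option σ)} {q : Option σ} (hq : ∀ x ∈ q, x ∉ A) {m : ℕ}
    (h1 : 1 ≤ m) (hm : m ≤ ps.length)
    (hB : m = ps.length ∨
      M.Indep ((A \ listElems (ps.take m) ∪ q.toFinset : Finset σ) : Set σ))
    (hB' : m = 1 ∨
      ¬ M.Indep ((A \ listElems (ps.take (m - 1)) ∪ q.toFinset : Finset σ) : Set σ))
    {k : ℕ} (hk : k < ps.length) (hf : M.Indep (swapSet A ps[k] q : Set σ)) :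
    m - 1 ≤ k ∧ M.Indep (swapSet A (ps[m - 1]'(by omega)) q : Set σ) := by
  -- Once the feasible position `k` is among the removed ones, removing more keeps the set
  -- independent, so every later test succeeds.
  have hmono : ∀ j, k < j →
      M.Indep ((A \ listElems (ps.take j) ∪ q.toFinset : Finset σ) : Set σ) := by
    intro j hj
    refine hf.subset (Finset.coe_subset.2 (Finset.union_subset_union_left ?_))
    intro y hy
    simp only [Finset.mem_sdiff, mem_listElems, Option.mem_toFinset, Option.mem_def] at hy ⊢
    refine ⟨hy.1, fun hyk => hy.2 ?_⟩
    rw [← hyk]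
    exact List.mem_iff_getElem.2 ⟨k, by simp; omega, by simp⟩
  have hle : m - 1 ≤ k := by
    by_contra hlt
    rcases hB' with rfl | hB'
    · omega
    · exact hB' (hmono _ (by omega))
  refine ⟨hle, ?_⟩
  have hBm : M.Indep ((A \ listElems (ps.take m) ∪ q.toFinset : Finset σ) : Set σ) := by
    rcases hB with rfl | hB
    · exact hmono _ hk
    · exact hB
  have hlast : listElems (ps.take m) =
      listElems (ps.take (m - 1)) ∪ (ps[m - 1]'(by omega)).toFinset := by
    obtain ⟨m, rfl⟩ : ∃ j, m = j + 1 := ⟨m - 1, by omega⟩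
    ext y
    simp only [mem_listElems, Finset.mem_union, Nat.add_sub_cancel, Option.mem_toFinset,
      Option.mem_def]
    rw [← List.take_concat_get' ps m (by omega)]
    simp only [List.mem_append, List.mem_singleton]
    rw [eq_comm (a := some y)]
  rcases hB' with rfl | hB'
  · have h0 : listElems (ps.take (1 - 1)) = ∅ := by simp [listElems]
    rw [hlast, h0, Finset.empty_union] at hBm
    exact hBm
  rcases q with _ | x
  -- If nothing is added, the tested set is a subset of `A`, so the test cannot fail.
  · exact absurd (hA.subset (by simp)) hB'
  have hxA : x ∉ A := hq x rfl
  set Z := listElems (ps.take (m - 1)) with hZ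
  have hsub : ∀ Y : Finset σ, M.Indep ((A \ Y : Finset σ) : Set σ) := fun Y =>
    hA.subset (by simp)
  have hunion : ∀ Y : Finset σ, ((A \ Y ∪ (some x).toFinset : Finset σ) : Set σ) =
      insert x ((A \ Y : Finset σ) : Set σ) := by
    intro Y
    ext y
    simp
  rw [hunion] at hB' hBm
  -- `x` is spanned by `A` without the first `m - 1` entries. Were it also spanned by `A` without
  -- the next entry alone, it would be spanned by the intersection of both sets, against the success
  -- of the test at `m`.
  have hcl := (hsub Z).mem_closure_of_not_indep_insert hE hB'
  rw [swapSet, hunion]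
  by_contra hcon
  have hcl2 := (hsub _).mem_closure_of_not_indep_insert hE hcon
  refine (hsub _).not_indep_insert_of_mem_closure (by simp [hxA]) ?_ hBm
  have h3 : M.Indep (((A \ Z : Finset σ) : Set σ) ∪
      ((A \ (ps[m - 1]'(by omega)).toFinset : Finset σ) : Set σ)) := by
    refine hA.subset ?_
    rw [← Finset.coe_union]
    exact_mod_cast Finset.union_subset Finset.sdiff_subset Finset.sdiff_subset
  have h4 : A \ listElems (ps.take m) = (A \ Z) ∩ (A \ (ps[m - 1]'(by omega)).toFinset) := by
    rw [hlast, Finset.sdiff_union_distrib]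
  rw [h4, Finset.coe_inter, h3.closure_inter_eq_inter_closure]
  exact ⟨hcl, hcl2⟩

/-! ### Independent sets of maximal weight -/

/-- Certified independent sets have maximal weight. -/
theorem IsWeightCert.sum_le {ω : σ → ℝ} {l : List σ} {S : Finset σ} (h : IsWeightCert M ω l S)
    {T : Finset σ} (hT : M.Indep (T : Set σ)) (hTl : ∀ x ∈ T, x ∈ l) :
    ∑ x ∈ T, ω x ≤ ∑ x ∈ S, ω x := by
  classical
  set T' := T.filter fun x => 0 < ω x with hT'
  -- Hall's condition: all of `X` is spanned by the elements of `S` that are at least as heavy as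
  -- the lightest element of `X`, so there are enough of them.
  have hall : ∀ X : Finset T', X.card ≤
      (X.biUnion fun x => S.filter fun s => ω x ≤ ω s).card := by
    intro X
    rcases X.eq_empty_or_nonempty with rfl | hX
    · simp
    obtain ⟨x0, hx0, hmin⟩ := X.exists_min_image (fun x => ω x) hX
    have hx0' := Finset.mem_filter.1 x0.2
    calc X.card = (X.map (Function.Embedding.subtype _)).card := by simp
      _ ≤ (S.filter fun s => ω x0 ≤ ω s).card := by
        refine Matroid.Indep.card_le_of_subset_closure (M := M) (hT.subset ?_) ?_
        · intro y hy
          simp only [Finset.coe_map, Set.mem_image] at hy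
          obtain ⟨z, -, rfl⟩ := hy
          exact (Finset.mem_filter.1 z.2).1
        · intro y hy
          simp only [Finset.coe_map, Set.mem_image] at hy
          obtain ⟨z, hz, rfl⟩ := hy
          have hz' := Finset.mem_filter.1 z.2
          refine M.closure_subset_closure ?_ (h.mem_closure z (hTl _ hz'.1) hz'.2)
          intro s hs
          simp only [Finset.coe_filter, Set.mem_ofPred_eq] at hs ⊢
          exact ⟨hs.1, (hmin z hz).trans hs.2⟩
      _ ≤ _ := Finset.card_le_card fun s hs => Finset.mem_biUnion.2 ⟨x0, hx0, hs⟩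
  obtain ⟨g, hg, hgm⟩ := (Finset.all_card_le_biUnion_card_iff_exists_injective _).1 hall
  calc ∑ x ∈ T, ω x ≤ ∑ x ∈ T', ω x := by
        rw [hT', Finset.sum_filter]
        refine Finset.sum_le_sum fun x _ => ?_
        split_ifs with hx
        · exact le_rfl
        · exact not_lt.1 hx
    _ = ∑ x : T', ω x := (Finset.sum_coe_sort T' ω).symm
    _ ≤ ∑ x : T', ω (g x) := Finset.sum_le_sum fun x _ => (Finset.mem_filter.1 (hgm x)).2
    _ = ∑ y ∈ Finset.univ.image g, ω y := (Finset.sum_image fun x _ y _ e => hg e).symm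
    _ ≤ ∑ x ∈ S, ω x := by
        refine Finset.sum_le_sum_of_subset_of_nonneg ?_ fun x hx _ => (h.pos x hx).le
        intro y hy
        obtain ⟨x, -, rfl⟩ := Finset.mem_image.1 hy
        exact (Finset.mem_filter.1 (hgm x)).1

/-- The certificate survives if a new element does not improve the set. -/
theorem IsWeightCert.cons_of_not_improving {ω : σ → ℝ} {l : List σ} {S : Finset σ}
    (hE : M.E = Set.univ)
    (h : IsWeightCert M ω l S) {x : σ} (hx : x ∉ S)
    (hno : 0 < ω x → ¬ M.Indep (swapSet S none (some x) : Set σ))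
    (hmin : ∀ p ∈ S, M.Indep (swapSet S (some p) (some x) : Set σ) → ω x ≤ ω p) :
    IsWeightCert M ω (x :: l) S := by
  refine ⟨h.indep, fun y hy => List.mem_cons_of_mem _ (h.mem y hy), h.pos, fun y hy hpos => ?_⟩
  rcases List.mem_cons.1 hy with rfl | hy
  · have e : ∀ p : Option σ, ((swapSet S p (some y) : Finset σ) : Set σ) =
        insert y ((S \ p.toFinset : Finset σ) : Set σ) := by
      intro p
      ext z
      simp [swapSet]
    have h0 : y ∈ M.closure S := by
      have := hno hpos
      rw [e] at this
      simpa using (h.indep.subset (by simp)).mem_closure_of_not_indep_insert hE this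
    -- An element lighter than `y` cannot be exchanged with it, so it is not needed to span `y`. All
    -- such elements can then be dropped together.
    have := h.indep.mem_closure_sdiff h0 (S.filter fun s => ω s < ω y) fun p hp => by
      rw [Finset.mem_filter] at hp
      by_contra hcl
      refine absurd (hmin p hp.1 ?_) (not_le.2 hp.2)
      by_contra hni
      rw [e] at hni
      have h2 := (h.indep.subset (by simp)).mem_closure_of_not_indep_insert hE hni
      apply hcl
      simpa [Finset.sdiff_singleton_eq_erase] using h2
    have e2 : S \ (S.filter fun s => ω s < ω y) = S.filter fun s => ω y ≤ ω s := by
      ext z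
      simp only [Finset.mem_sdiff, Finset.mem_filter]
      constructor
      · rintro ⟨hz, hz'⟩
        exact ⟨hz, not_lt.1 fun hlt => hz' ⟨hz, hlt⟩⟩
      · rintro ⟨hz, hz'⟩
        exact ⟨hz, fun hlt => absurd hlt.2 (not_lt.2 hz')⟩
    rwa [e2] at this
  · exact h.mem_closure y hy hpos

/-- The certificate survives an exchange with the lightest element that can be exchanged. -/
theorem IsWeightCert.cons_swap {ω : σ → ℝ} {l : List σ} {S : Finset σ} (hE : M.E = Set.univ)
    (h : IsWeightCert M ω l S) {x : σ} (hx : x ∉ S) (hxpos : 0 < ω x)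
    {p : Option σ} (hpx : ∀ y ∈ p, ω y < ω x)
    (hf : M.Indep (swapSet S p (some x) : Set σ))
    (hno : p ≠ none → ¬ M.Indep (swapSet S none (some x) : Set σ))
    (hmin : ∀ y ∈ p, ∀ p' ∈ S, M.Indep (swapSet S (some p') (some x) : Set σ) → ω y ≤ ω p') :
    IsWeightCert M ω (x :: l) (swapSet S p (some x)) := by
  have hmemS : ∀ y, y ∈ swapSet S p (some x) ↔ (y ∈ S ∧ y ∉ p) ∨ y = x := by
    intro y
    simp only [swapSet, Finset.mem_union, Finset.mem_sdiff, Option.mem_toFinset, Option.mem_def,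
      Option.some.injEq, eq_comm (a := x)]
  refine ⟨hf, fun y hy => ?_, fun y hy => ?_, ?_⟩
  · rcases (hmemS y).1 hy with ⟨hy, -⟩ | rfl
    · exact List.mem_cons_of_mem _ (h.mem y hy)
    · exact List.mem_cons_self
  · rcases (hmemS y).1 hy with ⟨hy, -⟩ | rfl
    · exact h.pos y hy
    · exact hxpos
  have hself : ∀ y, ω y ≤ ω x → x ∈ M.closure
      (((swapSet S p (some x)).filter fun s => ω y ≤ ω s : Finset σ) : Set σ) := by
    intro y hyx
    refine M.mem_closure_of_mem' ?_ (by rw [hE]; trivial)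
    simp only [Finset.coe_filter, Set.mem_ofPred_eq]
    exact ⟨(hmemS x).2 (Or.inr rfl), hyx⟩
  intro y hy hpos
  rcases List.mem_cons.1 hy with rfl | hy
  · exact hself _ le_rfl
  have hcl := h.mem_closure y hy hpos
  refine M.closure_subset_closure_of_subset_closure ?_ hcl
  intro s hs
  simp only [Finset.coe_filter, Set.mem_ofPred_eq] at hs
  by_cases hsp : s ∈ p
  · obtain rfl : p = some s := hsp
    have hys : ω y ≤ ω s := hs.2
    have hsx := hpx s rfl
    -- exchange `s` with `x`
    set D := S.filter fun s' => ω s ≤ ω s' with hD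
    have e : ∀ p : Option σ, ((swapSet S p (some x) : Finset σ) : Set σ) =
        insert x ((S \ p.toFinset : Finset σ) : Set σ) := by
      intro p
      ext z
      simp [swapSet]
    -- `s` is the lightest element exchangeable with `x`, so no element lighter than `s` is needed
    -- to span `x`.
    have hxD : x ∈ M.closure (D : Set σ) := by
      have h0 : x ∈ M.closure S := by
        have := hno (by simp)
        rw [e] at this
        simpa using (h.indep.subset (by simp)).mem_closure_of_not_indep_insert hE this
      have := h.indep.mem_closure_sdiff h0 (S.filter fun s' => ω s' < ω s) fun p' hp' => by
        rw [Finset.mem_filter] at hp'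
        by_contra hcl'
        refine absurd (hmin s rfl p' hp'.1 ?_) (not_le.2 hp'.2)
        by_contra hni
        rw [e] at hni
        have h2 := (h.indep.subset (by simp)).mem_closure_of_not_indep_insert hE hni
        apply hcl'
        simpa [Finset.sdiff_singleton_eq_erase] using h2
      have e2 : S \ (S.filter fun s' => ω s' < ω s) = D := by
        ext z
        simp only [hD, Finset.mem_sdiff, Finset.mem_filter]
        constructor
        · rintro ⟨hz, hz'⟩
          exact ⟨hz, not_lt.1 fun hlt => hz' ⟨hz, hlt⟩⟩
        · rintro ⟨hz, hz'⟩
          exact ⟨hz, fun hlt => absurd hlt.2 (not_lt.2 hz')⟩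
      rwa [e2] at this
    have hxnot : x ∉ M.closure ((D.erase s : Finset σ) : Set σ) := by
      intro hxc
      rw [e] at hf
      refine (h.indep.subset (by simp)).not_indep_insert_of_mem_closure ?_ ?_ hf
      · simp [hx]
      · refine M.closure_subset_closure ?_ hxc
        intro z hz
        simp only [Finset.coe_erase, hD, Finset.coe_filter, Set.mem_sdiff, Set.mem_ofPred_eq,
          Set.mem_singleton_iff] at hz
        simp [hz.1.1, hz.2]
    have hins : insert s ((D.erase s : Finset σ) : Set σ) = D := by
      rw [← Finset.coe_insert, Finset.insert_erase]
      simp [hD, hs.1]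
    -- The exchange property puts the removed `s` into the span of `x` and the rest of `D`, all of
    -- which are at least as heavy as `s`. Hence what `s` helped to span is still spanned.
    have := (M.closure_exchange (X := ((D.erase s : Finset σ) : Set σ)) (e := x) (f := s)
      ⟨by rwa [hins], hxnot⟩).1
    refine M.closure_subset_closure ?_ this
    intro z hz
    simp only [Finset.coe_filter, Set.mem_ofPred_eq]
    rcases hz with rfl | hz
    · exact ⟨(hmemS z).2 (Or.inr rfl), hys.trans hsx.le⟩
    · simp only [Finset.coe_erase, hD, Finset.coe_filter, Set.mem_sdiff, Set.mem_ofPred_eq,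
        Set.mem_singleton_iff] at hz
      refine ⟨(hmemS z).2 (Or.inl ⟨hz.1.1, ?_⟩), hys.trans hz.1.2⟩
      simpa [eq_comm] using hz.2
  · refine M.mem_closure_of_mem' ?_ (by rw [hE]; trivial)
    simp only [Finset.coe_filter, Set.mem_ofPred_eq]
    exact ⟨(hmemS s).2 (Or.inl ⟨hs.1, hsp⟩), hs.2⟩

end exchange

/-! ### Matching the elements of two independent sets -/

section matching

variable {σ : Type u}

/-- The elements of `A` are put into `R` slots. -/
noncomputable def slot (A : Finset σ) {R : ℕ} (k : Fin R) : Option σ := A.toList[(k : ℕ)]?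

theorem mem_of_slot_eq {A : Finset σ} {R : ℕ} {k : Fin R} {p : σ} (h : slot A k = some p) :
    p ∈ A :=
  Finset.mem_toList.1 (List.mem_of_getElem? h)

theorem exists_slot_eq {A : Finset σ} {R : ℕ} (hR : A.card ≤ R) {p : σ} (hp : p ∈ A) :
    ∃ k : Fin R, slot A k = some p := by
  obtain ⟨i, hi, h⟩ := List.mem_iff_getElem.1 (Finset.mem_toList.2 hp)
  refine ⟨⟨i, ?_⟩, ?_⟩
  · rw [Finset.length_toList] at hi
    omega
  · simp [slot, h, List.getElem?_eq_getElem hi]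

theorem slot_injective {A : Finset σ} {R : ℕ} {k k' : Fin R} {p : σ} (h : slot A k = some p)
    (h' : slot A k' = some p) : k = k' := by
  obtain ⟨hk, -⟩ := List.getElem?_eq_some_iff.1 h
  exact Fin.ext ((List.getElem?_inj hk A.nodup_toList).1 (h.trans h'.symm))

variable [DecidableEq σ] {M : Matroid σ}

theorem sum_slot {A : Finset σ} {R : ℕ} [NeZero R] (hR : A.card ≤ R) (Z : Finset σ) (hZ : Z ⊆ A)
    (ω : σ → ℝ) :
    ∑ k : Fin R, (((slot A k).filter (· ∈ Z)).elim 0 ω) = ∑ p ∈ Z, ω p := by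
  classical
  have : Nonempty (Fin R) := ⟨0⟩
  choose! g hg using fun p (hp : p ∈ A) => exists_slot_eq hR hp
  have hinj : Set.InjOn g Z := fun p hp p' hp' e => by
    have h1 := hg p (hZ hp)
    rw [e, hg p' (hZ hp')] at h1
    exact (Option.some.inj h1).symm
  rw [← Finset.sum_subset (Finset.subset_univ (Z.image g)), Finset.sum_image hinj]
  · refine Finset.sum_congr rfl fun p hp => ?_
    rw [hg p (hZ hp)]
    simp [Option.filter, hp]
  · intro k _ hk
    rcases h : slot A k with _ | p
    · simp
    · have : p ∉ Z := fun hp => hk (Finset.mem_image.2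
        ⟨p, hp, slot_injective (hg p (hZ hp)) h⟩)
      simp [Option.filter, this]

/-- There is a way to assign different slots to the elements of `T \ A` so that each can be
exchanged with the content of its slot. -/
theorem exists_slot_matching (hE : M.E = Set.univ) {A T : Finset σ} (hA : M.Indep (A : Set σ))
    (hT : M.Indep (T : Set σ)) {R : ℕ} [NeZero R] (hAR : A.card ≤ R) (hTR : T.card ≤ R) :
    ∃ g : (T \ A : Finset σ) → Fin R, Function.Injective g ∧ ∀ q : (T \ A : Finset σ),
      (∀ p ∈ slot A (g q), p ∉ T) ∧ M.Indep (swapSet A (slot A (g q)) (some q.1) : Set σ) := by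
  classical
  have e : ∀ (p : Option σ) (q : σ), ((swapSet A p (some q) : Finset σ) : Set σ) =
      insert q ((A \ p.toFinset : Finset σ) : Set σ) := by
    intro p q
    ext z
    simp [swapSet]
  let t : (T \ A : Finset σ) → Finset (Fin R) := fun q => Finset.univ.filter fun k =>
    (∀ p ∈ slot A k, p ∉ T) ∧ M.Indep (swapSet A (slot A k) (some q.1) : Set σ)
  have : Nonempty (Fin R) := ⟨0⟩
  have key : ∃ g : (T \ A : Finset σ) → Fin R, Function.Injective g ∧ ∀ q, g q ∈ t q := by
    refine (Finset.all_card_le_biUnion_card_iff_exists_injective t).1 fun X => ?_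
    choose! g hg using fun p (hp : p ∈ A) => exists_slot_eq (R := R) hAR hp
    have hinj : ∀ Z ⊆ A, Set.InjOn g Z := fun Z hZ p hp p' hp' e => by
      have h1 := hg p (hZ hp)
      rw [e, hg p' (hZ hp')] at h1
      exact (Option.some.inj h1).symm
    -- If some element of `X` can be inserted outright, every slot whose content is not in `T` is
    -- available to it. These are at least `R - |A ∩ T|` slots, enough for all of `T \ A`.
    by_cases hins : ∃ q ∈ X, M.Indep (insert q.1 (A : Set σ))
    · obtain ⟨q, hq, hqi⟩ := hins
      have hsub : Finset.univ \ (A ∩ T).image g ⊆ X.biUnion t := by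
        intro k hk
        refine Finset.mem_biUnion.2 ⟨q, hq, Finset.mem_filter.2 ⟨Finset.mem_univ _, ?_, ?_⟩⟩
        · intro p hp hpT
          have hpA := mem_of_slot_eq hp
          refine (Finset.mem_sdiff.1 hk).2 (Finset.mem_image.2 ⟨p, by simp [hpA, hpT], ?_⟩)
          exact slot_injective (hg p hpA) hp
        · rw [e]
          exact hqi.subset (Set.insert_subset_insert (by simp))
      have h1 := Finset.card_le_card hsub
      rw [Finset.card_sdiff_of_subset (Finset.subset_univ _), Finset.card_univ, Fintype.card_fin,
        Finset.card_image_of_injOn (hinj _ Finset.inter_subset_left)] at h1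
      have h2 : X.card ≤ (T \ A).card := by
        simpa using Finset.card_le_univ X
      have h3 := Finset.card_sdiff_add_card_inter T A
      rw [Finset.inter_comm] at h3
      omega
    · push Not at hins
      -- Otherwise `A` spans `X`, and the elements of `A \ T` exchangeable with no member of `X` are
      -- not needed for this. So `N' ∪ (A ∩ T)` spans the independent set `X ∪ (A ∩ T)`, and
      -- comparing cardinalities gives Hall's condition.
      set N' := (A \ T).filter fun p => ∃ q ∈ X, M.Indep (swapSet A (some p) (some q.1) : Set σ)
        with hN'
      have h1 : N'.card ≤ (X.biUnion t).card := by
        rw [← Finset.card_image_of_injOn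
          (hinj N' ((Finset.filter_subset _ _).trans Finset.sdiff_subset))]
        refine Finset.card_le_card fun k hk => ?_
        obtain ⟨p, hp, rfl⟩ := Finset.mem_image.1 hk
        obtain ⟨hp1, q, hq, hqi⟩ := Finset.mem_filter.1 hp
        obtain ⟨hpA, hpT⟩ := Finset.mem_sdiff.1 hp1
        refine Finset.mem_biUnion.2 ⟨q, hq, Finset.mem_filter.2 ⟨Finset.mem_univ _, ?_, ?_⟩⟩
        · rw [hg p hpA]
          rintro _ ⟨⟩
          exact hpT
        · rwa [hg p hpA]
      refine le_trans ?_ h1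
      set X' : Finset σ := X.map (Function.Embedding.subtype _) with hX'
      have hX'T : X' ⊆ T \ A := by
        intro y hy
        obtain ⟨z, -, rfl⟩ := Finset.mem_map.1 hy
        exact z.2
      have hdisj : Disjoint X' (A ∩ T) := Finset.disjoint_left.2 fun y hy hy' =>
        (Finset.mem_sdiff.1 (hX'T hy)).2 (Finset.mem_inter.1 hy').1
      have hdisj2 : Disjoint N' (A ∩ T) := Finset.disjoint_left.2 fun y hy hy' =>
        (Finset.mem_sdiff.1 (Finset.mem_filter.1 hy).1).2 (Finset.mem_inter.1 hy').2
      have hcard : (X' ∪ A ∩ T).card ≤ (N' ∪ A ∩ T).card := by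
        refine Matroid.Indep.card_le_of_subset_closure (M := M) (hT.subset ?_) ?_
        · exact_mod_cast Finset.union_subset (hX'T.trans Finset.sdiff_subset)
            Finset.inter_subset_right
        · intro y hy
          rcases Finset.mem_union.1 (Finset.mem_coe.1 hy) with hy | hy
          · obtain ⟨z, hz, rfl⟩ := Finset.mem_map.1 hy
            have hzA : (z : σ) ∈ M.closure (A : Set σ) :=
              hA.mem_closure_of_not_indep_insert hE (hins z hz)
            have := hA.mem_closure_sdiff hzA ((A \ T) \ N') fun p hp => by
              obtain ⟨hp1, hp2⟩ := Finset.mem_sdiff.1 hp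
              by_contra hcl
              refine hp2 (Finset.mem_filter.2 ⟨hp1, z, hz, ?_⟩)
              rw [e]
              by_contra hni
              have h2 := (hA.subset (by simp)).mem_closure_of_not_indep_insert hE hni
              apply hcl
              simpa [Finset.sdiff_singleton_eq_erase] using h2
            refine M.closure_subset_closure ?_ this
            intro s hs
            rw [Finset.mem_coe] at hs ⊢
            simp only [Finset.mem_sdiff, Finset.mem_union, Finset.mem_inter] at hs ⊢
            tauto
          · refine M.mem_closure_of_mem' ?_ (by rw [hE]; trivial)
            exact Finset.mem_coe.2 (Finset.mem_union_right _ hy)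
      rw [Finset.card_union_of_disjoint hdisj, Finset.card_union_of_disjoint hdisj2] at hcard
      have : X'.card = X.card := Finset.card_map _
      omega
  obtain ⟨g, hg, hgt⟩ := key
  exact ⟨g, hg, fun q => (Finset.mem_filter.1 (hgt q)).2⟩

/-- The difference of the weights of two independent sets is at most the total gain of exchanges
between different slots and different candidates, where a candidate is an element to be added,
or the command to empty a certain slot. -/
theorem exists_exchange_candidates (hE : M.E = Set.univ) {A T : Finset σ}
    (hA : M.Indep (A : Set σ)) (hT : M.Indep (T : Set σ)) {R : ℕ} [NeZero R] (hAR : A.card ≤ R)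
    (hTR : T.card ≤ R) (ω : σ → ℝ) :
    ∃ τ : Fin R → σ ⊕ Fin R, Function.Injective τ ∧
      (∀ k, τ k = Sum.inr k ∨ ∃ q ∈ T, q ∉ A ∧ τ k = Sum.inl q ∧
        M.Indep (swapSet A (slot A k) (some q) : Set σ)) ∧
      ∑ x ∈ T, ω x - ∑ x ∈ A, ω x ≤
        ∑ k, max 0 ((τ k).elim ω (fun _ => 0) - (slot A k).elim 0 ω) := by
  classical
  obtain ⟨g, hg, hgt⟩ := exists_slot_matching hE hA hT hAR hTR
  -- Each unmatched slot has its own deletion command. This keeps `τ` injective, so that random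
  -- sampling treats all slots alike.
  let τ : Fin R → σ ⊕ Fin R := fun k =>
    if h : ∃ q, g q = k then Sum.inl h.choose.1 else Sum.inr k
  have hτg : ∀ q, τ (g q) = Sum.inl q.1 := by
    intro q
    have h : ∃ q', g q' = g q := ⟨q, rfl⟩
    simp only [τ, dif_pos h]
    rw [hg h.choose_spec]
  have hτn : ∀ k, (¬ ∃ q, g q = k) → τ k = Sum.inr k := fun k h => dif_neg h
  refine ⟨τ, ?_, ?_, ?_⟩
  · intro k k' hkk
    by_cases h : ∃ q, g q = k <;> by_cases h' : ∃ q, g q = k'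
    · obtain ⟨q, rfl⟩ := h
      obtain ⟨q', rfl⟩ := h'
      rw [hτg, hτg] at hkk
      rw [Subtype.ext (Sum.inl.inj hkk)]
    · obtain ⟨q, rfl⟩ := h
      rw [hτg, hτn _ h'] at hkk
      cases hkk
    · obtain ⟨q, rfl⟩ := h'
      rw [hτg, hτn _ h] at hkk
      cases hkk
    · rw [hτn _ h, hτn _ h'] at hkk
      exact Sum.inr.inj hkk
  · intro k
    by_cases h : ∃ q, g q = k
    · obtain ⟨q, rfl⟩ := h
      have hq := Finset.mem_sdiff.1 q.2
      exact Or.inr ⟨q, hq.1, hq.2, hτg q, (hgt q).2⟩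
    · exact Or.inl (hτn k h)
  · have h1 : ∑ x ∈ T, ω x - ∑ x ∈ A, ω x = ∑ x ∈ T \ A, ω x - ∑ x ∈ A \ T, ω x := by
      rw [← Finset.sum_sdiff_sub_sum_sdiff]
    have h2 : ∑ k, (τ k).elim ω (fun _ => 0) = ∑ x ∈ T \ A, ω x := by
      rw [← Finset.sum_subset (Finset.subset_univ (Finset.univ.image g)),
        Finset.sum_image fun x _ y _ e => hg e, ← Finset.sum_coe_sort (T \ A) ω]
      · exact Finset.sum_congr rfl fun q _ => by rw [hτg]; rfl
      · intro k _ hk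
        rw [hτn k fun ⟨q, hq⟩ => hk (Finset.mem_image.2 ⟨q, Finset.mem_univ _, hq⟩)]
        rfl
    rw [h1, ← h2, ← sum_slot hAR (A \ T) Finset.sdiff_subset ω, ← Finset.sum_sub_distrib]
    refine Finset.sum_le_sum fun k _ => ?_
    -- A slot with content in `T` is never matched and contributes zero on the left. In all other
    -- cases the gain before truncation is exactly the summand.
    rcases hs : slot A k with _ | p
    · exact le_max_right _ _
    · by_cases hp : p ∈ T
      · have : τ k = Sum.inr k := hτn k fun ⟨q, hq⟩ => by
          have := (hgt q).1
          rw [hq, hs] at this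
          exact this p rfl hp
        rw [this]
        simp [Option.filter, hp]
      · have hpA : p ∈ A := mem_of_slot_eq hs
        refine le_trans (le_of_eq ?_) (le_max_right _ _)
        simp [Option.filter, hp, hpA]

end matching

/-! ### Marginal values -/

section marginals

variable {σ : Type u} [DecidableEq σ]

/-- The marginal value of `p` with respect to `A \ {p}`. -/
def marginal (Φ : Finset σ → ℝ) (A : Finset σ) (p : σ) : ℝ :=
  Φ (insert p (A.erase p)) - Φ (A.erase p)

theorem marginal_of_notMem {Φ : Finset σ → ℝ} {A : Finset σ} {p : σ} (hp : p ∉ A) :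
    marginal Φ A p = Φ (insert p A) - Φ A := by
  rw [marginal, Finset.erase_eq_of_notMem hp]

theorem marginal_of_mem {Φ : Finset σ → ℝ} {A : Finset σ} {p : σ} (hp : p ∈ A) :
    marginal Φ A p = Φ A - Φ (A.erase p) := by
  rw [marginal, Finset.insert_erase hp]

theorem marginal_add_sum (g : Finset σ → ℝ) (ω : σ → ℝ) (A : Finset σ) (p : σ) :
    marginal (fun A => g A + ∑ x ∈ A, ω x) A p = marginal g A p + ω p := by
  simp only [marginal]
  rw [Finset.sum_insert (Finset.notMem_erase _ _)]
  ring

theorem IsSubmodular.add_sum {g : Finset σ → ℝ} (hg : IsSubmodular g) (ω : σ → ℝ) :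
    IsSubmodular fun A => g A + ∑ x ∈ A, ω x := by
  intro S T
  have h1 := hg S T
  have h2 := Finset.sum_union_inter (s₁ := S) (s₂ := T) (f := ω)
  simp only
  linarith

variable {g : Finset σ → ℝ}

theorem IsSubmodular.insert_sub_le (hg : IsSubmodular g) {A B : Finset σ} (hAB : A ⊆ B) {p : σ}
    (hp : p ∉ B) : g (insert p B) - g B ≤ g (insert p A) - g A := by
  have h := hg (insert p A) B
  have h1 : insert p A ∩ B = A := by
    rw [Finset.insert_inter_of_notMem hp, Finset.inter_eq_left.2 hAB]
  have h2 : insert p A ∪ B = insert p B := by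
    rw [Finset.insert_union, Finset.union_eq_right.2 hAB]
  rw [h1, h2] at h
  linarith

theorem marginal_nonneg (hm : Monotone g) (A : Finset σ) (p : σ) : 0 ≤ marginal g A p :=
  sub_nonneg.2 (hm (Finset.subset_insert _ _))

theorem insert_sub_le_marginal (hm : Monotone g) (A : Finset σ) (p : σ) :
    g (insert p A) - g A ≤ marginal g A p := by
  by_cases hp : p ∈ A
  · rw [Finset.insert_eq_of_mem hp, sub_self]
    exact marginal_nonneg hm A p
  · rw [marginal_of_notMem hp]

theorem singleton_le_marginal_add (hm : Monotone g) (A : Finset σ) (p : σ) :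
    g {p} ≤ marginal g A p + g A := by
  have h1 := insert_sub_le_marginal hm A p
  have h2 : g {p} ≤ g (insert p A) := hm (by simp)
  linarith

/-- Adding `T` element by element, each gain is at most the gain over `A` alone. Elements already in
`A` gain nothing, while their marginal value is nonnegative by monotonicity. -/
theorem union_sub_le_sum_marginal (hg : IsSubmodular g) (hm : Monotone g) (A T : Finset σ) :
    g (A ∪ T) - g A ≤ ∑ p ∈ T, marginal g A p := by
  induction T using Finset.induction_on with
  | empty => simp
  | insert p T hp ih =>
    rw [Finset.sum_insert hp, Finset.union_insert]
    have h1 : g (insert p (A ∪ T)) - g (A ∪ T) ≤ marginal g A p := by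
      by_cases hpA : p ∈ A ∪ T
      · rw [Finset.insert_eq_of_mem hpA, sub_self]
        exact marginal_nonneg hm A p
      · exact (hg.insert_sub_le Finset.subset_union_left hpA).trans (insert_sub_le_marginal hm A p)
    linarith

/-- Removing `B` element by element, each loss is at least the loss incurred from the full set `A`.
-/
theorem sum_marginal_le (hg : IsSubmodular g) {A B : Finset σ} (hB : B ⊆ A) :
    ∑ p ∈ B, marginal g A p ≤ g A - g (A \ B) := by
  induction B using Finset.induction_on with
  | empty => simp
  | insert p B hp ih =>
    rw [Finset.insert_subset_iff] at hB
    rw [Finset.sum_insert hp]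
    have h1 : marginal g A p ≤ g (A \ B) - g (A \ insert p B) := by
      have h2 := hg.insert_sub_le (A := A \ insert p B) (B := A.erase p) (p := p)
        (fun x hx => by
          simp only [Finset.mem_sdiff, Finset.mem_insert, Finset.mem_erase] at hx ⊢
          tauto) (Finset.notMem_erase _ _)
      have h3 : insert p (A \ insert p B) = A \ B := by
        ext x
        by_cases hx : x = p
        · subst hx
          simp [hB.1, hp]
        · simp [hx]
      rw [h3] at h2
      exact h2
    have := ih hB.2
    linarith

theorem le_sum_singleton (hg : IsSubmodular g) (hm : Monotone g) (h0 : g ∅ = 0)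
    (A : Finset σ) : g A ≤ ∑ p ∈ A, g {p} := by
  have := union_sub_le_sum_marginal hg hm ∅ A
  simpa [marginal, h0] using this

/-- An exchange gains at least the difference of the marginal values. -/
theorem marginal_sub_marginal_le {Φ : Finset σ → ℝ} (hΦ : IsSubmodular Φ) {A : Finset σ}
    {p q : Option σ} (hp : ∀ x ∈ p, x ∈ A) (hq : ∀ x ∈ q, x ∉ A) :
    q.elim 0 (marginal Φ A) - p.elim 0 (marginal Φ A) ≤ Φ (swapSet A p q) - Φ A := by
  have hrem : Φ A - p.elim 0 (marginal Φ A) = Φ (A \ p.toFinset) := by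
    rcases p with _ | x
    · simp
    · rw [Option.elim_some, marginal_of_mem (hp x rfl), Option.toFinset_some,
        Finset.sdiff_singleton_eq_erase]
      ring
  have hadd : q.elim 0 (marginal Φ A) ≤ Φ (swapSet A p q) - Φ (A \ p.toFinset) := by
    rcases q with _ | x
    · simp [swapSet]
    · rw [Option.elim_some, marginal_of_notMem (hq x rfl)]
      have := hΦ.insert_sub_le (Finset.sdiff_subset (s := A) (t := p.toFinset)) (hq x rfl)
      rw [swapSet, Option.toFinset_some, Finset.union_comm, ← Finset.insert_eq]
      exact this
  linarith

end marginals

/-! ### The auxiliary function -/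

section auxiliary

variable {N : Type u} [DecidableEq N] {L : ℕ}

theorem mem_unionPart {J : Finset (Fin L)} {A : Finset (N × Fin L)} {x : N} :
    x ∈ unionPart J A ↔ ∃ i ∈ J, (x, i) ∈ A := by
  simp only [unionPart, Finset.mem_image, Finset.mem_filter, Prod.exists]
  constructor
  · rintro ⟨y, i, ⟨h1, h2⟩, rfl⟩
    exact ⟨i, h2, h1⟩
  · rintro ⟨i, h2, h1⟩
    exact ⟨x, i, ⟨h1, h2⟩, rfl⟩

theorem unionPart_mono (J : Finset (Fin L)) : Monotone (unionPart (N := N) J) := by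
  intro A B hAB x hx
  obtain ⟨i, hi, hx⟩ := mem_unionPart.1 hx
  exact mem_unionPart.2 ⟨i, hi, hAB hx⟩

theorem unionPart_union (J : Finset (Fin L)) (A B : Finset (N × Fin L)) :
    unionPart J (A ∪ B) = unionPart J A ∪ unionPart J B := by
  ext x
  simp only [mem_unionPart, Finset.mem_union]
  constructor
  · rintro ⟨i, hi, h | h⟩
    exacts [Or.inl ⟨i, hi, h⟩, Or.inr ⟨i, hi, h⟩]
  · rintro (⟨i, hi, h⟩ | ⟨i, hi, h⟩)
    exacts [⟨i, hi, Or.inl h⟩, ⟨i, hi, Or.inr h⟩]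

theorem unionPart_inter_subset (J : Finset (Fin L)) (A B : Finset (N × Fin L)) :
    unionPart J (A ∩ B) ⊆ unionPart J A ∩ unionPart J B :=
  Finset.subset_inter (unionPart_mono J Finset.inter_subset_left)
    (unionPart_mono J Finset.inter_subset_right)

theorem unionPart_subset_univ (J : Finset (Fin L)) (A : Finset (N × Fin L)) :
    unionPart J A ⊆ unionPart Finset.univ A := by
  intro x hx
  obtain ⟨i, -, hx⟩ := mem_unionPart.1 hx
  exact mem_unionPart.2 ⟨i, Finset.mem_univ _, hx⟩

theorem unionPart_empty (A : Finset (N × Fin L)) : unionPart ∅ A = ∅ := by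
  ext x
  simp [mem_unionPart]

theorem unionPart_of_empty (J : Finset (Fin L)) :
    unionPart J (∅ : Finset (N × Fin L)) = ∅ := by
  ext x
  simp [mem_unionPart]

theorem unionPart_product_singleton (J : Finset (Fin L)) (S : Finset N) (i : Fin L) :
    unionPart J (S ×ˢ {i}) = if i ∈ J then S else ∅ := by
  ext x
  simp only [mem_unionPart, Finset.mem_product, Finset.mem_singleton]
  split_ifs with h
  · constructor
    · rintro ⟨j, -, hx, -⟩
      exact hx
    · intro hx
      exact ⟨i, h, hx, rfl⟩
  · simp only [Finset.notMem_empty, iff_false]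
    rintro ⟨j, hj, -, rfl⟩
    exact h hj

theorem unionPart_sdiff_filter (J : Finset (Fin L)) (A : Finset (N × Fin L)) (j : Fin L) :
    unionPart J (A \ A.filter fun p => p.2 = j) = unionPart (J.erase j) A := by
  ext x
  simp only [mem_unionPart, Finset.mem_sdiff, Finset.mem_filter, Finset.mem_erase]
  constructor
  · rintro ⟨i, hi, hx, hne⟩
    exact ⟨i, ⟨fun e => hne ⟨hx, e⟩, hi⟩, hx⟩
  · rintro ⟨i, ⟨hne, hi⟩, hx⟩
    exact ⟨i, hi, hx, fun h => hne h.2⟩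

/-! ### Monotonicity, submodularity and marginal values of the auxiliary function -/

variable {α : ℕ → ℝ} {f : Finset N → ℝ}

theorem auxSubmodular_mono (hα : ∀ i, 0 ≤ α i) (hf : Monotone f) :
    Monotone (auxSubmodular (L := L) α f) := by
  intro A B hAB
  exact Finset.sum_le_sum fun J _ => mul_le_mul_of_nonneg_left (hf (unionPart_mono J hAB)) (hα _)

/-- `unionPart J` commutes with unions, but on arbitrary sets of pairs only one inclusion holds for
intersections. Monotonicity of `f` bridges this gap. -/
theorem auxSubmodular_isSubmodular (hα : ∀ i, 0 ≤ α i) (hf : Monotone f)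
    (hs : IsSubmodular f) : IsSubmodular (auxSubmodular (L := L) α f) := by
  intro A B
  simp only [auxSubmodular, ← Finset.sum_add_distrib, ← mul_add]
  refine Finset.sum_le_sum fun J _ => mul_le_mul_of_nonneg_left ?_ (hα _)
  rw [unionPart_union]
  have h1 := hs (unionPart J A) (unionPart J B)
  have h2 := hf (unionPart_inter_subset J A B)
  linarith

theorem auxSubmodular_empty (h0 : f ∅ = 0) :
    auxSubmodular α f (∅ : Finset (N × Fin L)) = 0 := by
  simp [auxSubmodular, unionPart_of_empty, h0]

theorem auxSubmodular_nonneg (hα : ∀ i, 0 ≤ α i) (hf : ∀ S, 0 ≤ f S)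
    (A : Finset (N × Fin L)) : 0 ≤ auxSubmodular α f A :=
  Finset.sum_nonneg fun _ _ => mul_nonneg (hα _) (hf _)

theorem auxSubmodular_le (hα : ∀ i, 0 ≤ α i) (hf : Monotone f) (A : Finset (N × Fin L)) :
    auxSubmodular α f A ≤ (∑ J : Finset (Fin L), α J.card) * f (unionPart Finset.univ A) := by
  rw [Finset.sum_mul]
  exact Finset.sum_le_sum fun J _ =>
    mul_le_mul_of_nonneg_left (hf (unionPart_subset_univ J A)) (hα _)

theorem auxFun_eq (c : ℝ) (w : Finset N → ℝ) (A : Finset (N × Fin L)) :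
    auxFun α c f w A = auxSubmodular α f A + ∑ p ∈ A, c * w {p.1} := by
  rw [auxFun, Finset.mul_sum]

theorem auxFun_isSubmodular (hα : ∀ i, 0 ≤ α i) (hf : Monotone f) (hs : IsSubmodular f) (c : ℝ)
    (w : Finset N → ℝ) : IsSubmodular (auxFun (L := L) α c f w) := by
  have := (auxSubmodular_isSubmodular (L := L) hα hf hs).add_sum fun p => c * w {p.1}
  convert this using 1
  exact funext fun A => auxFun_eq c w A

theorem marginal_auxFun (c : ℝ) (w : Finset N → ℝ) (A : Finset (N × Fin L)) (p : N × Fin L) :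
    marginal (auxFun α c f w) A p = marginal (auxSubmodular α f) A p + c * w {p.1} := by
  rw [← marginal_add_sum _ fun p : N × Fin L => c * w {p.1}]
  congr 1
  exact funext fun A => auxFun_eq c w A

end auxiliary

/-! ### The coefficients and the approximation guarantee of local optima -/

/-- The coefficients of the auxiliary function for `ℓ + 1` parts. -/
noncomputable def searchCoeff (ℓ : ℕ) : ℕ → ℝ
  | 0 => 0
  | j + 1 => (1 + 1 / ((ℓ : ℝ) + 1)) ^ j / (ℓ.choose j)

/-- The weight of the linear function. -/
noncomputable def linearCoeff (ℓ : ℕ) : ℝ := ((ℓ : ℝ) + 1) * (1 + 1 / ((ℓ : ℝ) + 1)) ^ (ℓ + 1)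

/-- The total weight of the sets of indices that contain a given index. -/
noncomputable def singleCoeff (ℓ : ℕ) : ℝ := ∑ j ∈ Finset.range (ℓ + 1), (1 + 1 / ((ℓ : ℝ) + 1)) ^ j

section coefficients

variable (ℓ : ℕ)

theorem searchCoeff_nonneg (i : ℕ) : 0 ≤ searchCoeff ℓ i := by
  cases i <;> simp only [searchCoeff] <;> positivity

theorem searchCoeff_pos {i : ℕ} (h1 : 1 ≤ i) (h2 : i ≤ ℓ + 1) : 0 < searchCoeff ℓ i := by
  obtain ⟨j, rfl⟩ : ∃ j, i = j + 1 := ⟨i - 1, by omega⟩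
  have : 0 < ℓ.choose j := Nat.choose_pos (by omega)
  simp only [searchCoeff]
  positivity

theorem linearCoeff_pos : 0 < linearCoeff ℓ := by
  rw [linearCoeff]
  positivity

/-- The right side is the coefficient of f(S) that the full index set produces in the averaged
inequality; f(S) and ℓ(S) thus enter with the same weight. -/
theorem linearCoeff_eq : linearCoeff ℓ = ((ℓ : ℝ) + 2) * searchCoeff ℓ (ℓ + 1) := by
  rw [linearCoeff, searchCoeff, Nat.choose_self, pow_succ]
  field_simp
  push_cast
  ring

/-- A geometric sum. Divided by `linearCoeff ℓ` it gives the ratio 1 - (1 + 1/L)^(-L) with L = ℓ +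
1. -/
theorem singleCoeff_eq : singleCoeff ℓ = linearCoeff ℓ - ((ℓ : ℝ) + 1) := by
  rw [singleCoeff, linearCoeff, geom_sum_eq]
  · field_simp
    ring
  · have : (0 : ℝ) < 1 / ((ℓ : ℝ) + 1) := by positivity
    linarith

theorem singleCoeff_pos : 0 < singleCoeff ℓ :=
  Finset.sum_pos (fun _ _ => by positivity) (by simp)

/-- The recurrence for which the coefficients were chosen: it says that f(S_J) with |J| = j has
total coefficient zero in the averaged inequality. -/
theorem searchCoeff_succ {j : ℕ} (h1 : 1 ≤ j) (h2 : j ≤ ℓ) :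
    ((ℓ : ℝ) + 2) * j * searchCoeff ℓ j =
      ((ℓ : ℝ) + 1) * ((ℓ : ℝ) + 1 - j) * searchCoeff ℓ (j + 1) := by
  obtain ⟨i, rfl⟩ : ∃ i, j = i + 1 := ⟨j - 1, by omega⟩
  have hc := Nat.choose_succ_right_eq ℓ i
  have hc' : (ℓ.choose (i + 1) : ℝ) * ((i : ℝ) + 1) = ℓ.choose i * ((ℓ : ℝ) - i) := by
    have : ((ℓ - i : ℕ) : ℝ) = (ℓ : ℝ) - i := by
      rw [Nat.cast_sub (by omega)]
    rw [← this]
    exact_mod_cast hc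
  have p1 : (ℓ.choose i : ℝ) ≠ 0 := by
    exact_mod_cast (Nat.choose_pos (by omega : i ≤ ℓ)).ne'
  have p2 : (ℓ.choose (i + 1) : ℝ) ≠ 0 := by
    exact_mod_cast (Nat.choose_pos h2).ne'
  have p3 : (ℓ : ℝ) + 1 ≠ 0 := by positivity
  simp only [searchCoeff]
  rw [pow_succ, mul_div_assoc', mul_div_assoc', div_eq_div_iff p1 p2]
  push_cast
  have e : (1 + 1 / ((ℓ : ℝ) + 1)) * ((ℓ : ℝ) + 1) = (ℓ : ℝ) + 2 := by
    field_simp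
    ring
  generalize (1 + 1 / ((ℓ : ℝ) + 1)) = q at *
  calc ((ℓ : ℝ) + 2) * (i + 1) * q ^ i * ℓ.choose (i + 1)
      = ((ℓ : ℝ) + 2) * q ^ i * (ℓ.choose (i + 1) * (i + 1)) := by ring
    _ = (q * ((ℓ : ℝ) + 1)) * q ^ i * (ℓ.choose i * ((ℓ : ℝ) - i)) := by rw [hc', e]
    _ = _ := by ring

theorem sum_ite_mem_eq {L : ℕ} (j : Fin L) (F : Finset (Fin L) → ℝ) :
    ∑ J, (if j ∈ J then F J else 0) = ∑ J, (if j ∈ J then 0 else F (insert j J)) := by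
  have h : ∑ J, (if j ∈ J then 0 else F (insert j J)) =
      ∑ J, (if j ∉ J then F (insert j J) else 0) :=
    Finset.sum_congr rfl fun J _ => by split_ifs <;> simp_all
  rw [h, ← Finset.sum_filter, ← Finset.sum_filter]
  refine Finset.sum_nbij' (fun J => J.erase j) (fun J => insert j J) ?_ ?_ ?_ ?_ ?_
  · intro J _
    simp
  · intro J _
    simp
  · intro J hJ
    exact Finset.insert_erase (Finset.mem_filter.1 hJ).2
  · intro J hJ
    exact Finset.erase_insert (Finset.mem_filter.1 hJ).2
  · intro J hJ
    rw [Finset.insert_erase (Finset.mem_filter.1 hJ).2]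

/-- There are `ℓ.choose j` index sets of size `j + 1` containing `i`, which cancels the denominators
of the coefficients. -/
theorem sum_searchCoeff_mem (i : Fin (ℓ + 1)) :
    ∑ J : Finset (Fin (ℓ + 1)), (if i ∈ J then searchCoeff ℓ J.card else 0) = singleCoeff ℓ := by
  have hu : (Finset.univ : Finset (Finset (Fin (ℓ + 1)))) =
      (insert i (Finset.univ.erase i)).powerset := by
    rw [Finset.insert_erase (Finset.mem_univ i), Finset.powerset_univ]
  have hcard : (Finset.univ.erase i).card = ℓ := by
    rw [Finset.card_erase_of_mem (Finset.mem_univ i)]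
    simp
  rw [hu, Finset.sum_powerset_insert (Finset.notMem_erase _ _)]
  have h1 : ∀ J ∈ (Finset.univ.erase i).powerset, i ∉ J := fun J hJ hi =>
    Finset.notMem_erase _ _ (Finset.mem_powerset.1 hJ hi)
  rw [Finset.sum_congr rfl fun J hJ => if_neg (h1 J hJ), Finset.sum_const_zero, zero_add]
  rw [Finset.sum_congr rfl (g := fun J => searchCoeff ℓ (J.card + 1)) fun J hJ => by
    rw [if_pos (Finset.mem_insert_self _ _), Finset.card_insert_of_notMem (h1 J hJ)]]
  rw [Finset.sum_powerset_apply_card fun m => searchCoeff ℓ (m + 1), hcard, singleCoeff]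
  refine Finset.sum_congr rfl fun j hj => ?_
  have : (ℓ.choose j : ℝ) ≠ 0 := by
    exact_mod_cast (Nat.choose_pos (by simpa [Nat.lt_succ_iff] using hj)).ne'
  simp only [searchCoeff, nsmul_eq_mul]
  field_simp

/-! ### The averaged inequality for local optima -/

variable {N : Type u} [DecidableEq N] {f : Finset N → ℝ}

theorem auxSubmodular_singleton (h0 : f ∅ = 0) (p : N × Fin (ℓ + 1)) :
    auxSubmodular (searchCoeff ℓ) f {p} = singleCoeff ℓ * f {p.1} := by
  rw [← sum_searchCoeff_mem ℓ p.2, Finset.sum_mul, auxSubmodular]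
  refine Finset.sum_congr rfl fun J _ => ?_
  have : ({p} : Finset (N × Fin (ℓ + 1))) = ({p.1} : Finset N) ×ˢ {p.2} := by simp
  rw [this, unionPart_product_singleton]
  split_ifs <;> simp [h0]

theorem auxSubmodular_product_singleton (h0 : f ∅ = 0) (S : Finset N) (i : Fin (ℓ + 1)) :
    auxSubmodular (searchCoeff ℓ) f (S ×ˢ {i}) = singleCoeff ℓ * f S := by
  rw [← sum_searchCoeff_mem ℓ i, Finset.sum_mul, auxSubmodular]
  refine Finset.sum_congr rfl fun J _ => ?_
  rw [unionPart_product_singleton]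
  split_ifs <;> simp [h0]

/-- Putting `O` into part `i` affects precisely the unions with `i ∈ J`, so summing over `i` counts
each `J` exactly `|J|` times. -/
theorem sum_sum_marginal_ge (hf : Monotone f) (hs : IsSubmodular f)
    (A : Finset (N × Fin (ℓ + 1))) (O : Finset N) :
    ∑ J : Finset (Fin (ℓ + 1)),
        (J.card : ℝ) * (searchCoeff ℓ J.card * (f (unionPart J A ∪ O) - f (unionPart J A))) ≤
      ∑ i, ∑ p ∈ O ×ˢ {i}, marginal (auxSubmodular (searchCoeff ℓ) f) A p := by
  have hα := searchCoeff_nonneg ℓ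
  have h1 : ∀ J : Finset (Fin (ℓ + 1)),
      (J.card : ℝ) * (searchCoeff ℓ J.card * (f (unionPart J A ∪ O) - f (unionPart J A))) =
      ∑ i, if i ∈ J then searchCoeff ℓ J.card * (f (unionPart J A ∪ O) - f (unionPart J A))
        else 0 := by
    intro J
    rw [Finset.sum_ite_mem, Finset.univ_inter, Finset.sum_const, nsmul_eq_mul]
  rw [Finset.sum_congr rfl fun J _ => h1 J, Finset.sum_comm]
  refine Finset.sum_le_sum fun i _ => ?_
  refine le_trans (le_of_eq ?_) (union_sub_le_sum_marginal
    (auxSubmodular_isSubmodular hα hf hs) (auxSubmodular_mono hα hf) A (O ×ˢ {i}))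
  rw [auxSubmodular, auxSubmodular, ← Finset.sum_sub_distrib]
  refine Finset.sum_congr rfl fun J _ => ?_
  rw [unionPart_union, unionPart_product_singleton]
  split_ifs
  · ring
  · simp

/-- The marginal values in one part add up to at most the loss from deleting that part. Deletion of
part `j` turns S_J into the union over `J` without `j`; reindexing by the smaller set produces the
term with `|J| + 1`. -/
theorem sum_marginal_auxSubmodular_le (hf : Monotone f) (hs : IsSubmodular f)
    (A : Finset (N × Fin (ℓ + 1))) :
    ∑ p ∈ A, marginal (auxSubmodular (searchCoeff ℓ) f) A p ≤
      ∑ J : Finset (Fin (ℓ + 1)), ((J.card : ℝ) * searchCoeff ℓ J.card -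
        ((ℓ : ℝ) + 1 - J.card) * searchCoeff ℓ (J.card + 1)) * f (unionPart J A) := by
  have hα := searchCoeff_nonneg ℓ
  have hsub := auxSubmodular_isSubmodular (L := ℓ + 1) hα hf hs
  have h1 : ∑ p ∈ A, marginal (auxSubmodular (searchCoeff ℓ) f) A p =
      ∑ j, ∑ p ∈ A.filter fun p => p.2 = j, marginal (auxSubmodular (searchCoeff ℓ) f) A p :=
    (Finset.sum_fiberwise A Prod.snd _).symm
  rw [h1]
  calc _ ≤ ∑ j, (auxSubmodular (searchCoeff ℓ) f A -
          auxSubmodular (searchCoeff ℓ) f (A \ A.filter fun p => p.2 = j)) :=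
        Finset.sum_le_sum fun j _ => sum_marginal_le hsub (Finset.filter_subset _ _)
    _ = ∑ j, (∑ J : Finset (Fin (ℓ + 1)), (if j ∈ J then searchCoeff ℓ J.card * f (unionPart J A) else 0) -
          ∑ J : Finset (Fin (ℓ + 1)), (if j ∈ J then searchCoeff ℓ J.card * f (unionPart (J.erase j) A) else 0)) := by
        refine Finset.sum_congr rfl fun j _ => ?_
        rw [auxSubmodular, auxSubmodular, ← Finset.sum_sub_distrib, ← Finset.sum_sub_distrib]
        refine Finset.sum_congr rfl fun J _ => ?_
        rw [unionPart_sdiff_filter]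
        split_ifs with hj
        · rfl
        · rw [Finset.erase_eq_of_notMem hj]
          ring
    _ = ∑ j, (∑ J : Finset (Fin (ℓ + 1)), (if j ∈ J then searchCoeff ℓ J.card * f (unionPart J A) else 0) -
          ∑ J : Finset (Fin (ℓ + 1)), (if j ∈ J then 0 else searchCoeff ℓ (J.card + 1) * f (unionPart J A))) := by
        refine Finset.sum_congr rfl fun j _ => ?_
        rw [sum_ite_mem_eq j fun J : Finset (Fin (ℓ + 1)) =>
          searchCoeff ℓ J.card * f (unionPart (J.erase j) A)]
        congr 1
        refine Finset.sum_congr rfl fun J _ => ?_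
        split_ifs with hj
        · rfl
        · rw [Finset.erase_insert hj, Finset.card_insert_of_notMem hj]
    _ = _ := by
        rw [Finset.sum_sub_distrib, Finset.sum_comm, Finset.sum_comm (γ := Fin (ℓ + 1)),
          ← Finset.sum_sub_distrib]
        refine Finset.sum_congr rfl fun J _ => ?_
        have e1 : ∑ j, (if j ∈ J then searchCoeff ℓ J.card * f (unionPart J A) else 0) =
            (J.card : ℝ) * (searchCoeff ℓ J.card * f (unionPart J A)) := by
          rw [Finset.sum_ite_mem, Finset.univ_inter, Finset.sum_const, nsmul_eq_mul]
        have e2 : ∑ j, (if j ∈ J then 0 else searchCoeff ℓ (J.card + 1) * f (unionPart J A)) =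
            ((ℓ : ℝ) + 1 - J.card) * (searchCoeff ℓ (J.card + 1) * f (unionPart J A)) := by
          have : ∀ j, (if j ∈ J then 0 else searchCoeff ℓ (J.card + 1) * f (unionPart J A)) =
              searchCoeff ℓ (J.card + 1) * f (unionPart J A) -
              (if j ∈ J then searchCoeff ℓ (J.card + 1) * f (unionPart J A) else 0) := by
            intro j
            split_ifs <;> ring
          rw [Finset.sum_congr rfl fun j _ => this j, Finset.sum_sub_distrib, Finset.sum_ite_mem,
            Finset.univ_inter, Finset.sum_const, Finset.sum_const, nsmul_eq_mul, nsmul_eq_mul,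
            Finset.card_univ, Fintype.card_fin]
          push_cast
          ring
        rw [e1, e2]
        ring

/-- The value of a solution in terms of its violation of local optimality. -/
theorem local_optimum_bound (hf : Monotone f) (hs : IsSubmodular f) (h0 : f ∅ = 0)
    (A : Finset (N × Fin (ℓ + 1))) (O : Finset N) {b : ℝ} (hb : 0 ≤ b)
    (hb' : b ≤ searchCoeff ℓ (ℓ + 1)) :
    ((ℓ : ℝ) + 1) * ((singleCoeff ℓ - b) * f O + b * f (unionPart Finset.univ A) -
        linearCoeff ℓ * f (unionPart Finset.univ A)) ≤
      ∑ i, ∑ p ∈ O ×ˢ {i}, marginal (auxSubmodular (searchCoeff ℓ) f) A p -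
        ((ℓ : ℝ) + 1) * ∑ p ∈ A, marginal (auxSubmodular (searchCoeff ℓ) f) A p := by
  have hα := searchCoeff_nonneg ℓ
  have h1 := sum_sum_marginal_ge ℓ hf hs A O
  have h2 := mul_le_mul_of_nonneg_left (sum_marginal_auxSubmodular_le ℓ hf hs A)
    (by positivity : (0 : ℝ) ≤ (ℓ : ℝ) + 1)
  refine le_trans ?_ (sub_le_sub h1 h2)
  rw [Finset.mul_sum, ← Finset.sum_sub_distrib]
  have hsum : ∑ J : Finset (Fin (ℓ + 1)), (J.card : ℝ) * searchCoeff ℓ J.card =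
      ((ℓ : ℝ) + 1) * singleCoeff ℓ := by
    have : ∀ J : Finset (Fin (ℓ + 1)), (J.card : ℝ) * searchCoeff ℓ J.card =
        ∑ i, if i ∈ J then searchCoeff ℓ J.card else 0 := by
      intro J
      rw [Finset.sum_ite_mem, Finset.univ_inter, Finset.sum_const, nsmul_eq_mul]
    rw [Finset.sum_congr rfl fun J _ => this J, Finset.sum_comm,
      Finset.sum_congr rfl fun i _ => sum_searchCoeff_mem ℓ i, Finset.sum_const, nsmul_eq_mul,
      Finset.card_univ, Fintype.card_fin]
    push_cast
    ring
  -- Distributing the left side over the index sets reduces the claim to one inequality per `J`;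
  -- only the full set carries f(S) and the slack.
  have hL : ((ℓ : ℝ) + 1) * ((singleCoeff ℓ - b) * f O + b * f (unionPart Finset.univ A) -
        linearCoeff ℓ * f (unionPart Finset.univ A)) =
      ∑ J : Finset (Fin (ℓ + 1)), ((J.card : ℝ) * searchCoeff ℓ J.card * f O +
        if J = Finset.univ then ((ℓ : ℝ) + 1) * (b * (f (unionPart Finset.univ A) - f O) -
          linearCoeff ℓ * f (unionPart Finset.univ A)) else 0) := by
    rw [Finset.sum_add_distrib, ← Finset.sum_mul, hsum, Finset.sum_ite_eq' Finset.univ,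
      if_pos (Finset.mem_univ _)]
    ring
  rw [hL]
  refine Finset.sum_le_sum fun J _ => ?_
  have hO : f O ≤ f (unionPart J A ∪ O) := hf Finset.subset_union_right
  by_cases hJ : J = Finset.univ
  · subst hJ
    rw [if_pos rfl, Finset.card_univ, Fintype.card_fin, linearCoeff_eq]
    push_cast
    have hS : f (unionPart Finset.univ A) ≤ f (unionPart Finset.univ A ∪ O) :=
      hf Finset.subset_union_left
    -- Here the slack arises: a share `b` of the weight of f(S ∪ O) is used to bound it below by
    -- f(S) instead of f(O).
    have h3 : (searchCoeff ℓ (ℓ + 1) - b) * f O + b * f (unionPart Finset.univ A) ≤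
        searchCoeff ℓ (ℓ + 1) * f (unionPart Finset.univ A ∪ O) := by
      have e1 := mul_le_mul_of_nonneg_left hO (sub_nonneg.2 hb')
      have e2 := mul_le_mul_of_nonneg_left hS hb
      linarith
    have h4 := mul_le_mul_of_nonneg_left h3 (by positivity : (0 : ℝ) ≤ (ℓ : ℝ) + 1)
    linarith
  · rw [if_neg hJ, add_zero]
    rcases J.eq_empty_or_nonempty with rfl | hne
    -- The empty index set has no compensating term, which is where the normalization f(∅) = 0
    -- enters.
    · rw [unionPart_empty, h0]
      simp [searchCoeff]
    · have hc1 : 1 ≤ J.card := hne.card_pos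
      have hc2 : J.card ≤ ℓ := by
        have := Finset.card_lt_card (Finset.ssubset_univ_iff.2 hJ)
        rw [Finset.card_univ, Fintype.card_fin] at this
        omega
      have h3 := searchCoeff_succ ℓ hc1 hc2
      have h4 := mul_le_mul_of_nonneg_left hO
        (mul_nonneg (Nat.cast_nonneg J.card) (hα J.card))
      have h5 := congrArg (fun y => y * f (unionPart J A)) h3
      beta_reduce at h5
      linarith

end coefficients

namespace OracleAlg

variable {N : Type u} {f w : Finset N → ℝ} {M : Matroid N}

/-! ### Binary search -/

/-- Find a position in `(lo, hi]` at which the answers of `F` change from `false` to `true`. -/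
def search (F : ℕ → OracleAlg N Bool) : ℕ → ℕ → ℕ → OracleAlg N ℕ
  | 0, _, hi => output hi
  | t + 1, lo, hi =>
    if hi ≤ lo + 1 then output hi
    else (F ((lo + hi) / 2)).bind fun b =>
      if b then search F t lo ((lo + hi) / 2) else search F t ((lo + hi) / 2) hi

-- `B` need not be monotone: throughout, `hi` is the initial bound or satisfies `B`, and `lo` is the
-- initial bound or violates it. The initial upper end is never queried, so a result equal to it has
-- to be verified separately.
open Classical in
theorem exists_computes_search {F : ℕ → OracleAlg N Bool} {B : ℕ → Prop}
    (hF : ∀ m, Computes f w M (F m) (decide (B m)) 1) (t : ℕ) {lo hi : ℕ} (h : lo < hi)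
    (ht : hi - lo ≤ 2 ^ t) :
    ∃ m, Computes f w M (search F t lo hi) m t ∧ lo < m ∧ m ≤ hi ∧ (m = hi ∨ B m) ∧
      (m = lo + 1 ∨ ¬ B (m - 1)) := by
  induction t generalizing lo hi with
  | zero =>
    rw [pow_zero] at ht
    exact ⟨hi, computes_output _ _, h, le_rfl, Or.inl rfl, Or.inl (by omega)⟩
  | succ t ih =>
    by_cases hle : hi ≤ lo + 1
    · refine ⟨hi, ?_, h, le_rfl, Or.inl rfl, Or.inl (by omega)⟩
      rw [search, if_pos hle]
      exact computes_output _ _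
    · rw [pow_succ] at ht
      have hc := hF ((lo + hi) / 2)
      rw [search, if_neg hle]
      by_cases hB : B ((lo + hi) / 2)
      · obtain ⟨m, hm, h1, h2, h3, h4⟩ := ih (lo := lo) (hi := (lo + hi) / 2) (by omega) (by omega)
        refine ⟨m, ?_, h1, by omega, ?_, h4⟩
        · rw [add_comm t]
          refine hc.bind ?_
          rw [if_pos (by simpa using hB)]
          exact hm
        · rcases h3 with rfl | h3
          exacts [Or.inr hB, Or.inr h3]
      · obtain ⟨m, hm, h1, h2, h3, h4⟩ := ih (lo := (lo + hi) / 2) (hi := hi) (by omega) (by omega)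
        refine ⟨m, ?_, by omega, h2, h3, ?_⟩
        · rw [add_comm t]
          refine hc.bind ?_
          rw [if_neg (by simpa using hB)]
          exact hm
        · rcases h4 with rfl | h4
          exacts [Or.inr (by simpa using hB), Or.inr h4]

/-! ### Finding the best element to exchange -/

section swap

variable {σ : Type v} [DecidableEq σ]

/-- Search for the first member of `ps` that can be exchanged with `q`. -/
def findSwap (ind : Finset σ → OracleAlg N Bool) (t : ℕ) (A : Finset σ) (ps : List (Option σ))
    (q : Option σ) : OracleAlg N (Option (Option σ)) :=
  (search (fun m => ind (A \ listElems (ps.take m) ∪ q.toFinset)) t 0 ps.length).bind fun m =>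
    (ind (swapSet A (ps.getD (m - 1) none) q)).bind fun b =>
      output (if b then some (ps.getD (m - 1) none) else none)

open Classical in
/-- Sort a list by weights. -/
noncomputable def sortByWeight (wt : Option σ → ℝ) (ps : List (Option σ)) : List (Option σ) :=
  ps.mergeSort fun a b => decide (wt a ≤ wt b)

omit [DecidableEq σ] in
theorem pairwise_sortByWeight (wt : Option σ → ℝ) (ps : List (Option σ)) :
    (sortByWeight wt ps).Pairwise fun a b => wt a ≤ wt b := by
  classical
  refine (List.pairwise_mergeSort (le := fun a b => decide (wt a ≤ wt b)) ?_ ?_ ps).imp ?_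
  · intro a b c
    simpa using le_trans
  · intro a b
    simpa using le_total (wt a) (wt b)
  · simp

omit [DecidableEq σ] in
theorem mem_sortByWeight {wt : Option σ → ℝ} {ps : List (Option σ)} {p : Option σ} :
    p ∈ sortByWeight wt ps ↔ p ∈ ps := by
  classical
  exact List.mem_mergeSort

omit [DecidableEq σ] in
theorem length_sortByWeight (wt : Option σ → ℝ) (ps : List (Option σ)) :
    (sortByWeight wt ps).length = ps.length := by
  classical
  exact List.length_mergeSort _

variable {M' : Matroid σ} {ind : Finset σ → OracleAlg N Bool}

-- The first feasible member of a sorted list is a lightest one. If no exchange is feasible, the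
-- search still returns a position; the extra query after it rejects the exchange found there.
open Classical in
theorem exists_computes_findSwap (hE : M'.E = Set.univ)
    (hind : ∀ X : Finset σ, Computes f w M (ind X) (decide (M'.Indep (X : Set σ))) 1)
    {t : ℕ} {A : Finset σ} (hA : M'.Indep (A : Set σ)) {ps : List (Option σ)} (hps : ps ≠ [])
    (ht : ps.length ≤ 2 ^ t) {q : Option σ} (hq : ∀ x ∈ q, x ∉ A) {wt : Option σ → ℝ}
    (hsort : ps.Pairwise fun a b => wt a ≤ wt b) :
    ∃ o : Option (Option σ), Computes f w M (findSwap ind t A ps q) o (t + 1) ∧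
      (∀ p ∈ o, p ∈ ps ∧ M'.Indep (swapSet A p q : Set σ)) ∧
      ∀ p' ∈ ps, M'.Indep (swapSet A p' q : Set σ) → ∃ p ∈ o, wt p ≤ wt p' := by
  obtain ⟨m, hm, h1, h2, h3, h4⟩ := exists_computes_search (f := f) (w := w) (M := M)
    (F := fun m => ind (A \ listElems (ps.take m) ∪ q.toFinset))
    (B := fun m => M'.Indep ((A \ listElems (ps.take m) ∪ q.toFinset : Finset σ) : Set σ))
    (fun m => hind _) t (List.length_pos_of_ne_nil hps) (by simpa using ht)
  have hlt : m - 1 < ps.length := by omega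
  have hget : ps.getD (m - 1) none = ps[m - 1] := List.getD_eq_getElem _ _ hlt
  have hc := hm.bind (F := fun m => (ind (swapSet A (ps.getD (m - 1) none) q)).bind fun b =>
    output (if b then some (ps.getD (m - 1) none) else none))
    ((hind (swapSet A (ps.getD (m - 1) none) q)).bind (computes_output _ 0))
  refine ⟨_, hc, ?_, ?_⟩
  · intro p hp
    split_ifs at hp with hi
    · obtain rfl := Option.some.inj hp
      rw [hget] at hi ⊢
      exact ⟨List.getElem_mem _, by simpa using hi⟩
    · cases hp
  · intro p' hp' hf
    obtain ⟨k, hk, rfl⟩ := List.mem_iff_getElem.1 hp'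
    obtain ⟨hle, hfe⟩ := swap_feasible_of_search hE hA hq h1 h2 h3
      (by simpa using h4) hk hf
    refine ⟨ps[m - 1], ?_, ?_⟩
    · rw [hget, if_pos (by simpa using hfe)]
      rfl
    · rcases hle.lt_or_eq with hlt' | heq
      · exact List.pairwise_iff_getElem.1 hsort _ _ hlt hk hlt'
      · simp only [heq, le_refl]

/-! ### Independent sets of maximal weight -/

open Classical in
/-- Add `x` to the independent set `S`, or exchange it with the lightest possible element, if this
increases the weight. -/
noncomputable def insertWeighted (ind : Finset σ → OracleAlg N Bool) (t : ℕ) (ω : σ → ℝ)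
    (S : Finset σ) (x : σ) : OracleAlg N (Finset σ) :=
  if x ∈ S ∨ ω x ≤ 0 then output S
  else (findSwap ind t S
    (sortByWeight (fun p => p.elim 0 ω) (none :: S.toList.map some)) (some x)).bind fun o =>
      output (o.elim S fun p => if p.elim 0 ω < ω x then swapSet S p (some x) else S)

-- The option `none` of weight 0 stands for insertion without removal. Members of `S` have positive
-- weight, so insertion is preferred whenever it is possible, as `IsWeightCert.cons_swap` demands.
open Classical in
theorem exists_computes_insertWeighted (hE : M'.E = Set.univ)
    (hind : ∀ X : Finset σ, Computes f w M (ind X) (decide (M'.Indep (X : Set σ))) 1)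
    {t : ℕ} {ω : σ → ℝ} {l : List σ} {S : Finset σ} (hS : IsWeightCert M' ω l S)
    (ht : S.card + 1 ≤ 2 ^ t) (x : σ) :
    ∃ S', Computes f w M (insertWeighted ind t ω S x) S' (t + 1) ∧
      IsWeightCert M' ω (x :: l) S' := by
  by_cases hxS : x ∈ S
  · refine ⟨S, ?_, hS.indep, fun y hy => List.mem_cons_of_mem _ (hS.mem y hy), hS.pos,
      fun y hy => ?_⟩
    · rw [insertWeighted, if_pos (Or.inl hxS)]
      exact computes_output _ _
    · rcases List.mem_cons.1 hy with rfl | hy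
      · exact hS.mem_closure _ (hS.mem _ hxS)
      · exact hS.mem_closure _ hy
  by_cases hpos : 0 < ω x
  swap
  · refine ⟨S, ?_, hS.cons_of_not_improving hE hxS (fun h => absurd h hpos) fun p hp _ =>
      (not_lt.1 hpos).trans (hS.pos p hp).le⟩
    rw [insertWeighted, if_pos (Or.inr (not_lt.1 hpos))]
    exact computes_output _ _
  rw [insertWeighted, if_neg (by simpa [hxS] using hpos)]
  set wt : Option σ → ℝ := fun p => p.elim 0 ω with hwt
  set ps := sortByWeight wt (none :: S.toList.map some) with hps
  have hmem : ∀ p, p ∈ ps ↔ p = none ∨ ∃ y ∈ S, some y = p := by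
    intro p
    rw [hps, mem_sortByWeight]
    simp
  obtain ⟨o, ho, h1, h2⟩ := exists_computes_findSwap (f := f) (w := w) (M := M) hE hind
    (t := t) (ps := ps) (q := some x) hS.indep (List.ne_nil_of_mem ((hmem none).2 (Or.inl rfl)))
    (by rw [hps, length_sortByWeight]; simpa using ht) (by simpa using hxS)
    (pairwise_sortByWeight wt _)
  refine ⟨_, ho.bind (k' := 0) (computes_output _ 0), ?_⟩
  rcases o with _ | p
  · refine hS.cons_of_not_improving hE hxS (fun _ hi => ?_) fun p hp hi => ?_
    · obtain ⟨p, hp, -⟩ := h2 none ((hmem _).2 (Or.inl rfl)) hi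
      cases hp
    · obtain ⟨p', hp', -⟩ := h2 (some p) ((hmem _).2 (Or.inr ⟨p, hp, rfl⟩)) hi
      cases hp'
  · obtain ⟨hp1, hp2⟩ := h1 p rfl
    have h2' : ∀ p' ∈ ps, M'.Indep (swapSet S p' (some x) : Set σ) → wt p ≤ wt p' := by
      intro p' hp' hi
      obtain ⟨p'', h, hle⟩ := h2 p' hp' hi
      obtain rfl := Option.some.inj h
      exact hle
    rw [Option.elim_some]
    split_ifs with hlt
    · refine hS.cons_swap hE hxS hpos ?_ hp2 ?_ ?_
      · rintro y rfl
        exact hlt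
      · intro hne hi
        have hle := h2' none ((hmem _).2 (Or.inl rfl)) hi
        rcases (hmem p).1 hp1 with rfl | ⟨y, hy, rfl⟩
        · exact hne rfl
        · exact absurd hle (not_le.2 (hS.pos y hy))
      · rintro y rfl p' hp' hi
        exact h2' (some p') ((hmem _).2 (Or.inr ⟨p', hp', rfl⟩)) hi
    · refine hS.cons_of_not_improving hE hxS (fun _ hi => ?_) fun p' hp' hi => ?_
      · have hle := h2' none ((hmem _).2 (Or.inl rfl)) hi
        exact hlt (hle.trans_lt hpos)
      · exact (not_lt.1 hlt).trans (h2' (some p') ((hmem _).2 (Or.inr ⟨p', hp', rfl⟩)) hi)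

/-- An independent subset of maximal weight of the members of a list. -/
noncomputable def maxWeight (ind : Finset σ → OracleAlg N Bool) (t : ℕ) (ω : σ → ℝ) :
    List σ → OracleAlg N (Finset σ)
  | [] => output ∅
  | x :: l => (maxWeight ind t ω l).bind fun S => insertWeighted ind t ω S x

open Classical in
theorem exists_computes_maxWeight [Fintype σ] (hE : M'.E = Set.univ)
    (hind : ∀ X : Finset σ, Computes f w M (ind X) (decide (M'.Indep (X : Set σ))) 1)
    {t : ℕ} (ω : σ → ℝ) (ht : Fintype.card σ + 1 ≤ 2 ^ t) (l : List σ) :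
    ∃ S, Computes f w M (maxWeight ind t ω l) S (l.length * (t + 1)) ∧
      IsWeightCert M' ω l S := by
  induction l with
  | nil => exact ⟨∅, computes_output _ _, isWeightCert_nil ω⟩
  | cons x l ih =>
    obtain ⟨S, hS, hc⟩ := ih
    obtain ⟨S', hS', hc'⟩ := exists_computes_insertWeighted hE hind hc
      ((Nat.add_le_add_right (Finset.card_le_univ S) 1).trans ht) x
    refine ⟨S', ?_, hc'⟩
    rw [List.length_cons, add_mul, one_mul]
    exact hS.bind hS'

end swap

end OracleAlg

namespace OracleAlg

variable {N : Type u} {f w : Finset N → ℝ} {M : Matroid N}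
variable {σ : Type v} [DecidableEq σ] {M' : Matroid σ} {ind : Finset σ → OracleAlg N Bool}

/-! ### The choice of the scale -/

/-- The state of the scan through the elements in the order of increasing values: sets of maximal
weight for two weight functions, a selected part of the elements, a set of maximal weight for
this part, and a bound for the values in this part. -/
structure ScaleState (σ : Type v) where
  heavy : Finset σ
  light : Finset σ
  part : List σ
  start : Finset σ
  scale : ℝ

open Classical in
/-- Select the largest initial part of the elements whose last element is relevant for the maximal
weight. -/
noncomputable def scan (ind : Finset σ → OracleAlg N Bool) (t : ℕ) (ω ω₀ s : σ → ℝ) (δ : ℝ) :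
    List σ → OracleAlg N (ScaleState σ)
  | [] => output ⟨∅, ∅, [], ∅, 0⟩
  | x :: l => (scan ind t ω ω₀ s δ l).bind fun st =>
    (insertWeighted ind t ω st.heavy x).bind fun V =>
      (insertWeighted ind t ω₀ st.light x).bind fun Y =>
        output (if ∑ y ∈ st.light, ω₀ y + δ * s x ≤ ∑ y ∈ V, ω y then ⟨V, Y, x :: l, V, s x⟩
          else ⟨V, Y, st.part, st.start, st.scale⟩)

/-- The properties of the part of the elements selected by the scan. -/
structure IsScale (M' : Matroid σ) (ω ω₀ s : σ → ℝ) (δ : ℝ) (l : List σ) (part : List σ)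
    (start : Finset σ) (scale : ℝ) : Prop where
  subset : part ⊆ l
  length_le : part.length ≤ l.length
  cert : IsWeightCert M' ω part start
  scale_nonneg : 0 ≤ scale
  le_scale : ∀ x ∈ part, s x ≤ scale
  -- A solution either contains an element of value at least `scale` or has linear weight clearly
  -- below the weight of `start`. This turns `scale` into a lower bound in `SearchSetting.scale_le`.
  relevant : ∀ A : Finset σ, M'.Indep (A : Set σ) → (∀ x ∈ A, x ∈ part) →
    (∃ x ∈ A, scale ≤ s x) ∨ ∑ x ∈ A, ω₀ x + δ * scale ≤ ∑ x ∈ start, ω x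
  -- Sets leaving the selected part are beaten from within it, by linear weight alone, up to an
  -- error of at most `δ * s y` for each element of the list.
  outside : ∀ T : Finset σ, M'.Indep (T : Set σ) → (∀ x ∈ T, x ∈ l) →
    (∀ x ∈ T, x ∈ part) ∨ ∃ O : Finset σ, M'.Indep (O : Set σ) ∧ (∀ x ∈ O, x ∈ part) ∧
      ∃ y ∈ T, ∑ x ∈ T, ω x ≤ ∑ x ∈ O, ω₀ x + l.length * (δ * s y)

open Classical in
theorem exists_computes_scan [Fintype σ] (hE : M'.E = Set.univ)
    (hind : ∀ X : Finset σ, Computes f w M (ind X) (decide (M'.Indep (X : Set σ))) 1)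
    {t : ℕ} (ht : Fintype.card σ + 1 ≤ 2 ^ t) {ω ω₀ s : σ → ℝ} (hs : ∀ x, 0 ≤ s x)
    (hω : ∀ x, ω₀ x ≤ ω x) {δ : ℝ} (hδ : 0 ≤ δ) {l : List σ}
    (hl : l.Pairwise fun x y => s y ≤ s x) :
    ∃ st, Computes f w M (scan ind t ω ω₀ s δ l) st (l.length * (2 * (t + 1))) ∧
      IsWeightCert M' ω l st.heavy ∧ IsWeightCert M' ω₀ l st.light ∧
      IsScale M' ω ω₀ s δ l st.part st.start st.scale := by
  induction l with
  | nil =>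
    refine ⟨_, computes_output _ _, isWeightCert_nil _, isWeightCert_nil _, ?_⟩
    refine ⟨by simp, le_rfl, isWeightCert_nil _, le_rfl, by simp, fun A _ hA => Or.inr ?_,
      fun T _ hT => Or.inl hT⟩
    obtain rfl := Finset.eq_empty_of_forall_notMem fun x hx => by simpa using hA x hx
    simp
  | cons x l ih =>
    rw [List.pairwise_cons] at hl
    obtain ⟨st, hst, hV, hY, hsc⟩ := ih hl.2
    obtain ⟨V, hcV, hV'⟩ := exists_computes_insertWeighted hE hind hV
      ((Nat.add_le_add_right (Finset.card_le_univ st.heavy) 1).trans ht) x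
    obtain ⟨Y, hcY, hY'⟩ := exists_computes_insertWeighted hE hind hY
      ((Nat.add_le_add_right (Finset.card_le_univ st.light) 1).trans ht) x
    refine ⟨if ∑ y ∈ st.light, ω₀ y + δ * s x ≤ ∑ y ∈ V, ω y then ⟨V, Y, x :: l, V, s x⟩
      else ⟨V, Y, st.part, st.start, st.scale⟩, ?_, ?_⟩
    · have h := hst.bind (F := fun st => (insertWeighted ind t ω st.heavy x).bind fun V =>
        (insertWeighted ind t ω₀ st.light x).bind fun Y =>
          output (if ∑ y ∈ st.light, ω₀ y + δ * s x ≤ ∑ y ∈ V, ω y then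
            (⟨V, Y, x :: l, V, s x⟩ : ScaleState σ)
            else ⟨V, Y, st.part, st.start, st.scale⟩))
        (hcV.bind (k' := t + 1 + 0) (hcY.bind (k' := 0) (computes_output _ 0)))
      refine h.mono (le_of_eq ?_)
      rw [List.length_cons]
      ring
    by_cases hcond : ∑ y ∈ st.light, ω₀ y + δ * s x ≤ ∑ y ∈ V, ω y
    · rw [if_pos hcond]
      refine ⟨hV', hY', fun _ h => h, le_rfl, hV', hs x, fun y hy => ?_, fun A hA hAl => ?_,
        fun T _ hT => Or.inl hT⟩
      · rcases List.mem_cons.1 hy with rfl | hy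
        · exact le_rfl
        · exact hl.1 y hy
      · by_cases hxA : x ∈ A
        · exact Or.inl ⟨x, hxA, le_rfl⟩
        -- Without `x`, the set `A` consists of earlier elements, so its linear weight is at most
        -- that of `st.light`.
        · refine Or.inr (le_trans ?_ hcond)
          have := hY.sum_le hA fun y hy => (List.mem_cons.1 (hAl y hy)).resolve_left
            fun e => hxA (e ▸ hy)
          linarith
    · rw [if_neg hcond]
      refine ⟨hV', hY', fun y hy => List.mem_cons_of_mem _ (hsc.subset hy),
        hsc.length_le.trans (by simp), hsc.cert, hsc.scale_nonneg, hsc.le_scale, hsc.relevant,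
        fun T hT hTl => ?_⟩
      have hlen : ((x :: l).length : ℝ) = l.length + 1 := by simp
      rw [hlen]
      by_cases hxT : x ∈ T
      -- The element `x` was not selected, so replacing `T` by `st.light` costs less than `δ * s x`.
      -- If this set leaves the part too, it is replaced in turn; values increase along the scan, so
      -- the errors add up to a multiple of `δ * s x`.
      · refine Or.inr ?_
        have h1 := hV'.sum_le hT hTl
        rcases hsc.outside st.light hY.indep hY.mem with h | ⟨O, hO, hOp, y, hy, hle⟩
        · refine ⟨st.light, hY.indep, h, x, hxT, ?_⟩
          have : 0 ≤ (l.length : ℝ) * (δ * s x) := by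
            have := hs x
            positivity
          linarith
        · refine ⟨O, hO, hOp, x, hxT, ?_⟩
          have h2 : ∑ y ∈ st.light, ω₀ y ≤ ∑ y ∈ st.light, ω y :=
            Finset.sum_le_sum fun y _ => hω y
          have h3 : (l.length : ℝ) * (δ * s y) ≤ l.length * (δ * s x) := by
            gcongr
            exact hl.1 y (hY.mem y hy)
          linarith
      · rcases hsc.outside T hT fun y hy => (List.mem_cons.1 (hTl y hy)).resolve_left
            fun e => hxT (e ▸ hy) with h | ⟨O, hO, hOp, y, hy, hle⟩
        · exact Or.inl h
        · refine Or.inr ⟨O, hO, hOp, y, hy, ?_⟩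
          have : 0 ≤ δ * s y := by
            have := hs y
            positivity
          linarith

/-! ### Improving a solution -/

/-- The candidate of largest gain, or the old set if no candidate has a positive gain. -/
noncomputable def bestCandidate (A : Finset σ) : List (Finset σ × ℝ) → Finset σ × ℝ
  | [] => (A, 0)
  | c :: l => if (bestCandidate A l).2 < c.2 then c else bestCandidate A l

omit [DecidableEq σ] in
theorem bestCandidate_spec (A : Finset σ) (l : List (Finset σ × ℝ)) :
    (bestCandidate A l = (A, 0) ∨ bestCandidate A l ∈ l ∧ 0 < (bestCandidate A l).2) ∧
      ∀ c ∈ l, c.2 ≤ (bestCandidate A l).2 := by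
  induction l with
  | nil => simp [bestCandidate]
  | cons c l ih =>
    obtain ⟨h1, h2⟩ := ih
    have h0 : 0 ≤ (bestCandidate A l).2 := by
      rcases h1 with h1 | h1
      · rw [h1]
      · exact h1.2.le
    rw [bestCandidate]
    split_ifs with h
    · refine ⟨Or.inr ⟨List.mem_cons_self, h0.trans_lt h⟩, fun c' hc' => ?_⟩
      rcases List.mem_cons.1 hc' with rfl | hc'
      · exact le_rfl
      · exact (h2 c' hc').trans h.le
    · refine ⟨h1.imp_right fun h1 => ⟨List.mem_cons_of_mem _ h1.1, h1.2⟩, fun c' hc' => ?_⟩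
      rcases List.mem_cons.1 hc' with rfl | hc'
      · exact not_lt.1 h
      · exact h2 c' hc'

/-- The marginal value of the content of a slot. -/
def slotValue (val : Finset σ → OracleAlg N ℝ) (A : Finset σ) (a : ℝ) :
    Option σ → OracleAlg N ℝ
  | none => output 0
  | some p => (val (A.erase p)).bind fun y => output (a - y)

/-- The marginal value of an element that is to be added. -/
def candidateValue (val : Finset σ → OracleAlg N ℝ) (A : Finset σ) (a : ℝ) :
    Option σ → OracleAlg N ℝ
  | none => output 0
  | some q => (val (insert q A)).bind fun y => output (y - a)

/-- Perform the best exchange between the slots and the candidates, if it is an improvement. -/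
noncomputable def improve (ind : Finset σ → OracleAlg N Bool) (val : Finset σ → OracleAlg N ℝ)
    (t : ℕ) (A : Finset σ) (slots cands : List (Option σ)) : OracleAlg N (Finset σ) :=
  (val A).bind fun a =>
    (tabulate (slotValue val A a) slots).bind fun wt =>
      (tabulate (fun q => (candidateValue val A a q).bind fun y =>
          (findSwap ind t A (sortByWeight wt slots) q).bind fun o =>
            output (o.map fun p => (swapSet A p q, y - wt p))) cands).bind fun tab =>
        output (bestCandidate A (cands.filterMap tab)).1

/-- The result of an improvement step. -/
structure IsImprovement (M' : Matroid σ) (Φ : Finset σ → ℝ) (G A A' : Finset σ) : Prop where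
  indep : M'.Indep (A' : Set σ)
  subset : A' ⊆ G
  step : A' = A ∨ IsLocalStep A A' ∧ Φ A < Φ A'

theorem IsImprovement.le {Φ : Finset σ → ℝ} {G A A' : Finset σ}
    (h : IsImprovement M' Φ G A A') : Φ A ≤ Φ A' := by
  rcases h.step with rfl | h
  · exact le_rfl
  · exact h.2.le

theorem isLocalStep_swapSet (A : Finset σ) (p q : Option σ) :
    IsLocalStep A (swapSet A p q) := by
  have hcard : ∀ o : Option σ, o.toFinset.card ≤ 1 := by
    rintro (_ | x) <;> simp
  refine ⟨(Finset.card_le_card (t := p.toFinset) ?_).trans (hcard p),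
    (Finset.card_le_card (t := q.toFinset) ?_).trans (hcard q)⟩
  · intro x hx
    simp only [swapSet, Finset.mem_sdiff, Finset.mem_union] at hx ⊢
    tauto
  · intro x hx
    simp only [swapSet, Finset.mem_sdiff, Finset.mem_union] at hx ⊢
    tauto

-- Gains are measured by differences of marginal values at `A`, which submodularity makes lower
-- bounds for the true gains. So one value for each slot and each candidate suffices, not one for
-- each pair, and slots can be sorted once for all candidates.
open Classical in
theorem exists_computes_improve (hE : M'.E = Set.univ)
    (hind : ∀ X : Finset σ, Computes f w M (ind X) (decide (M'.Indep (X : Set σ))) 1)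
    {val : Finset σ → OracleAlg N ℝ} {Φ : Finset σ → ℝ} {kv : ℕ}
    (hval : ∀ X, Computes f w M (val X) (Φ X) kv) (hΦ : IsSubmodular Φ)
    {t : ℕ} {G A : Finset σ} (hA : M'.Indep (A : Set σ)) (hAG : A ⊆ G)
    {slots cands : List (Option σ)} (hne : slots ≠ []) (hlen : slots.length ≤ 2 ^ t)
    (hslots : ∀ p ∈ slots, ∀ x ∈ p, x ∈ A) (hcands : ∀ q ∈ cands, ∀ x ∈ q, x ∉ A ∧ x ∈ G) :
    ∃ A', Computes f w M (improve ind val t A slots cands) A'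
        (kv + slots.length * kv + cands.length * (kv + t + 1)) ∧
      IsImprovement M' Φ G A A' ∧
      ∀ q ∈ cands, ∀ p ∈ slots, M'.Indep (swapSet A p q : Set σ) →
        q.elim 0 (marginal Φ A) - p.elim 0 (marginal Φ A) ≤ Φ A' - Φ A := by
  have hslot : ∀ p ∈ slots, Computes f w M (slotValue val A (Φ A) p)
      (p.elim 0 (marginal Φ A)) kv := by
    rintro (_ | x) hp
    · exact computes_output _ _
    · rw [Option.elim_some, marginal_of_mem (hslots _ hp x rfl)]
      exact (hval _).bind (k' := 0) (computes_output _ 0)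
  obtain ⟨wt, hwt, hwtv⟩ := exists_computes_tabulate slots hslot
  have hcandv : ∀ q ∈ cands, Computes f w M (candidateValue val A (Φ A) q)
      (q.elim 0 (marginal Φ A)) kv := by
    rintro (_ | x) hp
    · exact computes_output _ _
    · rw [Option.elim_some, marginal_of_notMem (hcands _ hp x rfl).1]
      exact (hval _).bind (k' := 0) (computes_output _ 0)
  have hswap : ∀ q ∈ cands, ∃ o : Option (Option σ),
      Computes f w M (findSwap ind t A (sortByWeight wt slots) q) o (t + 1) ∧
      (∀ p ∈ o, p ∈ slots ∧ M'.Indep (swapSet A p q : Set σ)) ∧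
      ∀ p' ∈ slots, M'.Indep (swapSet A p' q : Set σ) → ∃ p ∈ o, wt p ≤ wt p' := by
    intro q hq
    obtain ⟨o, ho, h1, h2⟩ := exists_computes_findSwap (f := f) (w := w) (M := M) hE hind
      (t := t) (ps := sortByWeight wt slots) (q := q) hA
      (fun h => hne (by simpa [h] using (length_sortByWeight wt slots).symm))
      (by rwa [length_sortByWeight]) (fun x hx => (hcands q hq x hx).1)
      (pairwise_sortByWeight wt _)
    simp only [mem_sortByWeight] at h1 h2
    exact ⟨o, ho, h1, h2⟩
  choose! o ho ho1 ho2 using hswap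
  obtain ⟨tab, htab, htabv⟩ := exists_computes_tabulate (f := f) (w := w) (M := M)
    (F := fun q => (candidateValue val A (Φ A) q).bind fun y =>
      (findSwap ind t A (sortByWeight wt slots) q).bind fun o =>
        output (o.map fun p => (swapSet A p q, y - wt p)))
    (val := fun q => (o q).map fun p => (swapSet A p q, q.elim 0 (marginal Φ A) - wt p))
    (k := kv + (t + 1)) cands
    fun q hq => (hcandv q hq).bind (k' := t + 1)
      ((ho q hq).bind (k' := 0) (computes_output _ 0))
  have hmemc : ∀ c, c ∈ cands.filterMap tab ↔ ∃ q ∈ cands, ∃ p ∈ o q,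
      c = (swapSet A p q, q.elim 0 (marginal Φ A) - wt p) := by
    intro c
    rw [List.mem_filterMap]
    constructor
    · rintro ⟨q, hq, h⟩
      rw [htabv q hq, Option.map_eq_some_iff] at h
      obtain ⟨p, hp, rfl⟩ := h
      exact ⟨q, hq, p, hp, rfl⟩
    · rintro ⟨q, hq, p, hp, rfl⟩
      refine ⟨q, hq, ?_⟩
      rw [htabv q hq, Option.map_eq_some_iff]
      exact ⟨p, hp, rfl⟩
  obtain ⟨hb1, hb2⟩ := bestCandidate_spec A (cands.filterMap tab)
  have hgain : IsImprovement M' Φ G A (bestCandidate A (cands.filterMap tab)).1 ∧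
      (bestCandidate A (cands.filterMap tab)).2 ≤
        Φ (bestCandidate A (cands.filterMap tab)).1 - Φ A := by
    rcases hb1 with h | ⟨h, hpos⟩
    · rw [h]
      exact ⟨⟨hA, hAG, Or.inl rfl⟩, by simp⟩
    · obtain ⟨q, hq, p, hp, hc⟩ := (hmemc _).1 h
      rw [hc] at hpos ⊢
      obtain ⟨hp1, hp2⟩ := ho1 q hq p hp
      have hle := marginal_sub_marginal_le hΦ (A := A) (p := p) (q := q) (hslots p hp1)
        fun x hx => (hcands q hq x hx).1
      rw [hwtv p hp1] at hpos ⊢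
      refine ⟨⟨hp2, ?_, Or.inr ⟨isLocalStep_swapSet _ _ _, ?_⟩⟩, hle⟩
      · intro x hx
        rcases Finset.mem_union.1 hx with hx | hx
        · exact hAG (Finset.mem_sdiff.1 hx).1
        · exact (hcands q hq x (Option.mem_toFinset.1 hx)).2
      · simp only at hpos
        linarith
  refine ⟨(bestCandidate A (cands.filterMap tab)).1, ?_, hgain.1, ?_⟩
  · have h := (hval A).bind (F := fun a => (tabulate (slotValue val A a) slots).bind fun wt =>
      (tabulate (fun q => (candidateValue val A a q).bind fun y =>
          (findSwap ind t A (sortByWeight wt slots) q).bind fun o =>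
            output (o.map fun p => (swapSet A p q, y - wt p))) cands).bind fun tab =>
        output (bestCandidate A (cands.filterMap tab)).1)
      (hwt.bind (htab.bind (computes_output _ 0)))
    exact h.mono (le_of_eq (by ring))
  · intro q hq p hp hi
    obtain ⟨p', hp', hle⟩ := ho2 q hq p hp hi
    have h1 := hb2 _ ((hmemc _).2 ⟨q, hq, p', hp', rfl⟩)
    rw [hwtv p hp] at hle
    simp only at h1
    linarith [hgain.2]

/-! ### Recognizing approximate local optima -/

/-- A number `e` bounds the violation of local optimality of `A` in the ground set `G`. -/
def IsLocalOptIn (M' : Matroid σ) (Φ : Finset σ → ℝ) (G A : Finset σ) (e : ℝ) : Prop :=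
  ∀ T : Finset σ, M'.Indep (T : Set σ) → T ⊆ G →
    ∑ p ∈ T, marginal Φ A p - ∑ p ∈ A, marginal Φ A p ≤ e

open Classical in
/-- Test whether `A` is approximately locally optimal. -/
noncomputable def testOpt (ind : Finset σ → OracleAlg N Bool) (val gval : Finset σ → OracleAlg N ℝ)
    (t : ℕ) (ε : ℝ) (G A : Finset σ) : OracleAlg N Bool :=
  (tabulate (fun p => (val (insert p (A.erase p))).bind fun x =>
      (val (A.erase p)).bind fun y => output (x - y)) G.toList).bind fun ω =>
    (maxWeight ind t ω G.toList).bind fun T =>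
      (gval A).bind fun g => output (decide (∑ p ∈ T, ω p - ∑ p ∈ A, ω p ≤ ε * g))

-- At a fixed `A` the violation is linear in the competitor, so an independent set of maximal
-- marginal weight is the worst competitor and a single comparison decides.
open Classical in
theorem computes_testOpt [Fintype σ] (hE : M'.E = Set.univ)
    (hind : ∀ X : Finset σ, Computes f w M (ind X) (decide (M'.Indep (X : Set σ))) 1)
    {val gval : Finset σ → OracleAlg N ℝ} {Φ g : Finset σ → ℝ} {kv : ℕ}
    (hval : ∀ X, Computes f w M (val X) (Φ X) kv) (hgval : ∀ X, Computes f w M (gval X) (g X) kv)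
    {t : ℕ} (ht : Fintype.card σ + 1 ≤ 2 ^ t) (ε : ℝ) {G A : Finset σ} (hAG : A ⊆ G) :
    Computes f w M (testOpt ind val gval t ε G A)
      (decide (IsLocalOptIn M' Φ G A (ε * g A))) (G.card * (2 * kv + t + 1) + kv) := by
  obtain ⟨ω, hω, hωv⟩ := exists_computes_tabulate (f := f) (w := w) (M := M)
    (F := fun p => (val (insert p (A.erase p))).bind fun x =>
      (val (A.erase p)).bind fun y => output (x - y))
    (val := marginal Φ A) (k := kv + (kv + 0)) G.toList
    fun p _ => (hval _).bind ((hval _).bind (computes_output _ 0))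
  obtain ⟨T, hT, hcert⟩ := exists_computes_maxWeight (f := f) (w := w) (M := M) hE hind ω ht
    G.toList
  have hb : (∑ p ∈ T, ω p - ∑ p ∈ A, ω p ≤ ε * g A) ↔ IsLocalOptIn M' Φ G A (ε * g A) := by
    have hsum : ∀ X ⊆ G, ∑ p ∈ X, ω p = ∑ p ∈ X, marginal Φ A p := fun X hX =>
      Finset.sum_congr rfl fun p hp => hωv p (Finset.mem_toList.2 (hX hp))
    have hTG : T ⊆ G := fun p hp => Finset.mem_toList.1 (hcert.mem p hp)
    rw [hsum A hAG, hsum T hTG]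
    constructor
    · intro h T' hT' hTG'
      have := hcert.sum_le hT' fun p hp => Finset.mem_toList.2 (hTG' hp)
      rw [hsum T hTG, hsum T' hTG'] at this
      linarith
    · intro h
      exact h T hcert.indep hTG
  have h := hω.bind (F := fun ω => (maxWeight ind t ω G.toList).bind fun T =>
      (gval A).bind fun g => output (decide (∑ p ∈ T, ω p - ∑ p ∈ A, ω p ≤ ε * g)))
    (hT.bind ((hgval A).bind (computes_output _ 0)))
  rw [decide_eq_decide.2 hb] at h
  refine h.mono (le_of_eq ?_)
  rw [Finset.length_toList]
  ring

end OracleAlg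

namespace OracleAlg

variable {N : Type u} {f w : Finset N → ℝ} {M : Matroid N}

/-! ### The best of several random candidates -/

/-- The first draw that hits the image of `K` is uniform on it, so the expectation is at least the
probability of a hit times the average gain. The induction separates hits from misses of the first
draw. -/
theorem le_expect_uniformList {X κ : Type*} [Fintype X] [Nonempty X]
    (K : Finset κ) (hK : K.Nonempty) {τ : κ → X} (hτ : Function.Injective τ) (G : κ → ℝ) (m : ℕ)
    (ψ : List X → ℝ) (h0 : ∀ l, 0 ≤ ψ l) (hψ : ∀ l, ∀ k ∈ K, τ k ∈ l → G k ≤ ψ l) :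
    (1 - (1 - (K.card : ℝ) / Fintype.card X) ^ m) * ((∑ k ∈ K, G k) / K.card) ≤
      (uniformList X m : OracleAlg N (List X)).expect f w M ψ := by
  classical
  have hs : (0 : ℝ) < K.card := by exact_mod_cast hK.card_pos
  have hU : (0 : ℝ) < Fintype.card X := by exact_mod_cast Fintype.card_pos
  induction m generalizing ψ with
  | zero => simpa [uniformList, expect] using h0 []
  | succ m ih =>
    rw [uniformList, expect_bind, expect_uniform, le_div_iff₀ hU]
    have hrest : ∀ x : X, (1 - (1 - (K.card : ℝ) / Fintype.card X) ^ m) *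
        ((∑ k ∈ K, G k) / K.card) ≤
        ((uniformList X m : OracleAlg N (List X)).bind fun l => output (x :: l)).expect
          f w M ψ := by
      intro x
      rw [expect_bind]
      exact ih _ (fun l => h0 _) fun l k hk hkl => hψ _ k hk (List.mem_cons_of_mem _ hkl)
    have hhit : ∀ k ∈ K, G k ≤
        ((uniformList X m : OracleAlg N (List X)).bind fun l => output (τ k :: l)).expect
          f w M ψ := by
      intro k hk
      rw [expect_bind, ← expect_const f w M (uniformList X m) (G k)]
      exact expect_mono fun l _ => hψ _ k hk List.mem_cons_self
    rw [← Finset.sum_compl_add_sum (K.image τ), Finset.sum_image fun x _ y _ e => hτ e]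
    have h1 := Finset.sum_le_sum hhit
    have h2 := Finset.sum_le_sum fun x (_ : x ∈ (K.image τ)ᶜ) => hrest x
    rw [Finset.sum_const, nsmul_eq_mul, Finset.card_compl, Finset.card_image_of_injective _ hτ,
      Nat.cast_sub ((Finset.card_image_of_injective K hτ).ge.trans (Finset.card_le_univ _))] at h2
    refine le_trans (le_of_eq ?_) (add_le_add h2 h1)
    rw [pow_succ]
    field_simp
    ring

theorem one_sub_div_pow_le_half {s U m : ℕ} (hU : 0 < U) (hs : s ≤ U) (h : U ≤ m * s) :
    (1 - (s : ℝ) / U) ^ m ≤ 1 / 2 := by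
  have hU' : (0 : ℝ) < U := by exact_mod_cast hU
  have h0 : 0 ≤ 1 - (s : ℝ) / U := by
    rw [sub_nonneg, div_le_one hU']
    exact_mod_cast hs
  calc (1 - (s : ℝ) / U) ^ m ≤ Real.exp (-((s : ℝ) / U)) ^ m :=
        pow_le_pow_left₀ h0 (Real.one_sub_le_exp_neg _) m
    _ = Real.exp (-((m : ℝ) * s / U)) := by
        rw [← Real.exp_nat_mul]
        congr 1
        ring
    _ ≤ Real.exp (-1) := by
        refine Real.exp_le_exp.2 (neg_le_neg ?_)
        rw [le_div_iff₀ hU', one_mul]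
        exact_mod_cast h
    _ ≤ 1 / 2 := by
        rw [Real.exp_neg, ← one_div]
        exact one_div_le_one_div_of_le (by norm_num) (by linarith [Real.exp_one_gt_d9])

/-! ### Cyclic windows -/

/-- The `s` cyclically consecutive indices from `k₀` on. -/
def window {R : ℕ} [NeZero R] (s : ℕ) (k₀ : Fin R) : Finset (Fin R) :=
  Finset.univ.filter fun k => ((k - k₀ : Fin R) : ℕ) < s

theorem card_window {R : ℕ} [NeZero R] {s : ℕ} (h : s ≤ R) (k₀ : Fin R) :
    (window s k₀).card = s := by
  have e : (Finset.univ.filter fun k : Fin R => (k : ℕ) < s).card = s := by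
    rw [Fin.card_filter_val_lt, min_eq_right h]
  refine Eq.trans (Finset.card_bij (fun k _ => k - k₀) ?_ ?_ ?_) e
  · intro k hk
    simpa [window] using hk
  · intro a _ b _ e
    exact sub_left_injective e
  · intro b hb
    exact ⟨b + k₀, by simpa [window] using hb, by simp⟩

/-- Each index lies in exactly `s` cyclic windows, so a random window has the overall average gain.
-/
theorem sum_sum_window {R : ℕ} [NeZero R] {s : ℕ} (h : s ≤ R) (G : Fin R → ℝ) :
    ∑ k₀, ∑ k ∈ window s k₀, G k = s * ∑ k, G k := by
  simp only [window, Finset.sum_filter]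
  rw [Finset.sum_comm, Finset.mul_sum]
  refine Finset.sum_congr rfl fun k _ => ?_
  rw [← Finset.sum_filter, Finset.sum_const, nsmul_eq_mul]
  congr 2
  have e : (Finset.univ.filter fun k : Fin R => (k : ℕ) < s).card = s := by
    rw [Fin.card_filter_val_lt, min_eq_right h]
  refine Eq.trans (Finset.card_bij (fun k₀ _ => k - k₀) ?_ ?_ ?_) e
  · intro k₀ hk
    simpa using hk
  · intro a _ b _ e
    exact sub_right_injective e
  · intro b hb
    exact ⟨k - b, by simpa using hb, by simp⟩

/-! ### Improvement steps -/

section steps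

variable {σ : Type v} [DecidableEq σ] {M' : Matroid σ} {ind : Finset σ → OracleAlg N Bool}

/-- The element that a candidate adds to `A`, if any. -/
def candidateElem {R : ℕ} (G A : Finset σ) : σ ⊕ Fin R → Option σ
  | Sum.inl q => if q ∈ G ∧ q ∉ A then some q else none
  | Sum.inr _ => none

/-- Perform the best exchange between given slots and given candidates. -/
noncomputable def improveOn (ind : Finset σ → OracleAlg N Bool) (val : Finset σ → OracleAlg N ℝ)
    (t : ℕ) {R : ℕ} (G A : Finset σ) (K : Finset (Fin R)) (l : List (σ ⊕ Fin R)) :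
    OracleAlg N (Finset σ) :=
  improve ind val t A (K.toList.map (slot A)) (l.map (candidateElem G A))

open Classical in
theorem exists_computes_improveOn (hE : M'.E = Set.univ)
    (hind : ∀ X : Finset σ, Computes f w M (ind X) (decide (M'.Indep (X : Set σ))) 1)
    {val : Finset σ → OracleAlg N ℝ} {Φ : Finset σ → ℝ} {kv : ℕ}
    (hval : ∀ X, Computes f w M (val X) (Φ X) kv) (hΦ : IsSubmodular Φ)
    {t : ℕ} {G A : Finset σ} (hA : M'.Indep (A : Set σ)) (hAG : A ⊆ G)
    {R : ℕ} {K : Finset (Fin R)} (hK : K.Nonempty) (hKt : K.card ≤ 2 ^ t)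
    (l : List (σ ⊕ Fin R)) :
    ∃ A', Computes f w M (improveOn ind val t G A K l) A'
        (kv + K.card * kv + l.length * (kv + t + 1)) ∧
      IsImprovement M' Φ G A A' ∧
      ∀ T ⊆ G, ∀ τ : Fin R → σ ⊕ Fin R,
        (∀ k, τ k = Sum.inr k ∨ ∃ q ∈ T, q ∉ A ∧ τ k = Sum.inl q ∧
          M'.Indep (swapSet A (slot A k) (some q) : Set σ)) →
        ∀ k ∈ K, τ k ∈ l →
          max 0 ((τ k).elim (marginal Φ A) (fun _ => 0) - (slot A k).elim 0 (marginal Φ A)) ≤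
            Φ A' - Φ A := by
  obtain ⟨A', hc, himp, hgain⟩ := exists_computes_improve (f := f) (w := w) (M := M) hE hind hval
    hΦ (t := t) hA hAG (slots := K.toList.map (slot A)) (cands := l.map (candidateElem G A))
    (by simpa using hK.ne_empty) (by simpa using hKt)
    (by
      intro p hp x hx
      obtain ⟨k, -, rfl⟩ := List.mem_map.1 hp
      exact mem_of_slot_eq hx)
    (by
      intro q hq x hx
      obtain ⟨y, -, rfl⟩ := List.mem_map.1 hq
      rcases y with y | y
      · simp only [candidateElem] at hx
        split_ifs at hx with h
        · obtain rfl := Option.some.inj hx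
          exact h.symm
        · cases hx
      · cases hx)
  refine ⟨A', by simpa [improveOn] using hc, himp, fun T hT τ hτ k hk hkl => max_le ?_ ?_⟩
  · exact sub_nonneg.2 himp.le
  · have hslot : slot A k ∈ K.toList.map (slot A) :=
      List.mem_map.2 ⟨k, Finset.mem_toList.2 hk, rfl⟩
    have hcand := List.mem_map_of_mem (f := candidateElem G A) hkl
    rcases hτ k with h | ⟨q, hqT, hqA, h, hf⟩
    · rw [h] at hcand ⊢
      refine hgain none hcand _ hslot (hA.subset ?_)
      simp [swapSet]
    · rw [h] at hcand ⊢
      have : candidateElem G A (Sum.inl q : σ ⊕ Fin R) = some q := if_pos ⟨hT hqT, hqA⟩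
      rw [this] at hcand
      exact hgain _ hcand _ hslot hf

/-- The best of all exchanges. -/
noncomputable def fullImprove [Fintype σ] (ind : Finset σ → OracleAlg N Bool)
    (val : Finset σ → OracleAlg N ℝ) (t R : ℕ) (G A : Finset σ) : OracleAlg N (Finset σ) :=
  improveOn ind val t G A (Finset.univ : Finset (Fin R)) Finset.univ.toList

-- The best of `R` exchanges gains at least their average, and their total gain is at least the
-- violation.
open Classical in
theorem exists_computes_fullImprove [Fintype σ] (hE : M'.E = Set.univ)
    (hind : ∀ X : Finset σ, Computes f w M (ind X) (decide (M'.Indep (X : Set σ))) 1)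
    {val : Finset σ → OracleAlg N ℝ} {Φ : Finset σ → ℝ} {kv : ℕ}
    (hval : ∀ X, Computes f w M (val X) (Φ X) kv) (hΦ : IsSubmodular Φ)
    {t R : ℕ} [NeZero R] {G A : Finset σ} (hA : M'.Indep (A : Set σ)) (hAG : A ⊆ G)
    (hR : ∀ X : Finset σ, M'.Indep (X : Set σ) → X.card ≤ R) (hRt : R ≤ 2 ^ t) :
    ∃ A', Computes f w M (fullImprove ind val t R G A) A'
        (kv + R * kv + (Fintype.card σ + R) * (kv + t + 1)) ∧
      IsImprovement M' Φ G A A' ∧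
      ∀ T ⊆ G, M'.Indep (T : Set σ) →
        (∑ p ∈ T, marginal Φ A p - ∑ p ∈ A, marginal Φ A p) / R ≤ Φ A' - Φ A := by
  obtain ⟨A', hc, himp, hgain⟩ := exists_computes_improveOn (f := f) (w := w) (M := M) hE hind
    hval hΦ (t := t) hA hAG (R := R) (K := Finset.univ) ⟨0, Finset.mem_univ _⟩ (by simpa using hRt)
    Finset.univ.toList
  refine ⟨A', by simpa [fullImprove] using hc, himp, fun T hTG hT => ?_⟩
  obtain ⟨τ, -, hτ, hsum⟩ := exists_exchange_candidates hE hA hT (hR A hA) (hR T hT)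
    (marginal Φ A)
  have hR0 : (0 : ℝ) < R := by exact_mod_cast Nat.pos_of_ne_zero (NeZero.ne R)
  rw [div_le_iff₀ hR0]
  refine hsum.trans ((Finset.sum_le_sum fun k _ =>
    hgain T hTG τ hτ k (Finset.mem_univ k) (by simp)).trans (le_of_eq ?_))
  rw [Finset.sum_const, nsmul_eq_mul, Finset.card_univ, Fintype.card_fin, mul_comm]

/-- The best exchange between `s` cyclically consecutive slots and `m` random candidates. -/
noncomputable def randomImprove [Fintype σ] (ind : Finset σ → OracleAlg N Bool)
    (val : Finset σ → OracleAlg N ℝ) (t R : ℕ) [NeZero R] (s m : ℕ) (G A : Finset σ) :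
    OracleAlg N (Finset σ) :=
  have : Nonempty (Fin R) := ⟨0⟩
  (uniform (Fin R)).bind fun k₀ => (uniformList (σ ⊕ Fin R) m).bind fun l =>
    improveOn ind val t G A (window s k₀) l

-- Each slot of the window has a matched candidate, and the matched candidates are distinct. With `m
-- * s` at least the number of all candidates, some matched one is drawn with probability at least
-- 1/2. This halves the average gain obtained from the full step.
open Classical in
theorem randomImprove_spec [Fintype σ] (hE : M'.E = Set.univ)
    (hind : ∀ X : Finset σ, Computes f w M (ind X) (decide (M'.Indep (X : Set σ))) 1)
    {val : Finset σ → OracleAlg N ℝ} {Φ : Finset σ → ℝ} {kv : ℕ}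
    (hval : ∀ X, Computes f w M (val X) (Φ X) kv) (hΦ : IsSubmodular Φ)
    {t R : ℕ} [NeZero R] {G A : Finset σ} (hA : M'.Indep (A : Set σ)) (hAG : A ⊆ G)
    (hR : ∀ X : Finset σ, M'.Indep (X : Set σ) → X.card ≤ R) (hRt : R ≤ 2 ^ t)
    {s m : ℕ} (hs : 1 ≤ s) (hsR : s ≤ R) (hm : Fintype.card σ + R ≤ m * s) :
    (randomImprove ind val t R s m G A).queries f w M ≤ kv + s * kv + m * (kv + t + 1) ∧
      (∀ A' ∈ (randomImprove ind val t R s m G A).outcomes f w M, IsImprovement M' Φ G A A') ∧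
      ∀ T ⊆ G, M'.Indep (T : Set σ) →
        Φ A + (∑ p ∈ T, marginal Φ A p - ∑ p ∈ A, marginal Φ A p) / (2 * R) ≤
          (randomImprove ind val t R s m G A).expect f w M Φ := by
  have hne : Nonempty (Fin R) := ⟨0⟩
  have hW : ∀ k₀ : Fin R, (window s k₀).Nonempty := fun k₀ =>
    Finset.card_pos.1 (by rw [card_window hsR]; exact hs)
  have hWt : ∀ k₀ : Fin R, (window s k₀).card ≤ 2 ^ t := fun k₀ => by
    rw [card_window hsR]
    exact hsR.trans hRt
  choose A' hc himp hgain using fun (k₀ : Fin R) (l : List (σ ⊕ Fin R)) =>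
    exists_computes_improveOn (f := f) (w := w) (M := M) hE hind
      hval hΦ (t := t) hA hAG (hW k₀) (hWt k₀) l
  refine ⟨?_, ?_, ?_⟩
  · refine (queries_bind_le (queries_uniform _).le (k := 0 + (kv + s * kv + m * (kv + t + 1)))
      fun k₀ _ => ?_).trans (by simp)
    refine queries_bind_le (queries_uniformList _ _).le fun l hl => ?_
    have := (hc k₀ l).queries_le
    rwa [card_window hsR, length_of_mem_outcomes_uniformList hl] at this
  · intro A'' h
    obtain ⟨k₀, -, h⟩ := (mem_outcomes_bind ..).1 h
    obtain ⟨l, -, h⟩ := (mem_outcomes_bind ..).1 h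
    rw [(hc k₀ l).outcomes_eq] at h
    obtain rfl := h
    exact himp k₀ l
  · intro T hTG hT
    obtain ⟨τ, hinj, hτ, hsum⟩ := exists_exchange_candidates hE hA hT (hR A hA) (hR T hT)
      (marginal Φ A)
    set gain : Fin R → ℝ := fun k =>
      max 0 ((τ k).elim (marginal Φ A) (fun _ => 0) - (slot A k).elim 0 (marginal Φ A)) with hgain'
    have hR0 : (0 : ℝ) < R := by exact_mod_cast Nat.pos_of_ne_zero (NeZero.ne R)
    have hs0 : (0 : ℝ) < s := by exact_mod_cast hs
    have hcard : Fintype.card (σ ⊕ Fin R) = Fintype.card σ + R := by simp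
    have hhalf : (1 - (s : ℝ) / (Fintype.card (σ ⊕ Fin R))) ^ m ≤ 1 / 2 :=
      one_sub_div_pow_le_half Fintype.card_pos (by rw [hcard]; omega) (by rw [hcard]; exact hm)
    have hk : ∀ k₀ : Fin R, Φ A + 1 / 2 * ((∑ k ∈ window s k₀, gain k) / s) ≤
        ((uniformList (σ ⊕ Fin R) m).bind fun l =>
          improveOn ind val t G A (window s k₀) l).expect f w M Φ := by
      intro k₀
      rw [expect_bind, expect_congr (ψ := fun l => Φ A + (Φ (A' k₀ l) - Φ A)) fun l _ => by
        rw [(hc k₀ l).expect_eq]; ring, expect_add, expect_const]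
      have h := le_expect_uniformList (N := N) (f := f) (w := w) (M := M) (window s k₀) (hW k₀)
        hinj gain m (fun l => Φ (A' k₀ l) - Φ A) (fun l => sub_nonneg.2 (himp k₀ l).le)
        fun l k hkW hkl => hgain k₀ l T hTG τ hτ k hkW hkl
      rw [card_window hsR] at h
      have h0 : 0 ≤ (∑ k ∈ window s k₀, gain k) / s :=
        div_nonneg (Finset.sum_nonneg fun k _ => le_max_left _ _) hs0.le
      nlinarith
    rw [randomImprove, expect_bind, expect_uniform, le_div_iff₀ (by simpa using hR0),
      Fintype.card_fin]
    refine le_trans ?_ (Finset.sum_le_sum fun k₀ _ => hk k₀)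
    rw [Finset.sum_add_distrib, Finset.sum_const, nsmul_eq_mul, Finset.card_univ,
      Fintype.card_fin, ← Finset.mul_sum, ← Finset.sum_div, sum_sum_window hsR,
      mul_div_cancel_left₀ _ hs0.ne', add_mul, mul_comm (R : ℝ)]
    refine add_le_add le_rfl ?_
    have e : ∀ y : ℝ, y / (2 * R) * R = 1 / 2 * y := fun y => by field_simp
    rw [e]
    exact mul_le_mul_of_nonneg_left hsum (by norm_num)

end steps

/-! ### Repetition -/

section repetition

variable {S : Type v}

/-- Perform `t` steps. -/
def iterate (step : S → OracleAlg N S) : ℕ → S → OracleAlg N S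
  | 0, x => output x
  | t + 1, x => (step x).bind (iterate step t)

/-- Perform a random number of steps, less than `K`. -/
noncomputable def randomIterate (step : S → OracleAlg N S) (K : ℕ) [NeZero K] (x : S) :
    OracleAlg N S :=
  have : Nonempty (Fin K) := ⟨0⟩
  (uniform (Fin K)).bind fun i => iterate step i x

/-- Repeat a move until a test succeeds, but at most `n` times. -/
def attempt (test : S → OracleAlg N Bool) (move : S → OracleAlg N S) : ℕ → S → OracleAlg N S
  | 0, x => output x
  | n + 1, x => (test x).bind fun b =>
      if b then output x else (move x).bind (attempt test move n)

variable {step : S → OracleAlg N S} {Inv bad : S → Prop}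

theorem inv_iterate (h1 : ∀ x, Inv x → ∀ y ∈ (step x).outcomes f w M, Inv y) (t : ℕ) {x y : S}
    (hx : Inv x) (hy : y ∈ (iterate step t x).outcomes f w M) : Inv y := by
  induction t generalizing x with
  | zero =>
    obtain rfl : y = x := hy
    exact hx
  | succ t ih =>
    obtain ⟨z, hz, hy⟩ := (mem_outcomes_bind ..).1 hy
    exact ih (h1 x hx z hz) hy

theorem inv_randomIterate (h1 : ∀ x, Inv x → ∀ y ∈ (step x).outcomes f w M, Inv y) (K : ℕ)
    [NeZero K] {x y : S} (hx : Inv x) (hy : y ∈ (randomIterate step K x).outcomes f w M) :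
    Inv y := by
  obtain ⟨i, -, hy⟩ := (mem_outcomes_bind ..).1 hy
  exact inv_iterate h1 i hx hy

theorem queries_iterate_le (h1 : ∀ x, Inv x → ∀ y ∈ (step x).outcomes f w M, Inv y) {k : ℕ}
    (hk : ∀ x, Inv x → (step x).queries f w M ≤ k) (t : ℕ) {x : S} (hx : Inv x) :
    (iterate step t x).queries f w M ≤ t * k := by
  induction t generalizing x with
  | zero => exact Nat.zero_le _
  | succ t ih =>
    have e : (t + 1) * k = k + t * k := by ring
    rw [e]
    exact queries_bind_le (hk x hx) fun y hy => ih (h1 x hx y hy)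

theorem queries_randomIterate_le (h1 : ∀ x, Inv x → ∀ y ∈ (step x).outcomes f w M, Inv y) {k : ℕ}
    (hk : ∀ x, Inv x → (step x).queries f w M ≤ k) (K : ℕ) [NeZero K] {x : S} (hx : Inv x) :
    (randomIterate step K x).queries f w M ≤ K * k := by
  have hne : Nonempty (Fin K) := ⟨0⟩
  refine (queries_bind_le (queries_uniform _).le (k := K * k) fun i _ => ?_).trans (by simp)
  exact (queries_iterate_le h1 hk i hx).trans (Nat.mul_le_mul_right _ i.2.le)

/-- If a bounded potential decreases by `γ` in expectation in each bad state, then there are few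
bad states in expectation. -/
theorem sum_prob_iterate_le (h1 : ∀ x, Inv x → ∀ y ∈ (step x).outcomes f w M, Inv y)
    {ψ : S → ℝ} {lo γ : ℝ} (h2 : ∀ x, Inv x → lo ≤ ψ x)
    (h3 : ∀ x, Inv x → (step x).expect f w M ψ ≤ ψ x)
    (h4 : ∀ x, Inv x → bad x → (step x).expect f w M ψ ≤ ψ x - γ) (K : ℕ) {x : S} (hx : Inv x) :
    ∑ t ∈ Finset.range K, γ * (iterate step t x).prob f w M bad ≤ ψ x - lo := by
  induction K generalizing x with
  | zero => simpa using h2 x hx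
  | succ K ih =>
    rw [Finset.sum_range_succ']
    -- Conditioning on the first step expresses the later bad states through runs started at `y`, to
    -- which the induction hypothesis applies.
    have e : ∀ t, γ * (iterate step (t + 1) x).prob f w M bad =
        (step x).expect f w M fun y => γ * (iterate step t y).prob f w M bad := by
      intro t
      rw [iterate, prob, expect_bind, expect_const_mul]
      rfl
    have e2 : ∀ n, ∑ t ∈ Finset.range n, γ * (iterate step (t + 1) x).prob f w M bad =
        (step x).expect f w M fun y =>
          ∑ t ∈ Finset.range n, γ * (iterate step t y).prob f w M bad := by
      intro n
      induction n with
      | zero => simpa using (expect_const f w M (step x) 0).symm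
      | succ n ihn =>
        rw [Finset.sum_range_succ, ihn, e, ← expect_add]
        exact expect_congr fun y _ => (Finset.sum_range_succ _ _).symm
    have e3 : (step x).expect f w M (fun y =>
        ∑ t ∈ Finset.range K, γ * (iterate step t y).prob f w M bad) ≤
        (step x).expect f w M ψ - lo := by
      have := expect_mono (f := f) (w := w) (M := M) (A := step x) (φ := fun y =>
        ∑ t ∈ Finset.range K, γ * (iterate step t y).prob f w M bad)
        (ψ := fun y => ψ y + -lo) fun y hy => by
          have := ih (h1 x hx y hy)
          linarith
      rw [expect_add, expect_const] at this
      linarith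
    rw [e2]
    by_cases hb : bad x
    · have : (iterate step 0 x).prob f w M bad = 1 := by simp [iterate, prob, expect, hb]
      rw [this]
      linarith [h4 x hx hb]
    · have : (iterate step 0 x).prob f w M bad = 0 := by simp [iterate, prob, expect, hb]
      rw [this]
      linarith [h3 x hx]

-- On average over the time, at most half of the states among the first `K` are bad. Stopping at a
-- uniformly random time thus replaces a costly test after each step.
open Classical in
theorem prob_randomIterate_le (h1 : ∀ x, Inv x → ∀ y ∈ (step x).outcomes f w M, Inv y)
    {ψ : S → ℝ} {lo γ : ℝ} (hγ : 0 < γ) (h2 : ∀ x, Inv x → lo ≤ ψ x)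
    (h3 : ∀ x, Inv x → (step x).expect f w M ψ ≤ ψ x)
    (h4 : ∀ x, Inv x → bad x → (step x).expect f w M ψ ≤ ψ x - γ) (K : ℕ) [NeZero K] {x : S}
    (hx : Inv x) (hK : 2 * (ψ x - lo) ≤ γ * K) :
    (randomIterate step K x).prob f w M bad ≤ 1 / 2 := by
  have hne : Nonempty (Fin K) := ⟨0⟩
  have hK0 : (0 : ℝ) < K := by exact_mod_cast Nat.pos_of_ne_zero (NeZero.ne K)
  have h := sum_prob_iterate_le h1 h2 h3 h4 K hx
  rw [← Finset.mul_sum] at h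
  rw [randomIterate, prob, expect_bind, expect_uniform, Fintype.card_fin, div_le_iff₀ hK0,
    Fin.sum_univ_eq_sum_range fun t => (iterate step t x).expect f w M fun b => if bad b then 1 else 0]
  have h' : γ * (2 * ∑ t ∈ Finset.range K, (iterate step t x).prob f w M bad) ≤ γ * K := by
    linarith
  have := le_of_mul_le_mul_left h' hγ
  simp only [prob] at this
  linarith

variable {test : S → OracleAlg N Bool} {move : S → OracleAlg N S}

theorem inv_attempt (h1 : ∀ x, Inv x → ∀ y ∈ (move x).outcomes f w M, Inv y) (n : ℕ) {x y : S}
    (hx : Inv x) (hy : y ∈ (attempt test move n x).outcomes f w M) : Inv y := by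
  induction n generalizing x with
  | zero =>
    obtain rfl : y = x := hy
    exact hx
  | succ n ih =>
    obtain ⟨b, -, hy⟩ := (mem_outcomes_bind ..).1 hy
    split_ifs at hy
    · obtain rfl : y = x := hy
      exact hx
    · obtain ⟨z, hz, hy⟩ := (mem_outcomes_bind ..).1 hy
      exact ih (h1 x hx z hz) hy

theorem queries_attempt_le (h1 : ∀ x, Inv x → ∀ y ∈ (move x).outcomes f w M, Inv y) {k k' : ℕ}
    (hk : ∀ x, Inv x → (test x).queries f w M ≤ k)
    (hk' : ∀ x, Inv x → (move x).queries f w M ≤ k') (n : ℕ) {x : S} (hx : Inv x) :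
    (attempt test move n x).queries f w M ≤ n * (k + k') := by
  induction n generalizing x with
  | zero => exact Nat.zero_le _
  | succ n ih =>
    have : (n + 1) * (k + k') = k + (k' + n * (k + k')) := by ring
    rw [this]
    refine queries_bind_le (hk x hx) fun b _ => ?_
    split_ifs
    · exact Nat.zero_le _
    · exact queries_bind_le (hk' x hx) fun y hy => ih (h1 x hx y hy)

-- A good state passes the test and is kept, so failure requires a failed move in every round.
open Classical in
theorem prob_attempt_le (h1 : ∀ x, Inv x → ∀ y ∈ (move x).outcomes f w M, Inv y) {k : ℕ}
    (ht : ∀ x, Inv x → Computes f w M (test x) (decide (¬ bad x)) k)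
    (hb : ∀ x, Inv x → bad x → (move x).prob f w M bad ≤ 1 / 2) (n : ℕ) {x : S} (hx : Inv x) :
    (attempt test move n x).prob f w M bad ≤ (1 / 2) ^ n := by
  have hgood : ∀ n x, Inv x → ¬ bad x → (attempt test move n x).prob f w M bad = 0 := by
    intro n x hx hbx
    cases n with
    | zero => simp [attempt, prob, expect, hbx]
    | succ n =>
      rw [attempt, prob, (ht x hx).expect_bind]
      simp [expect, hbx]
  induction n generalizing x with
  | zero => simp only [attempt, prob, expect, pow_zero]; split_ifs <;> norm_num
  | succ n ih =>
    by_cases hbx : bad x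
    · rw [attempt, prob, (ht x hx).expect_bind, if_neg (by simpa using hbx), expect_bind, pow_succ]
      calc _ ≤ (move x).expect f w M fun y => (1 / 2) ^ n * if bad y then 1 else 0 := by
            refine expect_mono fun y hy => ?_
            split_ifs with hby
            · simpa [prob] using ih (h1 x hx y hy)
            · simpa [prob] using (hgood n y (h1 x hx y hy) hby).le
        _ ≤ _ := by
            rw [expect_const_mul]
            exact mul_le_mul_of_nonneg_left (hb x hx hbx) (by positivity)
    · rw [hgood _ x hx hbx]
      positivity

-- Every move from a bad state lowers the potential by `γ`, and the number of rounds exceeds what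
-- the bound `lo` allows.
open Classical in
theorem not_bad_of_mem_outcomes_attempt
    (h1 : ∀ x, Inv x → ∀ y ∈ (move x).outcomes f w M, Inv y) {k : ℕ}
    (ht : ∀ x, Inv x → Computes f w M (test x) (decide (¬ bad x)) k)
    {ψ : S → ℝ} {lo γ : ℝ} (h2 : ∀ x, Inv x → bad x → lo ≤ ψ x)
    (h4 : ∀ x, Inv x → bad x → ∀ y ∈ (move x).outcomes f w M, ψ y ≤ ψ x - γ) (n : ℕ)
    {x y : S} (hx : Inv x) (hn : bad x → ψ x - lo < n * γ)
    (hy : y ∈ (attempt test move n x).outcomes f w M) : ¬ bad y := by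
  induction n generalizing x with
  | zero =>
    obtain rfl : y = x := hy
    intro hb
    have := hn hb
    have := h2 y hx hb
    simp at *
    linarith
  | succ n ih =>
    rw [attempt, (ht x hx).outcomes_bind] at hy
    split_ifs at hy with hb
    · obtain rfl : y = x := hy
      simpa using hb
    · have hb : bad x := by simpa using hb
      obtain ⟨z, hz, hy⟩ := (mem_outcomes_bind ..).1 hy
      refine ih (h1 x hx z hz) (fun _ => ?_) hy
      have e1 := h4 x hx hb z hz
      have e2 := hn hb
      push_cast at e2
      linarith

end repetition

end OracleAlg

/-! ### Solutions as independent sets -/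

section solutions

variable {N : Type u} [DecidableEq N] {L : ℕ} {M : Matroid N}

/-- The matroid on the pairs whose independent sets are the solutions. -/
def pairMatroid (M : Matroid N) (L : ℕ) : Matroid (N × Fin L) := M.comap Prod.fst

theorem coe_unionPart_univ (A : Finset (N × Fin L)) :
    (unionPart Finset.univ A : Set N) = Prod.fst '' (A : Set (N × Fin L)) := by
  simp [unionPart]

/-- Disjointness of the parts becomes part of independence, so the matroid exchange results cover
moves between parts as well. -/
theorem isSolution_iff {A : Finset (N × Fin L)} :
    IsSolution M A ↔ (pairMatroid M L).Indep (A : Set (N × Fin L)) := by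
  rw [pairMatroid, Matroid.comap_indep_iff, IsSolution, coe_unionPart_univ, and_comm]

omit [DecidableEq N] in
theorem pairMatroid_ground (hE : M.E = Set.univ) : (pairMatroid M L).E = Set.univ := by
  simp [pairMatroid, hE]

theorem IsSolution.sum_eq {A : Finset (N × Fin L)} (hA : IsSolution M A) (ω : N → ℝ) :
    ∑ p ∈ A, ω p.1 = ∑ x ∈ unionPart Finset.univ A, ω x := by
  have : unionPart Finset.univ A = A.image Prod.fst := by simp [unionPart]
  rw [this, Finset.sum_image hA.1]

theorem IsSolution.card_eq {A : Finset (N × Fin L)} (hA : IsSolution M A) :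
    (unionPart Finset.univ A).card = A.card := by
  have : unionPart Finset.univ A = A.image Prod.fst := by simp [unionPart]
  rw [this, Finset.card_image_of_injOn hA.1]

theorem isSolution_product_singleton {S : Finset N} (hS : M.Indep (S : Set N)) (i : Fin L) :
    IsSolution M (S ×ˢ {i}) := by
  refine ⟨?_, ?_⟩
  · rintro ⟨x, j⟩ hx ⟨y, k⟩ hy h
    simp only [Finset.coe_product, Finset.coe_singleton, Set.mem_prod,
      Set.mem_singleton_iff] at hx hy
    simp only at h
    rw [hx.2, hy.2, h]
  · rwa [unionPart_product_singleton, if_pos (Finset.mem_univ i)]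

omit [DecidableEq N] in
theorem sum_product_singleton' (S : Finset N) (i : Fin L) (F : N × Fin L → ℝ) :
    ∑ p ∈ S ×ˢ {i}, F p = ∑ x ∈ S, F (x, i) := by
  rw [Finset.sum_product]
  simp

/-- The pairs formed from the members of a list. -/
def pairsOf (part : List N) (L : ℕ) : Finset (N × Fin L) := part.toFinset ×ˢ Finset.univ

theorem mem_pairsOf {part : List N} {p : N × Fin L} : p ∈ pairsOf part L ↔ p.1 ∈ part := by
  simp [pairsOf]

theorem subset_pairsOf_iff {part : List N} {A : Finset (N × Fin L)} :
    A ⊆ pairsOf part L ↔ ∀ x ∈ unionPart Finset.univ A, x ∈ part := by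
  constructor
  · intro h x hx
    obtain ⟨i, -, hx⟩ := mem_unionPart.1 hx
    exact mem_pairsOf.1 (h hx)
  · intro h p hp
    exact mem_pairsOf.2 (h _ (mem_unionPart.2 ⟨p.2, Finset.mem_univ _, hp⟩))

theorem product_singleton_subset_pairsOf {part : List N} {S : Finset N} (h : ∀ x ∈ S, x ∈ part)
    (i : Fin L) : S ×ˢ {i} ⊆ pairsOf part L := by
  intro p hp
  exact mem_pairsOf.2 (h _ (Finset.mem_product.1 hp).1)

end solutions

/-! ### The analysis of the local search -/

section analysis

theorem sum_searchCoeff_pos (ℓ : ℕ) :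
    0 < ∑ J : Finset (Fin (ℓ + 1)), searchCoeff ℓ J.card :=
  Finset.sum_pos' (fun J _ => searchCoeff_nonneg ℓ _)
    ⟨Finset.univ, Finset.mem_univ _, searchCoeff_pos ℓ (by simp) (by simp)⟩

variable {N : Type u} [DecidableEq N]

/-- The situation after the preparation of a search for the normalized function `f`. -/
structure SearchSetting (ℓ : ℕ) (f w : Finset N → ℝ) (M : Matroid N) (κ ε η b δ : ℝ) (R : ℕ)
    (l part : List N) (start : Finset N) (v : ℝ) : Prop where
  mono : Monotone f
  submodular : IsSubmodular f
  empty : f ∅ = 0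
  linear : IsLinearSetFun w
  card_le : ∀ X : Finset N, M.Indep (X : Set N) → X.card ≤ R
  mem_list : ∀ x, x ∈ l
  scale : OracleAlg.IsScale M (fun x => singleCoeff ℓ * f {x} + linearCoeff ℓ * w {x})
    (fun x => linearCoeff ℓ * w {x}) (fun x => f {x}) δ l part start v
  κ_nonneg : 0 ≤ κ
  b_nonneg : 0 ≤ b
  -- `b` is the weight set aside as slack: half of it pays for `η`-approximate optimality, the other
  -- half remains in `guarantee`.
  b_le : b ≤ searchCoeff ℓ (ℓ + 1)
  κ_le : linearCoeff ℓ * κ ≤ singleCoeff ℓ - b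
  η_pos : 0 < η
  η_le_one : η ≤ 1
  η_le : η ≤ ε / 2
  η_mul_le : η * ∑ J : Finset (Fin (ℓ + 1)), searchCoeff ℓ J.card ≤ b / 2
  δ_le : δ ≤ singleCoeff ℓ
  -- The two bounds on `l.length * δ` pay for restricting competitors to the selected part, in the
  -- guarantee and in local optimality respectively.
  length_mul_le : l.length * δ ≤ singleCoeff ℓ - linearCoeff ℓ * κ
  length_mul_le' : l.length * δ ≤ ε / 2 * singleCoeff ℓ

/-! ### Scale, guarantee and progress of the prepared search -/

namespace SearchSetting

variable {ℓ : ℕ} {f w : Finset N → ℝ} {M : Matroid N} {κ ε η b δ : ℝ} {R : ℕ}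
  {l part : List N} {start : Finset N} {v : ℝ}

local notation "g" => auxSubmodular (L := ℓ + 1) (searchCoeff ℓ) f
local notation "Φ" => auxFun (L := ℓ + 1) (searchCoeff ℓ) (linearCoeff ℓ) f w
local notation "U" => unionPart (N := N) (Finset.univ : Finset (Fin (ℓ + 1)))

theorem f_nonneg (h : SearchSetting ℓ f w M κ ε η b δ R l part start v) (S : Finset N) :
    0 ≤ f S := by
  rw [← h.empty]
  exact h.mono (Finset.empty_subset _)

theorem g_mono (h : SearchSetting ℓ f w M κ ε η b δ R l part start v) : Monotone g :=
  auxSubmodular_mono (searchCoeff_nonneg ℓ) h.mono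

theorem g_submodular (h : SearchSetting ℓ f w M κ ε η b δ R l part start v) : IsSubmodular g :=
  auxSubmodular_isSubmodular (searchCoeff_nonneg ℓ) h.mono h.submodular

theorem g_nonneg (h : SearchSetting ℓ f w M κ ε η b δ R l part start v)
    (A : Finset (N × Fin (ℓ + 1))) : 0 ≤ g A :=
  auxSubmodular_nonneg (searchCoeff_nonneg ℓ) h.f_nonneg A

theorem sum_marginal_ge (h : SearchSetting ℓ f w M κ ε η b δ R l part start v)
    (A T : Finset (N × Fin (ℓ + 1))) :
    ∑ p ∈ T, linearCoeff ℓ * w {p.1} ≤ ∑ p ∈ T, marginal Φ A p := by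
  refine Finset.sum_le_sum fun p _ => ?_
  rw [marginal_auxFun]
  linarith [marginal_nonneg h.g_mono A p]

theorem sum_marginal_self_le (h : SearchSetting ℓ f w M κ ε η b δ R l part start v)
    (A : Finset (N × Fin (ℓ + 1))) :
    ∑ p ∈ A, marginal Φ A p ≤ g A + ∑ p ∈ A, linearCoeff ℓ * w {p.1} := by
  have h1 := sum_marginal_le h.g_submodular (subset_refl A)
  rw [Finset.sdiff_self, auxSubmodular_empty h.empty, sub_zero] at h1
  simp only [marginal_auxFun, Finset.sum_add_distrib]
  linarith

/-- By submodularity marginal values never exceed singleton values; so the weights used in the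
preparation dominate marginal values at every solution. -/
theorem sum_marginal_le_weight (h : SearchSetting ℓ f w M κ ε η b δ R l part start v)
    (A : Finset (N × Fin (ℓ + 1))) {T : Finset (N × Fin (ℓ + 1))} (hT : IsSolution M T) :
    ∑ p ∈ T, marginal Φ A p ≤
      ∑ x ∈ U T, (singleCoeff ℓ * f {x} + linearCoeff ℓ * w {x}) := by
  rw [← hT.sum_eq fun x => singleCoeff ℓ * f {x} + linearCoeff ℓ * w {x}]
  refine Finset.sum_le_sum fun p _ => ?_
  rw [marginal_auxFun, ← auxSubmodular_singleton ℓ h.empty p]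
  have := h.g_submodular.insert_sub_le (Finset.empty_subset (A.erase p))
    (Finset.notMem_erase p A)
  rw [insert_empty_eq, auxSubmodular_empty h.empty, sub_zero] at this
  exact add_le_add this le_rfl

theorem sum_le_sum_start (h : SearchSetting ℓ f w M κ ε η b δ R l part start v)
    {S : Finset N} (hS : M.Indep (S : Set N)) (hp : ∀ x ∈ S, x ∈ part) :
    ∑ x ∈ S, (singleCoeff ℓ * f {x} + linearCoeff ℓ * w {x}) ≤
      ∑ x ∈ start, (singleCoeff ℓ * f {x} + linearCoeff ℓ * w {x}) :=
  h.scale.cert.sum_le hS hp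

theorem sum_start_le (h : SearchSetting ℓ f w M κ ε η b δ R l part start v) :
    ∑ x ∈ start, singleCoeff ℓ * f {x} ≤ singleCoeff ℓ * (R * v) := by
  rw [← Finset.mul_sum]
  refine mul_le_mul_of_nonneg_left ?_ (singleCoeff_pos ℓ).le
  calc ∑ x ∈ start, f {x} ≤ ∑ x ∈ start, v :=
        Finset.sum_le_sum fun x hx => h.scale.le_scale x (h.scale.cert.mem x hx)
    _ = start.card * v := by rw [Finset.sum_const, nsmul_eq_mul]
    _ ≤ R * v := mul_le_mul_of_nonneg_right
        (by exact_mod_cast h.card_le start h.scale.cert.indep) h.scale.scale_nonneg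

theorem f_le (h : SearchSetting ℓ f w M κ ε η b δ R l part start v)
    {S : Finset N} (hS : M.Indep (S : Set N)) (hp : ∀ x ∈ S, x ∈ part) : f S ≤ R * v := by
  calc f S ≤ ∑ x ∈ S, f {x} := le_sum_singleton h.submodular h.mono h.empty S
    _ ≤ ∑ x ∈ S, v := Finset.sum_le_sum fun x hx => h.scale.le_scale x (hp x hx)
    _ = S.card * v := by rw [Finset.sum_const, nsmul_eq_mul]
    _ ≤ R * v := mul_le_mul_of_nonneg_right
        (by exact_mod_cast h.card_le S hS) h.scale.scale_nonneg

/-- The pairs of the initial solution. -/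
theorem start_isSolution (h : SearchSetting ℓ f w M κ ε η b δ R l part start v) :
    IsSolution M (start ×ˢ {(0 : Fin (ℓ + 1))}) :=
  isSolution_product_singleton h.scale.cert.indep 0

theorem start_subset (h : SearchSetting ℓ f w M κ ε η b δ R l part start v) :
    start ×ˢ {(0 : Fin (ℓ + 1))} ⊆ pairsOf part (ℓ + 1) :=
  product_singleton_subset_pairsOf h.scale.cert.mem 0

/-- If the violation of local optimality is small, then the value is not too small. -/
theorem scale_le (h : SearchSetting ℓ f w M κ ε η b δ R l part start v)
    {A : Finset (N × Fin (ℓ + 1))} (hA : IsSolution M A) (hAG : A ⊆ pairsOf part (ℓ + 1)) {e : ℝ}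
    (he : OracleAlg.IsLocalOptIn (pairMatroid M (ℓ + 1)) Φ (pairsOf part (ℓ + 1)) A e) :
    δ * v ≤ e + (R + 1) * g A := by
  have hg0 := h.g_nonneg A
  have he0 : 0 ≤ e := by
    have := he A (isSolution_iff.1 hA) hAG
    linarith
  have h1 := he _ (isSolution_iff.1 h.start_isSolution) h.start_subset
  have h2 := h.sum_marginal_self_le A
  rw [hA.sum_eq fun x => linearCoeff ℓ * w {x}] at h2
  -- By monotonicity the marginal value of an element falls short of its weight by at most g(A), and
  -- there are at most `R` elements.
  have h3 : ∑ x ∈ start, (singleCoeff ℓ * f {x} + linearCoeff ℓ * w {x}) - R * g A ≤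
      ∑ p ∈ start ×ˢ {(0 : Fin (ℓ + 1))}, marginal Φ A p := by
    rw [sum_product_singleton']
    have h4 : (start.card : ℝ) * g A ≤ R * g A :=
      mul_le_mul_of_nonneg_right (by exact_mod_cast h.card_le _ h.scale.cert.indep) hg0
    have h5 : ∑ x ∈ start, (singleCoeff ℓ * f {x} + linearCoeff ℓ * w {x} - g A) ≤
        ∑ x ∈ start, marginal Φ A (x, 0) := by
      refine Finset.sum_le_sum fun x _ => ?_
      rw [marginal_auxFun, ← auxSubmodular_singleton ℓ h.empty (x, 0)]
      linarith [singleton_le_marginal_add h.g_mono A (x, (0 : Fin (ℓ + 1)))]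
    rw [Finset.sum_sub_distrib, Finset.sum_const, nsmul_eq_mul] at h5
    linarith
  have hpart := subset_pairsOf_iff.1 hAG
  have hRg : 0 ≤ (R : ℝ) * g A := by positivity
  -- Either an element of value at least `v` makes g(A) large by itself, or the weight of `start`
  -- exceeds the linear weight of `A` by `δ * v`; then `start` as competitor forces the violation or
  -- g(A) to be large.
  rcases h.scale.relevant _ hA.2 hpart with ⟨x, hx, hvx⟩ | h5
  · obtain ⟨i, -, hxi⟩ := mem_unionPart.1 hx
    have h6 : g {(x, i)} ≤ g A := h.g_mono (Finset.singleton_subset_iff.2 hxi)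
    rw [auxSubmodular_singleton ℓ h.empty] at h6
    have h7 : δ * v ≤ singleCoeff ℓ * f {x} :=
      mul_le_mul h.δ_le hvx h.scale.scale_nonneg (singleCoeff_pos ℓ).le
    simp only at h6
    linarith
  · linarith

/-- It suffices to compare with independent subsets of the selected part. -/
theorem exists_optimum_in_part (h : SearchSetting ℓ f w M κ ε η b δ R l part start v)
    {O : Finset N} (hO : M.Indep (O : Set N)) :
    ∃ O' : Finset N, M.Indep (O' : Set N) ∧ (∀ x ∈ O', x ∈ part) ∧
      linearCoeff ℓ * κ * f O + linearCoeff ℓ * w O ≤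
        linearCoeff ℓ * κ * f O' + linearCoeff ℓ * w O' := by
  have hcκ : 0 ≤ linearCoeff ℓ * κ := mul_nonneg (linearCoeff_pos ℓ).le h.κ_nonneg
  rcases h.scale.outside O hO fun x _ => h.mem_list x with hp | ⟨O', hO', hp, y, hy, hle⟩
  · exact ⟨O, hO, hp, le_rfl⟩
  · refine ⟨O', hO', hp, ?_⟩
    rw [Finset.sum_add_distrib, ← Finset.mul_sum, ← Finset.mul_sum, ← Finset.mul_sum,
      ← h.linear O, ← h.linear O'] at hle
    have h1 : f O ≤ ∑ x ∈ O, f {x} := le_sum_singleton h.submodular h.mono h.empty O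
    have h2 : f {y} ≤ ∑ x ∈ O, f {x} :=
      Finset.single_le_sum (f := fun x => f {x}) (fun x _ => h.f_nonneg {x}) hy
    have h3 := mul_le_mul_of_nonneg_left h1 hcκ
    have hb := h.κ_le
    -- The difference between the weights of `f` in the preparation and in the guarantee pays for
    -- the loss outside the part.
    have h4 := mul_le_mul_of_nonneg_left h2
      (by linarith [h.b_nonneg] : 0 ≤ singleCoeff ℓ - linearCoeff ℓ * κ)
    have h5 := mul_le_mul_of_nonneg_right h.length_mul_le (h.f_nonneg {y})
    have h6 := mul_nonneg hcκ (h.f_nonneg O')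
    linarith

/-- Approximate local optima satisfy the approximation guarantee, with some slack. -/
theorem guarantee (h : SearchSetting ℓ f w M κ ε η b δ R l part start v)
    {A : Finset (N × Fin (ℓ + 1))}
    (hA : IsSolution M A)
    (hopt : OracleAlg.IsLocalOptIn (pairMatroid M (ℓ + 1)) Φ (pairsOf part (ℓ + 1)) A (η * g A))
    {O : Finset N} (hO : M.Indep (O : Set N)) :
    linearCoeff ℓ * κ * f O + linearCoeff ℓ * w O + b / 2 * f (U A) ≤
      linearCoeff ℓ * f (U A) + linearCoeff ℓ * w (U A) := by
  obtain ⟨O', hO', hp, hle⟩ := h.exists_optimum_in_part hO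
  have h1 := local_optimum_bound ℓ h.mono h.submodular h.empty A O' h.b_nonneg h.b_le
  have h2 : ∀ i : Fin (ℓ + 1), ∑ p ∈ O' ×ˢ {i}, marginal g A p + linearCoeff ℓ * w O' -
      (∑ p ∈ A, marginal g A p + linearCoeff ℓ * w (U A)) ≤ η * g A := by
    intro i
    have := hopt _ (isSolution_iff.1 (isSolution_product_singleton hO' i))
      (product_singleton_subset_pairsOf hp i)
    simp only [marginal_auxFun, Finset.sum_add_distrib] at this
    have e1 : ∑ p ∈ O' ×ˢ {i}, linearCoeff ℓ * w {p.1} = linearCoeff ℓ * w O' := by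
      rw [sum_product_singleton' _ _ fun p : N × Fin (ℓ + 1) => linearCoeff ℓ * w {p.1},
        ← Finset.mul_sum, ← h.linear]
    have e2 : ∑ p ∈ A, linearCoeff ℓ * w {p.1} = linearCoeff ℓ * w (U A) := by
      rw [hA.sum_eq fun x => linearCoeff ℓ * w {x}, ← Finset.mul_sum, ← h.linear]
    rw [e1, e2] at this
    linarith
  have h3 := Finset.sum_le_sum fun i (_ : i ∈ (Finset.univ : Finset (Fin (ℓ + 1)))) => h2 i
  rw [Finset.sum_sub_distrib, Finset.sum_add_distrib, Finset.sum_const, Finset.sum_const,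
    Finset.sum_const, Finset.card_univ, Fintype.card_fin] at h3
  simp only [nsmul_eq_mul] at h3
  push_cast at h3
  -- The permitted violation is charged to half of the slack.
  have h4 : η * g A ≤ b / 2 * f (U A) := by
    have h5 := mul_le_mul_of_nonneg_left (auxSubmodular_le (searchCoeff_nonneg ℓ) h.mono A)
      h.η_pos.le
    have h6 := mul_le_mul_of_nonneg_right h.η_mul_le (h.f_nonneg (U A))
    linarith
  have h7 : ((ℓ : ℝ) + 1) * ((singleCoeff ℓ - b) * f O' + b * f (U A) - linearCoeff ℓ * f (U A) +
      linearCoeff ℓ * w O' - linearCoeff ℓ * w (U A)) ≤ ((ℓ : ℝ) + 1) * (η * g A) := by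
    linarith
  have h8 := le_of_mul_le_mul_left h7 (by positivity)
  have h9 := mul_le_mul_of_nonneg_right h.κ_le (h.f_nonneg O')
  linarith

/-- Approximate local optima for the selected part are approximate local optima. -/
theorem locally_optimal [Finite N] (h : SearchSetting ℓ f w M κ ε η b δ R l part start v)
    {A : Finset (N × Fin (ℓ + 1))} (hA : IsSolution M A)
    (hopt : OracleAlg.IsLocalOptIn (pairMatroid M (ℓ + 1)) Φ (pairsOf part (ℓ + 1)) A (η * g A)) :
    ∃ B : Finset (N × Fin (ℓ + 1)), IsSolution M B ∧ ∀ T : Finset (N × Fin (ℓ + 1)),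
      IsSolution M T →
      ∑ p ∈ T, marginal Φ A p - ∑ p ∈ A, marginal Φ A p ≤ ε * g B := by
  -- `B` maximizes g over all solutions, not only over those in the selected part. This lets it also
  -- absorb the loss for competitors outside.
  obtain ⟨B, hB, hmax⟩ := Set.exists_max_image {B | IsSolution M B} g
    (Set.toFinite _) ⟨A, hA⟩
  refine ⟨B, hB, fun T hT => ?_⟩
  have hAB := hmax A hA
  have hB0 := h.g_nonneg B
  have hη : η * g A ≤ ε / 2 * g B := by
    have h1 := mul_le_mul_of_nonneg_left hAB h.η_pos.le
    have h2 := mul_le_mul_of_nonneg_right h.η_le hB0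
    linarith
  by_cases hTG : T ⊆ pairsOf part (ℓ + 1)
  · have h1 := hopt T (isSolution_iff.1 hT) hTG
    have h2 : 0 ≤ ε / 2 * g B := mul_nonneg (h.η_pos.le.trans h.η_le) hB0
    linarith
  · rcases h.scale.outside _ hT.2 fun x _ => h.mem_list x with hp | ⟨O, hO, hp, y, hy, hle⟩
    · exact absurd (subset_pairsOf_iff.2 hp) hTG
    · have h1 := h.sum_marginal_le_weight A hT
      have h2 := hopt _ (isSolution_iff.1 (isSolution_product_singleton hO 0))
        (product_singleton_subset_pairsOf hp 0)
      have h3 := h.sum_marginal_ge A (O ×ˢ {(0 : Fin (ℓ + 1))})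
      rw [sum_product_singleton' _ _ fun p : N × Fin (ℓ + 1) => linearCoeff ℓ * w {p.1}] at h3
      have h4 : singleCoeff ℓ * f {y} ≤ g B := by
        have hyT : M.Indep (({y} : Finset N) : Set N) :=
          hT.2.subset (by simpa using hy)
        have := hmax _ (isSolution_product_singleton (L := ℓ + 1) hyT 0)
        rwa [auxSubmodular_product_singleton ℓ h.empty] at this
      have h5 := mul_le_mul_of_nonneg_right h.length_mul_le' (h.f_nonneg {y})
      have h6 := mul_le_mul_of_nonneg_left h4 (h.η_pos.le.trans h.η_le)
      linarith

/-- The weight of the initial solution bounds the guiding function. -/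
theorem auxFun_le (h : SearchSetting ℓ f w M κ ε η b δ R l part start v)
    {T : Finset (N × Fin (ℓ + 1))} (hT : IsSolution M T) (hTG : T ⊆ pairsOf part (ℓ + 1)) :
    Φ T ≤ ∑ x ∈ start, (singleCoeff ℓ * f {x} + linearCoeff ℓ * w {x}) := by
  refine le_trans ?_ (h.sum_le_sum_start hT.2 (subset_pairsOf_iff.1 hTG))
  rw [← hT.sum_eq fun x => singleCoeff ℓ * f {x} + linearCoeff ℓ * w {x}, auxFun_eq,
    Finset.sum_add_distrib]
  have := le_sum_singleton h.g_submodular h.g_mono (auxSubmodular_empty h.empty) T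
  simp only [auxSubmodular_singleton ℓ h.empty] at this
  linarith

/-- By `auxFun_le` the weight of `start` bounds Φ from above, so this limits the initial gap. -/
theorem start_value (h : SearchSetting ℓ f w M κ ε η b δ R l part start v) :
    ∑ x ∈ start, (singleCoeff ℓ * f {x} + linearCoeff ℓ * w {x}) - singleCoeff ℓ * (R * v) ≤
      Φ (start ×ˢ {(0 : Fin (ℓ + 1))}) := by
  have h1 := h.sum_start_le
  have h2 := h.g_nonneg (start ×ˢ {(0 : Fin (ℓ + 1))})
  rw [auxFun_eq, sum_product_singleton' _ _ fun p : N × Fin (ℓ + 1) => linearCoeff ℓ * w {p.1},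
    Finset.sum_add_distrib]
  linarith

/-- A weak guarantee for all solutions that are at least as good as the initial one. -/
theorem weak_guarantee (h : SearchSetting ℓ f w M κ ε η b δ R l part start v)
    {A : Finset (N × Fin (ℓ + 1))} (hA : IsSolution M A) (hAG : A ⊆ pairsOf part (ℓ + 1))
    (hstart : Φ (start ×ˢ {(0 : Fin (ℓ + 1))}) ≤ Φ A) {O : Finset N} (hO : M.Indep (O : Set N)) :
    linearCoeff ℓ * κ * f O + linearCoeff ℓ * w O ≤
      linearCoeff ℓ * f (U A) + linearCoeff ℓ * w (U A) +
        (singleCoeff ℓ + ∑ J : Finset (Fin (ℓ + 1)), searchCoeff ℓ J.card) * (R * v) := by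
  obtain ⟨O', hO', hp, hle⟩ := h.exists_optimum_in_part hO
  have h1 := h.start_value
  have h2 := h.sum_le_sum_start hO' hp
  rw [Finset.sum_add_distrib, ← Finset.mul_sum, ← Finset.mul_sum, ← h.linear] at h2
  have h3 : f O' ≤ ∑ x ∈ O', f {x} := le_sum_singleton h.submodular h.mono h.empty O'
  have hcκ : 0 ≤ linearCoeff ℓ * κ := mul_nonneg (linearCoeff_pos ℓ).le h.κ_nonneg
  have h4 := mul_le_mul_of_nonneg_left h3 hcκ
  have h5 : linearCoeff ℓ * κ * ∑ x ∈ O', f {x} ≤ singleCoeff ℓ * ∑ x ∈ O', f {x} :=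
    mul_le_mul_of_nonneg_right (by linarith [h.κ_le, h.b_nonneg])
      (Finset.sum_nonneg fun x _ => h.f_nonneg _)
  have h6 : g A ≤ (∑ J : Finset (Fin (ℓ + 1)), searchCoeff ℓ J.card) * (R * v) :=
    (auxSubmodular_le (searchCoeff_nonneg ℓ) h.mono A).trans
      (mul_le_mul_of_nonneg_left (h.f_le hA.2 (subset_pairsOf_iff.1 hAG))
        (Finset.sum_nonneg fun J _ => searchCoeff_nonneg ℓ _))
  rw [auxFun_eq (A := A), hA.sum_eq fun x => linearCoeff ℓ * w {x}, ← Finset.mul_sum,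
    ← h.linear] at hstart
  have h7 := mul_nonneg (linearCoeff_pos ℓ).le (h.f_nonneg (U A))
  linarith

/-- If all values vanish, then the solutions that are at least as good as the initial one are
local optima. -/
theorem isLocalOptIn_of_scale_eq_zero
    (h : SearchSetting ℓ f w M κ ε η b δ R l part start v) (hv : v = 0)
    {A : Finset (N × Fin (ℓ + 1))} (hA : IsSolution M A) (hAG : A ⊆ pairsOf part (ℓ + 1))
    (hstart : Φ (start ×ˢ {(0 : Fin (ℓ + 1))}) ≤ Φ A) :
    OracleAlg.IsLocalOptIn (pairMatroid M (ℓ + 1)) Φ (pairsOf part (ℓ + 1)) A (η * g A) := by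
  intro T hT hTG
  have hT' := isSolution_iff.2 hT
  have h1 := h.sum_marginal_le_weight A hT'
  have h2 := h.sum_le_sum_start hT'.2 (subset_pairsOf_iff.1 hTG)
  have h3 := h.sum_marginal_ge A A
  have h4 := h.start_value
  have h5 := mul_nonneg h.η_pos.le (h.g_nonneg A)
  -- All f-values in the part vanish, so Φ is linear there and the initial set is already optimal.
  -- This case is separate because the logarithmic potential needs `v > 0`.
  have h6 : g A ≤ 0 := by
    have := auxSubmodular_le (searchCoeff_nonneg ℓ) h.mono A
    have h7 := h.f_le hA.2 (subset_pairsOf_iff.1 hAG)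
    rw [hv, mul_zero] at h7
    have h8 : 0 ≤ ∑ J : Finset (Fin (ℓ + 1)), searchCoeff ℓ J.card :=
      Finset.sum_nonneg fun J _ => searchCoeff_nonneg ℓ _
    exact this.trans (mul_nonpos_of_nonneg_of_nonpos h8 h7)
  rw [hv, mul_zero, mul_zero] at h4
  rw [auxFun_eq (A := A)] at hstart
  linarith

/-- A solution that is not approximately locally optimal admits an exchange with a gain that is
comparable to the distance from the optimum. -/
theorem exists_large_gain [Finite N] (h : SearchSetting ℓ f w M κ ε η b δ R l part start v)
    {A B : Finset (N × Fin (ℓ + 1))} (hA : IsSolution M A) (hAG : A ⊆ pairsOf part (ℓ + 1))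
    (hB : IsSolution M B) (hBG : B ⊆ pairsOf part (ℓ + 1))
    (hbad : ¬ OracleAlg.IsLocalOptIn (pairMatroid M (ℓ + 1)) Φ (pairsOf part (ℓ + 1)) A
      (η * g A)) :
    ∃ T ⊆ pairsOf part (ℓ + 1), (pairMatroid M (ℓ + 1)).Indep (T : Set (N × Fin (ℓ + 1))) ∧
      η / 3 * (Φ B - Φ A + η * (δ * v) / (R + 2)) ≤
        ∑ p ∈ T, marginal Φ A p - ∑ p ∈ A, marginal Φ A p := by
  obtain ⟨T, ⟨hT, hTG⟩, hmax⟩ := Set.exists_max_image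
    {T : Finset (N × Fin (ℓ + 1)) | (pairMatroid M (ℓ + 1)).Indep (T : Set (N × Fin (ℓ + 1))) ∧
      T ⊆ pairsOf part (ℓ + 1)}
    (fun T : Finset (N × Fin (ℓ + 1)) => ∑ p ∈ T, marginal Φ A p - ∑ p ∈ A, marginal Φ A p)
    (Set.toFinite _) ⟨A, isSolution_iff.1 hA, hAG⟩
  refine ⟨T, hTG, hT, ?_⟩
  set E := ∑ p ∈ T, marginal Φ A p - ∑ p ∈ A, marginal Φ A p with hE
  have hopt : OracleAlg.IsLocalOptIn (pairMatroid M (ℓ + 1)) Φ (pairsOf part (ℓ + 1)) A E :=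
    fun T' hT' hTG' => hmax T' ⟨hT', hTG'⟩
  have hEg : η * g A < E := by
    by_contra hle
    exact hbad fun T' hT' hTG' => (hopt T' hT' hTG').trans (not_lt.1 hle)
  have h1 := h.scale_le hA hAG hopt
  have hη := h.η_pos
  have hg0 := h.g_nonneg A
  have hE0 : 0 < E := lt_of_le_of_lt (mul_nonneg hη.le hg0) hEg
  -- In `scale_le`, multiplied by `η`, each `η * g A` is below `E` since `A` is bad. This leaves `(R
  -- + 2) * E` on the right.
  have hd : η * (δ * v) / (R + 2) ≤ E := by
    rw [div_le_iff₀ (by positivity)]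
    have h2 := mul_le_mul_of_nonneg_left h1 hη.le
    have h3 : ((R : ℝ) + 1) * (η * g A) ≤ ((R : ℝ) + 1) * E :=
      mul_le_mul_of_nonneg_left hEg.le (by positivity)
    have h4 : η * E ≤ 1 * E := mul_le_mul_of_nonneg_right h.η_le_one hE0.le
    linarith
  -- The marginal values of `B` bound the gain from adding it to `A`; those of `A` add up to at most
  -- its linear weight plus g(A).
  have hD : Φ B - Φ A ≤ E + g A := by
    have h2 := hopt B (isSolution_iff.1 hB) hBG
    have h3 := h.sum_marginal_self_le A
    have h4 := union_sub_le_sum_marginal h.g_submodular h.g_mono A B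
    have h5 : g B ≤ g (A ∪ B) := h.g_mono Finset.subset_union_right
    simp only [marginal_auxFun, Finset.sum_add_distrib] at h2 h3
    rw [auxFun_eq, auxFun_eq]
    linarith
  have h6 : η * (Φ B - Φ A + η * (δ * v) / (R + 2)) ≤ 3 * E := by
    have h7 : η * (Φ B - Φ A + η * (δ * v) / (R + 2)) ≤ η * (E + g A + E) :=
      mul_le_mul_of_nonneg_left (add_le_add hD hd) hη.le
    have h8 : η * E ≤ 1 * E := mul_le_mul_of_nonneg_right h.η_le_one hE0.le
    linarith
  linarith

/-- A logarithmic potential for the search. -/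
theorem exists_potential [Finite N] (h : SearchSetting ℓ f w M κ ε η b δ R l part start v)
    (hδ : 0 < δ) (hv : v ≠ 0) :
    ∃ (ψ ρ : Finset (N × Fin (ℓ + 1)) → ℝ) (lo : ℝ),
      (∀ A, IsSolution M A → A ⊆ pairsOf part (ℓ + 1) → lo ≤ ψ A ∧ 0 ≤ ρ A) ∧
      (∀ A A', IsSolution M A → A ⊆ pairsOf part (ℓ + 1) → IsSolution M A' →
        A' ⊆ pairsOf part (ℓ + 1) → ψ A' ≤ ψ A - ρ A * (Φ A' - Φ A)) ∧
      (∀ A, IsSolution M A → A ⊆ pairsOf part (ℓ + 1) →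
        ¬ OracleAlg.IsLocalOptIn (pairMatroid M (ℓ + 1)) Φ (pairsOf part (ℓ + 1)) A (η * g A) →
        ∃ T ⊆ pairsOf part (ℓ + 1), (pairMatroid M (ℓ + 1)).Indep (T : Set (N × Fin (ℓ + 1))) ∧
          η / 3 ≤ ρ A * (∑ p ∈ T, marginal Φ A p - ∑ p ∈ A, marginal Φ A p)) ∧
      ψ (start ×ˢ {(0 : Fin (ℓ + 1))}) - lo ≤
        Real.log (1 + singleCoeff ℓ * (R * (R + 2)) / (η * δ)) := by
  obtain ⟨B, ⟨hB, hBG⟩, hmax⟩ := Set.exists_max_image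
    {T : Finset (N × Fin (ℓ + 1)) | IsSolution M T ∧ T ⊆ pairsOf part (ℓ + 1)} Φ
    (Set.toFinite _) ⟨_, h.start_isSolution, h.start_subset⟩
  have hv0 : 0 < v := lt_of_le_of_ne h.scale.scale_nonneg (Ne.symm hv)
  have hη := h.η_pos
  set d := η * (δ * v) / (R + 2) with hd
  have hd0 : 0 < d := by positivity
  have hpos : ∀ A, IsSolution M A → A ⊆ pairsOf part (ℓ + 1) → d ≤ Φ B - Φ A + d := by
    intro A hA hAG
    linarith [hmax A ⟨hA, hAG⟩]
  -- The logarithm of the gap, shifted by `d` to stay bounded below. Its tangent has slope `ρ`, so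
  -- the decrease is bounded linearly in the gain of Φ, and expectations can be taken.
  refine ⟨fun A => Real.log (Φ B - Φ A + d), fun A => 1 / (Φ B - Φ A + d), Real.log d,
    ?_, ?_, ?_, ?_⟩
  · intro A hA hAG
    have h1 := hpos A hA hAG
    exact ⟨Real.log_le_log hd0 h1, by have := hd0.trans_le h1; positivity⟩
  · intro A A' hA hAG hA' hAG'
    have h1 := hd0.trans_le (hpos A hA hAG)
    have h2 := hd0.trans_le (hpos A' hA' hAG')
    have h3 := Real.log_le_sub_one_of_pos (div_pos h2 h1)
    rw [Real.log_div h2.ne' h1.ne'] at h3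
    have h4 : (Φ B - Φ A' + d) / (Φ B - Φ A + d) - 1 =
        -(1 / (Φ B - Φ A + d) * (Φ A' - Φ A)) := by
      field_simp
      ring
    linarith
  · intro A hA hAG hbad
    obtain ⟨T, hTG, hT, hle⟩ := h.exists_large_gain hA hAG hB hBG hbad
    refine ⟨T, hTG, hT, ?_⟩
    have h1 := hd0.trans_le (hpos A hA hAG)
    beta_reduce
    rw [one_div, ← div_eq_inv_mul, le_div_iff₀ h1]
    exact hle
  · have h1 := hd0.trans_le (hpos _ h.start_isSolution h.start_subset)
    rw [← Real.log_div h1.ne' hd0.ne']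
    refine Real.log_le_log (div_pos h1 hd0) ?_
    have h2 := h.start_value
    have h3 := h.auxFun_le hB hBG
    have h4 : (1 + singleCoeff ℓ * (R * (R + 2)) / (η * δ)) * d = d + singleCoeff ℓ * (R * v) := by
      rw [hd]
      field_simp
    rw [div_le_iff₀ hd0, h4]
    linarith

/-- The slack in the guarantee for approximate local optima. -/
theorem guarantee_of_scale (h : SearchSetting ℓ f w M κ ε η b δ R l part start v)
    {A : Finset (N × Fin (ℓ + 1))} (hA : IsSolution M A) (hAG : A ⊆ pairsOf part (ℓ + 1))
    (hopt : OracleAlg.IsLocalOptIn (pairMatroid M (ℓ + 1)) Φ (pairsOf part (ℓ + 1)) A (η * g A))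
    {O : Finset N} (hO : M.Indep (O : Set N)) :
    linearCoeff ℓ * κ * f O + linearCoeff ℓ * w O +
        b * (δ * v) / (2 * (R + 2) * ∑ J : Finset (Fin (ℓ + 1)), searchCoeff ℓ J.card) ≤
      linearCoeff ℓ * f (U A) + linearCoeff ℓ * w (U A) := by
  refine le_trans (add_le_add le_rfl ?_) (h.guarantee hA hopt hO)
  have h1 := h.scale_le hA hAG hopt
  have h2 := auxSubmodular_le (searchCoeff_nonneg ℓ) h.mono A
  have h3 := mul_le_mul_of_nonneg_right h.η_le_one (h.g_nonneg A)
  have hS := sum_searchCoeff_pos ℓ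
  rw [div_le_iff₀ (by positivity)]
  -- At an approximate local optimum the scale is a lower bound for f(S), so the slack `b / 2 * f (U
  -- A)` is a definite amount.
  have h4 : δ * v ≤ (R + 2) * ((∑ J : Finset (Fin (ℓ + 1)), searchCoeff ℓ J.card) * f (U A)) :=
    le_trans (by linarith) (mul_le_mul_of_nonneg_left h2 (by positivity : (0 : ℝ) ≤ R + 2))
  have h5 := mul_le_mul_of_nonneg_left h4 h.b_nonneg
  linarith

end SearchSetting

end analysis

/-! ### The oracles of the local search -/

namespace OracleAlg

section oracles

variable {N : Type u} [DecidableEq N] {L : ℕ} {f w : Finset N → ℝ} {M : Matroid N}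

/-- Evaluate `auxSubmodular α f`. -/
noncomputable def auxValue (α : ℕ → ℝ) (X : Finset (N × Fin L)) : OracleAlg N ℝ :=
  (tabulate (fun J => queryValue (unionPart J X) output) Finset.univ.toList).bind fun t =>
    output (∑ J : Finset (Fin L), α J.card * t J)

theorem computes_auxValue (α : ℕ → ℝ) (X : Finset (N × Fin L)) :
    Computes f w M (auxValue α X) (auxSubmodular α f X) (2 ^ L) := by
  have h := computes_tabulate_univ (f := f) (w := w) (M := M)
    (F := fun J : Finset (Fin L) => queryValue (unionPart J X) output)
    (val := fun J => f (unionPart J X)) (k := 1) fun J => computes_queryValue _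
  refine (h.bind (F := fun t => output (∑ J : Finset (Fin L), α J.card * t J))
    (computes_output _ 0)).mono ?_
  simp

/-- Evaluate `auxFun α c f w` when the values of `w` at the elements are known. -/
noncomputable def guideValue (α : ℕ → ℝ) (c : ℝ) (ω : N → ℝ) (X : Finset (N × Fin L)) :
    OracleAlg N ℝ :=
  (auxValue α X).bind fun y => output (y + ∑ p ∈ X, c * ω p.1)

/-- The linear values come from the table made in the preparation; only `f` is queried, once per
index set. -/
theorem computes_guideValue (α : ℕ → ℝ) (c : ℝ) (X : Finset (N × Fin L)) :
    Computes f w M (guideValue α c (fun x => w {x}) X) (auxFun α c f w X) (2 ^ L) := by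
  rw [auxFun_eq]
  exact (computes_auxValue α X).bind (F := fun y => output (y + ∑ p ∈ X, c * w {p.1}))
    (computes_output _ 0)

open Classical in
/-- Test whether a set of pairs is a solution. -/
noncomputable def solutionTest (X : Finset (N × Fin L)) : OracleAlg N Bool :=
  if Set.InjOn Prod.fst (X : Set (N × Fin L)) then
    queryIndep (unionPart Finset.univ X) output
  else output false

open Classical in
theorem computes_solutionTest (X : Finset (N × Fin L)) :
    Computes f w M (solutionTest X)
      (decide ((pairMatroid M L).Indep (X : Set (N × Fin L)))) 1 := by
  rw [solutionTest]
  split_ifs with h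
  · have : (pairMatroid M L).Indep (X : Set (N × Fin L)) ↔
        M.Indep (unionPart Finset.univ X : Set N) := isSolution_iff.symm.trans (and_iff_right h)
    rw [decide_eq_decide.2 this]
    exact computes_queryIndep _
  · rw [decide_eq_false fun hX => h (isSolution_iff.2 hX).1]
    exact computes_output _ _

end oracles

/-! ### The preparation of the search -/

section preparation

variable {N : Type u} [Fintype N] [DecidableEq N] {f w : Finset N → ℝ} {M : Matroid N}

/-- The results of the preparation: the values of the linear function at the elements, the rank,
the selected part of the elements, and the initial set. -/
structure Preparation (N : Type u) where
  weight : N → ℝ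
  rank : ℕ
  part : List N
  start : Finset N

/-- The preparation of the search. -/
noncomputable def prepare (ℓ t : ℕ) (δ : ℝ) : OracleAlg N (Preparation N) :=
  (tabulate (fun x => queryLinear {x} output) Finset.univ.toList).bind fun ω =>
    (tabulate (fun x => queryValue {x} output) Finset.univ.toList).bind fun s =>
      -- With unit weights a set of maximal weight is a basis, whose cardinality is the rank.
      (maxWeight (fun X => queryIndep X output) t (fun _ => 1) Finset.univ.toList).bind fun I =>
        (scan (fun X => queryIndep X output) t
          (fun x => singleCoeff ℓ * s x + linearCoeff ℓ * ω x) (fun x => linearCoeff ℓ * ω x) s δ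
          -- The list is decreasing because `scan` treats the tail before the head.
          (Finset.univ.toList.mergeSort fun x y => decide (s y ≤ s x))).bind fun st =>
            output ⟨ω, I.card, st.part, st.start⟩

theorem exists_computes_prepare (hE : M.E = Set.univ) (hm : Monotone f) (h0 : f ∅ = 0)
    (ℓ : ℕ) {t : ℕ} (ht : Fintype.card N + 1 ≤ 2 ^ t) {δ : ℝ} (hδ : 0 ≤ δ) :
    ∃ (P : Preparation N) (l : List N) (v : ℝ),
      Computes f w M (prepare ℓ t δ) P (5 * (Fintype.card N * (t + 1))) ∧
      P.weight = (fun x => w {x}) ∧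
      (∀ X : Finset N, M.Indep (X : Set N) → X.card ≤ P.rank) ∧ P.rank ≤ M.eRank.toNat ∧
      l.length = Fintype.card N ∧ (∀ x, x ∈ l) ∧
      IsScale M (fun x => singleCoeff ℓ * f {x} + linearCoeff ℓ * w {x})
        (fun x => linearCoeff ℓ * w {x}) (fun x => f {x}) δ l P.part P.start v := by
  classical
  have hf : ∀ S, 0 ≤ f S := fun S => h0 ▸ hm (Finset.empty_subset S)
  have h1 := computes_tabulate_univ (f := f) (w := w) (M := M)
    (F := fun x : N => queryLinear {x} output) (val := fun x => w {x}) (k := 1)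
    fun J => computes_queryLinear _
  have h2 := computes_tabulate_univ (f := f) (w := w) (M := M)
    (F := fun x : N => queryValue {x} output) (val := fun x => f {x}) (k := 1)
    fun J => computes_queryValue _
  obtain ⟨I, h3, hI⟩ := exists_computes_maxWeight (f := f) (w := w) (M := M) hE
    (ind := fun X => queryIndep X output) (fun X => computes_queryIndep X)
    (fun _ => 1) ht Finset.univ.toList
  have hsort : (Finset.univ.toList.mergeSort fun x y : N => decide (f {y} ≤ f {x})).Pairwise
      fun x y => f {y} ≤ f {x} := by
    have := List.pairwise_mergeSort (le := fun x y : N => decide (f {y} ≤ f {x}))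
      (fun a b c hab hbc => by
        simp only [decide_eq_true_eq] at *
        exact hbc.trans hab)
      (fun a b => by
        simp only [Bool.or_eq_true, decide_eq_true_eq]
        exact le_total _ _) Finset.univ.toList
    simpa using this
  obtain ⟨st, h4, -, -, hst⟩ := exists_computes_scan (f := f) (w := w) (M := M) hE
    (ind := fun X => queryIndep X output) (fun X => computes_queryIndep X) ht
    (ω := fun x => singleCoeff ℓ * f {x} + linearCoeff ℓ * w {x})
    (ω₀ := fun x => linearCoeff ℓ * w {x}) (fun x => hf {x})
    (fun x => by linarith [mul_nonneg (singleCoeff_pos ℓ).le (hf {x})]) hδ hsort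
  refine ⟨⟨fun x => w {x}, I.card, st.part, st.start⟩, _, st.scale, ?_, rfl, ?_, ?_, ?_, ?_, hst⟩
  · rw [Finset.length_toList, Finset.card_univ] at h3
    rw [List.length_mergeSort, Finset.length_toList, Finset.card_univ] at h4
    refine Computes.mono (h1.bind (k' := Fintype.card N * 1 + (Fintype.card N * (t + 1) +
      (Fintype.card N * (2 * (t + 1)) + 0))) ?_) ?_
    · exact h2.bind (h3.bind (h4.bind (computes_output _ 0)))
    · nlinarith
  · intro X hX
    have := hI.sum_le hX fun x _ => by simp
    simpa using this
  · exact hI.indep.card_le_eRank_toNat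
  · rw [List.length_mergeSort, Finset.length_toList, Finset.card_univ]
  · intro x
    simp [List.mem_mergeSort]

end preparation

end OracleAlg

/-! ### Runs of the search -/

namespace SearchRun

variable {N : Type u} [DecidableEq N] {L : ℕ} {M : Matroid N} {Φ : Finset (N × Fin L) → ℝ}

/-- Append a solution to a run, unless it is the last one already. -/
def extend (run : SearchRun N L) (A : Finset (N × Fin L)) : SearchRun N L :=
  -- An unchanged solution is not recorded, so that recorded steps increase Φ strictly.
  if A = run.final then run else ⟨run.start, run.steps ++ [A]⟩

theorem final_extend (run : SearchRun N L) (A : Finset (N × Fin L)) :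
    (run.extend A).final = A := by
  rw [extend]
  split_ifs with h
  · exact h.symm
  · simp [final, List.getLastD_eq_getLast?]

omit [DecidableEq N] in
theorem final_mem (run : SearchRun N L) : run.final ∈ run.start :: run.steps := by
  rw [final]
  rcases List.eq_nil_or_concat run.steps with h | ⟨l, a, h⟩ <;> simp [h]

theorem IsImproving.isSolution_final {run : SearchRun N L} (h : run.IsImproving M Φ) :
    IsSolution M run.final := h.1 _ run.final_mem

theorem IsImproving.extend {run : SearchRun N L} (h : run.IsImproving M Φ)
    {A : Finset (N × Fin L)} (hA : IsSolution M A)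
    (hstep : A = run.final ∨ IsLocalStep run.final A ∧ Φ run.final < Φ A) :
    (run.extend A).IsImproving M Φ := by
  rw [SearchRun.extend]
  split_ifs with hAf
  · exact h
  · have hstep := hstep.resolve_left hAf
    constructor
    · intro B hB
      simp only [List.mem_cons, List.mem_append, List.not_mem_nil, or_false] at hB
      rcases hB with hB | hB | hB
      · exact h.1 B (hB ▸ List.mem_cons_self)
      · exact h.1 B (List.mem_cons_of_mem _ hB)
      · exact hB ▸ hA
    · rw [← List.cons_append, List.isChain_append]
      refine ⟨h.2, List.isChain_singleton _, ?_⟩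
      intro x hx y hy
      rw [List.getLast?_cons, ← List.getLastD_eq_getLast?] at hx
      obtain rfl : run.final = x := by simpa [final] using hx
      obtain rfl : A = y := by simpa using hy
      exact hstep

end SearchRun

namespace OracleAlg

section runs

variable {N : Type u} [Fintype N] [DecidableEq N]

/-- The initial run. -/
def Preparation.initial (P : Preparation N) (ℓ : ℕ) : SearchRun N (ℓ + 1) :=
  ⟨P.start ×ˢ {(0 : Fin (ℓ + 1))}, []⟩

/-- Test the last solution for approximate local optimality. -/
noncomputable def testRun (ℓ t : ℕ) (η : ℝ) (P : Preparation N) (run : SearchRun N (ℓ + 1)) :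
    OracleAlg N Bool :=
  testOpt solutionTest (guideValue (searchCoeff ℓ) (linearCoeff ℓ) P.weight)
    (auxValue (searchCoeff ℓ)) t η (pairsOf P.part (ℓ + 1)) run.final

/-- Continue a run with the best local step. -/
noncomputable def fullStep (ℓ t : ℕ) (P : Preparation N) (run : SearchRun N (ℓ + 1)) :
    OracleAlg N (SearchRun N (ℓ + 1)) :=
  (fullImprove solutionTest (guideValue (searchCoeff ℓ) (linearCoeff ℓ) P.weight) t (P.rank + 1)
    (pairsOf P.part (ℓ + 1)) run.final).bind fun A => output (run.extend A)

/-- Continue a run with the best of some random local steps. -/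
noncomputable def randomStep (ℓ t s m : ℕ) (P : Preparation N) (run : SearchRun N (ℓ + 1)) :
    OracleAlg N (SearchRun N (ℓ + 1)) :=
  (randomImprove solutionTest (guideValue (searchCoeff ℓ) (linearCoeff ℓ) P.weight) t (P.rank + 1)
    s m (pairsOf P.part (ℓ + 1)) run.final).bind fun A => output (run.extend A)

/-- The deterministic search. -/
noncomputable def fullSearch (ℓ t : ℕ) (η : ℝ) (K : ℕ) (P : Preparation N) :
    OracleAlg N (SearchRun N (ℓ + 1)) :=
  attempt (testRun ℓ t η P) (fullStep ℓ t P) K (P.initial ℓ)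

/-- The randomized search. -/
noncomputable def randomSearch (ℓ t : ℕ) (η : ℝ) (s m K : ℕ) [NeZero K] (tries : ℕ)
    (P : Preparation N) : OracleAlg N (SearchRun N (ℓ + 1)) :=
  attempt (testRun ℓ t η P) (randomIterate (randomStep ℓ t s m P) K) tries (P.initial ℓ)

variable {ℓ : ℕ} {f w : Finset N → ℝ} {M : Matroid N}

/-- The properties that are preserved by the search. -/
structure IsSearchState (ℓ : ℕ) (f w : Finset N → ℝ) (M : Matroid N) (P : Preparation N)
    (run : SearchRun N (ℓ + 1)) : Prop where
  improving : run.IsImproving M (auxFun (searchCoeff ℓ) (linearCoeff ℓ) f w)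
  subset : run.final ⊆ pairsOf P.part (ℓ + 1)
  start_le : auxFun (searchCoeff ℓ) (linearCoeff ℓ) f w (P.start ×ˢ {(0 : Fin (ℓ + 1))}) ≤
    auxFun (searchCoeff ℓ) (linearCoeff ℓ) f w run.final

omit [Fintype N] in
theorem IsSearchState.extend {P : Preparation N} {run : SearchRun N (ℓ + 1)}
    (h : IsSearchState ℓ f w M P run) {A : Finset (N × Fin (ℓ + 1))}
    (hA : IsImprovement (pairMatroid M (ℓ + 1)) (auxFun (searchCoeff ℓ) (linearCoeff ℓ) f w)
      (pairsOf P.part (ℓ + 1)) run.final A) : IsSearchState ℓ f w M P (run.extend A) := by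
  refine ⟨h.improving.extend (isSolution_iff.2 hA.indep) hA.step, ?_, ?_⟩ <;>
    rw [SearchRun.final_extend]
  · exact hA.subset
  · exact h.start_le.trans hA.le

/-- The last solution of the run is approximately locally optimal. -/
def IsGoodRun (ℓ : ℕ) (f w : Finset N → ℝ) (M : Matroid N) (η : ℝ) (P : Preparation N)
    (run : SearchRun N (ℓ + 1)) : Prop :=
  IsLocalOptIn (pairMatroid M (ℓ + 1)) (auxFun (searchCoeff ℓ) (linearCoeff ℓ) f w)
    (pairsOf P.part (ℓ + 1)) run.final (η * auxSubmodular (searchCoeff ℓ) f run.final)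

variable {κ ε η b δ v : ℝ} {l : List N} {P : Preparation N} {t : ℕ}

open Classical in
theorem computes_testRun (hE : M.E = Set.univ) (hP : P.weight = fun x => w {x})
    (ht : Fintype.card N * (ℓ + 1) + 1 ≤ 2 ^ t) {run : SearchRun N (ℓ + 1)}
    (hrun : IsSearchState ℓ f w M P run) :
    Computes f w M (testRun ℓ t η P run) (decide (IsGoodRun ℓ f w M η P run))
      (Fintype.card N * (ℓ + 1) * (2 * 2 ^ (ℓ + 1) + t + 1) + 2 ^ (ℓ + 1)) := by
  have h := computes_testOpt (f := f) (w := w) (M := M) (pairMatroid_ground (L := ℓ + 1) hE)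
    (fun X => computes_solutionTest X)
    (computes_guideValue (f := f) (w := w) (M := M) (L := ℓ + 1) (searchCoeff ℓ) (linearCoeff ℓ))
    (computes_auxValue (f := f) (w := w) (M := M) (L := ℓ + 1) (searchCoeff ℓ)) (t := t)
    (by simpa using ht) η hrun.subset
  rw [testRun, hP]
  refine h.mono (Nat.add_le_add_right (Nat.mul_le_mul_right _ ?_) _)
  exact (Finset.card_le_univ _).trans (by simp)

theorem exists_computes_fullStep (hE : M.E = Set.univ) (hP : P.weight = fun x => w {x})
    (h : SearchSetting ℓ f w M κ ε η b δ (P.rank + 1) l P.part P.start v)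
    (ht : P.rank + 1 ≤ 2 ^ t) {run : SearchRun N (ℓ + 1)} (hrun : IsSearchState ℓ f w M P run) :
    ∃ A, Computes f w M (fullStep ℓ t P run) (run.extend A)
        (2 ^ (ℓ + 1) + (P.rank + 1) * 2 ^ (ℓ + 1) +
          (Fintype.card N * (ℓ + 1) + (P.rank + 1)) * (2 ^ (ℓ + 1) + t + 1)) ∧
      IsImprovement (pairMatroid M (ℓ + 1)) (auxFun (searchCoeff ℓ) (linearCoeff ℓ) f w)
        (pairsOf P.part (ℓ + 1)) run.final A ∧
      ∀ T ⊆ pairsOf P.part (ℓ + 1), (pairMatroid M (ℓ + 1)).Indep (T : Set (N × Fin (ℓ + 1))) →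
        (∑ p ∈ T, marginal (auxFun (searchCoeff ℓ) (linearCoeff ℓ) f w) run.final p -
          ∑ p ∈ run.final, marginal (auxFun (searchCoeff ℓ) (linearCoeff ℓ) f w) run.final p) /
            ((P.rank + 1 : ℕ) : ℝ) ≤
          auxFun (searchCoeff ℓ) (linearCoeff ℓ) f w A -
            auxFun (searchCoeff ℓ) (linearCoeff ℓ) f w run.final := by
  classical
  obtain ⟨A, hA, h1, h2⟩ := exists_computes_fullImprove (f := f) (w := w) (M := M)
    (pairMatroid_ground (L := ℓ + 1) hE)
    (fun X => computes_solutionTest X)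
    (computes_guideValue (f := f) (w := w) (M := M) (L := ℓ + 1) (searchCoeff ℓ) (linearCoeff ℓ))
    (auxFun_isSubmodular (searchCoeff_nonneg ℓ) h.mono h.submodular _ _) (t := t)
    (isSolution_iff.1 hrun.improving.isSolution_final) hrun.subset (R := P.rank + 1)
    (fun X hX => (isSolution_iff.2 hX).card_eq ▸ h.card_le _ (isSolution_iff.2 hX).2) ht
  refine ⟨A, ?_, h1, h2⟩
  rw [fullStep, hP]
  have := hA.bind (F := fun A => output (run.extend A)) (computes_output _ 0)
  simpa using this

theorem randomStep_spec (hE : M.E = Set.univ) (hP : P.weight = fun x => w {x})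
    (h : SearchSetting ℓ f w M κ ε η b δ (P.rank + 1) l P.part P.start v)
    (ht : P.rank + 1 ≤ 2 ^ t) {s m : ℕ} (hs : 1 ≤ s) (hsR : s ≤ P.rank + 1)
    (hm : Fintype.card N * (ℓ + 1) + (P.rank + 1) ≤ m * s)
    {run : SearchRun N (ℓ + 1)} (hrun : IsSearchState ℓ f w M P run) :
    (randomStep ℓ t s m P run).queries f w M ≤
        2 ^ (ℓ + 1) + s * 2 ^ (ℓ + 1) + m * (2 ^ (ℓ + 1) + t + 1) ∧
      (∀ run' ∈ (randomStep ℓ t s m P run).outcomes f w M, IsSearchState ℓ f w M P run') ∧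
      (∀ ψ : Finset (N × Fin (ℓ + 1)) → ℝ,
        (randomStep ℓ t s m P run).expect f w M (fun run' => ψ run'.final) =
          (randomImprove solutionTest (guideValue (searchCoeff ℓ) (linearCoeff ℓ) P.weight) t
            (P.rank + 1) s m (pairsOf P.part (ℓ + 1)) run.final).expect f w M ψ) ∧
      ∀ T ⊆ pairsOf P.part (ℓ + 1), (pairMatroid M (ℓ + 1)).Indep (T : Set (N × Fin (ℓ + 1))) →
        auxFun (searchCoeff ℓ) (linearCoeff ℓ) f w run.final +
        (∑ p ∈ T, marginal (auxFun (searchCoeff ℓ) (linearCoeff ℓ) f w) run.final p -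
          ∑ p ∈ run.final, marginal (auxFun (searchCoeff ℓ) (linearCoeff ℓ) f w) run.final p) /
            (2 * ((P.rank + 1 : ℕ) : ℝ)) ≤
          (randomStep ℓ t s m P run).expect f w M
            (fun run' => auxFun (searchCoeff ℓ) (linearCoeff ℓ) f w run'.final) := by
  classical
  obtain ⟨h1, h2, h3⟩ := randomImprove_spec (f := f) (w := w) (M := M)
    (pairMatroid_ground (L := ℓ + 1) hE)
    (fun X => computes_solutionTest X)
    (computes_guideValue (f := f) (w := w) (M := M) (L := ℓ + 1) (searchCoeff ℓ) (linearCoeff ℓ))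
    (auxFun_isSubmodular (searchCoeff_nonneg ℓ) h.mono h.submodular _ _) (t := t)
    (isSolution_iff.1 hrun.improving.isSolution_final) hrun.subset (R := P.rank + 1)
    (fun X hX => (isSolution_iff.2 hX).card_eq ▸ h.card_le _ (isSolution_iff.2 hX).2) ht
    hs hsR (by simpa using hm)
  have he : ∀ ψ : Finset (N × Fin (ℓ + 1)) → ℝ,
      (randomStep ℓ t s m P run).expect f w M (fun run' => ψ run'.final) =
        (randomImprove solutionTest (guideValue (searchCoeff ℓ) (linearCoeff ℓ) P.weight) t
          (P.rank + 1) s m (pairsOf P.part (ℓ + 1)) run.final).expect f w M ψ := by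
    intro ψ
    rw [randomStep, expect_bind]
    simp only [expect, SearchRun.final_extend]
  refine ⟨?_, ?_, he, ?_⟩
  · rw [randomStep, hP]
    exact queries_bind_le (k := 0) h1 fun A _ => le_rfl
  · intro run' hrun'
    rw [randomStep, hP] at hrun'
    obtain ⟨A, hA, hA'⟩ := (mem_outcomes_bind ..).1 hrun'
    obtain rfl : run' = run.extend A := hA'
    exact hrun.extend (h2 A hA)
  · intro T hT hTi
    rw [he, hP]
    exact h3 T hT hTi

omit [Fintype N] in
theorem isSearchState_initial
    {R : ℕ} (h : SearchSetting ℓ f w M κ ε η b δ R l P.part P.start v) :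
    IsSearchState ℓ f w M P (P.initial ℓ) := by
  refine ⟨⟨?_, List.isChain_singleton _⟩, h.start_subset, le_rfl⟩
  intro A hA
  obtain rfl : A = P.start ×ˢ {(0 : Fin (ℓ + 1))} := by simpa [Preparation.initial] using hA
  exact h.start_isSolution

omit [Fintype N] in
theorem IsSearchState.isGoodRun_of_scale_eq_zero {R : ℕ}
    (h : SearchSetting ℓ f w M κ ε η b δ R l P.part P.start v) (hv : v = 0)
    {run : SearchRun N (ℓ + 1)} (hrun : IsSearchState ℓ f w M P run) :
    IsGoodRun ℓ f w M η P run :=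
  h.isLocalOptIn_of_scale_eq_zero hv hrun.improving.isSolution_final hrun.subset hrun.start_le

/-- Each full step from a bad state lowers the potential by `η / (3 R)` with R = rank + 1, and `K`
steps would exceed its initial value. -/
theorem fullSearch_spec (hE : M.E = Set.univ) (hP : P.weight = fun x => w {x})
    (h : SearchSetting ℓ f w M κ ε η b δ (P.rank + 1) l P.part P.start v)
    (ht : Fintype.card N * (ℓ + 1) + 1 ≤ 2 ^ t) (ht' : P.rank + 1 ≤ 2 ^ t) (hδ : 0 < δ) {K : ℕ}
    (hK : Real.log (1 + singleCoeff ℓ * (((P.rank + 1 : ℕ) : ℝ) * (((P.rank + 1 : ℕ) : ℝ) + 2)) /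
      (η * δ)) < K * (η / (3 * ((P.rank + 1 : ℕ) : ℝ)))) :
    (∀ run ∈ (fullSearch ℓ t η K P).outcomes f w M,
      IsSearchState ℓ f w M P run ∧ IsGoodRun ℓ f w M η P run) ∧
    (fullSearch ℓ t η K P).queries f w M ≤
      K * (Fintype.card N * (ℓ + 1) * (2 * 2 ^ (ℓ + 1) + t + 1) + 2 ^ (ℓ + 1) +
        (2 ^ (ℓ + 1) + (P.rank + 1) * 2 ^ (ℓ + 1) +
          (Fintype.card N * (ℓ + 1) + (P.rank + 1)) * (2 ^ (ℓ + 1) + t + 1))) := by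
  classical
  have hinv : ∀ run, IsSearchState ℓ f w M P run →
      ∀ run' ∈ (fullStep ℓ t P run).outcomes f w M, IsSearchState ℓ f w M P run' := by
    intro run hrun run' hrun'
    obtain ⟨A, hA, hA', -⟩ := exists_computes_fullStep hE hP h ht' hrun
    rw [hA.outcomes_eq] at hrun'
    obtain rfl := hrun'
    exact hrun.extend hA'
  have htest : ∀ bad : SearchRun N (ℓ + 1) → Prop, (∀ run, bad run ↔ ¬ IsGoodRun ℓ f w M η P run) →
      ∀ run, IsSearchState ℓ f w M P run → Computes f w M (testRun ℓ t η P run)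
        (decide (¬ bad run))
        (Fintype.card N * (ℓ + 1) * (2 * 2 ^ (ℓ + 1) + t + 1) + 2 ^ (ℓ + 1)) := by
    intro bad hbad run hrun
    rw [decide_eq_decide.2 ((not_congr (hbad run)).trans not_not)]
    exact computes_testRun hE hP ht hrun
  have h0 := isSearchState_initial h
  refine ⟨fun run hrun => ⟨inv_attempt hinv K h0 hrun, ?_⟩, ?_⟩
  · rw [← not_not (a := IsGoodRun ℓ f w M η P run)]
    by_cases hv : v = 0
    · exact not_not.2 ((inv_attempt hinv K h0 hrun).isGoodRun_of_scale_eq_zero h hv)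
    · obtain ⟨ψ, ρ, lo, h1, h2, h3, h4⟩ := h.exists_potential hδ hv
      refine not_bad_of_mem_outcomes_attempt (bad := fun run => ¬ IsGoodRun ℓ f w M η P run)
        hinv (htest _ fun _ => Iff.rfl) (ψ := fun run => ψ run.final) (lo := lo)
        (γ := η / (3 * ((P.rank + 1 : ℕ) : ℝ)))
        (fun run hrun _ => (h1 _ hrun.improving.isSolution_final hrun.subset).1) ?_ K h0
        (fun _ => h4.trans_lt hK) hrun
      intro run hrun hbad run' hrun'
      obtain ⟨A, hA, hA', hgain⟩ := exists_computes_fullStep hE hP h ht' hrun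
      rw [hA.outcomes_eq] at hrun'
      obtain rfl := hrun'
      have hsol := hrun.improving.isSolution_final
      obtain ⟨T, hTG, hT, hle⟩ := h3 _ hsol hrun.subset hbad
      have h5 := h2 _ _ hsol hrun.subset (isSolution_iff.2 hA'.indep) hA'.subset
      have h6 := mul_le_mul_of_nonneg_left (hgain T hTG hT) (h1 _ hsol hrun.subset).2
      have h7 := div_le_div_of_nonneg_right hle (Nat.cast_nonneg (α := ℝ) (P.rank + 1))
      rw [mul_div_assoc] at h7
      rw [div_div] at h7
      simp only [SearchRun.final_extend]
      linarith
  · refine queries_attempt_le hinv (fun run hrun => (htest _ (fun _ => Iff.rfl) run hrun).queries_le)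
      (fun run hrun => ?_) K h0
    obtain ⟨A, hA, -, -⟩ := exists_computes_fullStep hE hP h ht' hrun
    exact hA.queries_le

theorem randomSearch_spec (hE : M.E = Set.univ) (hP : P.weight = fun x => w {x})
    (h : SearchSetting ℓ f w M κ ε η b δ (P.rank + 1) l P.part P.start v)
    (ht : Fintype.card N * (ℓ + 1) + 1 ≤ 2 ^ t) (ht' : P.rank + 1 ≤ 2 ^ t) (hδ : 0 < δ)
    {s m : ℕ} (hs : 1 ≤ s) (hsR : s ≤ P.rank + 1)
    (hm : Fintype.card N * (ℓ + 1) + (P.rank + 1) ≤ m * s) {K : ℕ} [NeZero K]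
    (hK : 2 * Real.log (1 + singleCoeff ℓ * (((P.rank + 1 : ℕ) : ℝ) *
      (((P.rank + 1 : ℕ) : ℝ) + 2)) / (η * δ)) ≤ η / (6 * ((P.rank + 1 : ℕ) : ℝ)) * K)
    (tries : ℕ) :
    (∀ run ∈ (randomSearch ℓ t η s m K tries P).outcomes f w M, IsSearchState ℓ f w M P run) ∧
    (randomSearch ℓ t η s m K tries P).prob f w M (fun run => ¬ IsGoodRun ℓ f w M η P run) ≤
      (1 / 2) ^ tries ∧
    (randomSearch ℓ t η s m K tries P).queries f w M ≤
      tries * (Fintype.card N * (ℓ + 1) * (2 * 2 ^ (ℓ + 1) + t + 1) + 2 ^ (ℓ + 1) +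
        K * (2 ^ (ℓ + 1) + s * 2 ^ (ℓ + 1) + m * (2 ^ (ℓ + 1) + t + 1))) := by
  classical
  have hstep : ∀ run, IsSearchState ℓ f w M P run →
      ∀ run' ∈ (randomStep ℓ t s m P run).outcomes f w M, IsSearchState ℓ f w M P run' :=
    fun run hrun => (randomStep_spec hE hP h ht' hs hsR hm hrun).2.1
  have hinv : ∀ run, IsSearchState ℓ f w M P run →
      ∀ run' ∈ (randomIterate (randomStep ℓ t s m P) K run).outcomes f w M,
        IsSearchState ℓ f w M P run' :=
    fun run hrun run' hrun' => inv_randomIterate hstep K hrun hrun'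
  have htest : ∀ bad : SearchRun N (ℓ + 1) → Prop, (∀ run, bad run ↔ ¬ IsGoodRun ℓ f w M η P run) →
      ∀ run, IsSearchState ℓ f w M P run → Computes f w M (testRun ℓ t η P run)
        (decide (¬ bad run))
        (Fintype.card N * (ℓ + 1) * (2 * 2 ^ (ℓ + 1) + t + 1) + 2 ^ (ℓ + 1)) := by
    intro bad hbad run hrun
    rw [decide_eq_decide.2 ((not_congr (hbad run)).trans not_not)]
    exact computes_testRun hE hP ht hrun
  have h0 := isSearchState_initial h
  refine ⟨fun run hrun => inv_attempt hinv tries h0 hrun,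
    prob_attempt_le (bad := fun run => ¬ IsGoodRun ℓ f w M η P run) hinv (htest _ fun _ => Iff.rfl) ?_ tries h0, ?_⟩
  · intro run hrun hbad
    -- A bad state has nonzero scale, so the potential is available.
    have hv : v ≠ 0 := fun hv => hbad (hrun.isGoodRun_of_scale_eq_zero h hv)
    obtain ⟨ψ, ρ, lo, h1, h2, h3, h4⟩ := h.exists_potential hδ hv
    have hη := h.η_pos
    -- The potential inequality is linear in the new value of Φ, so it passes to expectations.
    have key : ∀ run, IsSearchState ℓ f w M P run →
        (randomStep ℓ t s m P run).expect f w M (fun run' => ψ run'.final) ≤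
          ψ run.final - ρ run.final * ((randomStep ℓ t s m P run).expect f w M
            (fun run' => auxFun (searchCoeff ℓ) (linearCoeff ℓ) f w run'.final) -
              auxFun (searchCoeff ℓ) (linearCoeff ℓ) f w run.final) := by
      intro run hrun
      have hsol := hrun.improving.isSolution_final
      refine (expect_mono (ψ := fun run' => (ψ run.final + ρ run.final *
        auxFun (searchCoeff ℓ) (linearCoeff ℓ) f w run.final) + -ρ run.final *
          auxFun (searchCoeff ℓ) (linearCoeff ℓ) f w run'.final) fun run' hrun' => ?_).trans
          (le_of_eq ?_)
      · have hrun'' := hstep run hrun run' hrun'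
        have := h2 _ _ hsol hrun.subset hrun''.improving.isSolution_final hrun''.subset
        linarith
      · rw [expect_add, expect_const, expect_const_mul]
        ring
    refine prob_randomIterate_le (bad := fun run => ¬ IsGoodRun ℓ f w M η P run) hstep
      (ψ := fun run => ψ run.final) (lo := lo) (γ := η / (6 * ((P.rank + 1 : ℕ) : ℝ)))
      (by positivity)
      (fun run hrun => (h1 _ hrun.improving.isSolution_final hrun.subset).1) ?_ ?_ K hrun ?_
    · intro run hrun
      have hsol := hrun.improving.isSolution_final
      have h5 := key run hrun
      have h6 := (randomStep_spec hE hP h ht' hs hsR hm hrun).2.2.2 _ hrun.subset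
        (isSolution_iff.1 hsol)
      rw [sub_self, zero_div, add_zero] at h6
      have h7 := mul_nonneg (h1 _ hsol hrun.subset).2 (sub_nonneg.2 h6)
      linarith
    · intro run hrun hbad
      have hsol := hrun.improving.isSolution_final
      have h5 := key run hrun
      obtain ⟨T, hTG, hT, hle⟩ := h3 _ hsol hrun.subset hbad
      have h6 := (randomStep_spec hE hP h ht' hs hsR hm hrun).2.2.2 T hTG hT
      have h7 := mul_le_mul_of_nonneg_left (le_sub_iff_add_le'.2 h6)
        (h1 _ hsol hrun.subset).2
      have h8 := div_le_div_of_nonneg_right hle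
        (by positivity : (0 : ℝ) ≤ 2 * ((P.rank + 1 : ℕ) : ℝ))
      have e : η / 3 / (2 * ((P.rank + 1 : ℕ) : ℝ)) = η / (6 * ((P.rank + 1 : ℕ) : ℝ)) := by
        rw [div_div]
        congr 1
        ring
      rw [mul_div_assoc, e] at h8
      linarith
    -- A round may begin at any state reached so far. Its Φ is at least the initial one, so its
    -- potential is at most the initial one and the same `K` works.
    · have h5 := h2 _ _ h.start_isSolution h.start_subset hrun.improving.isSolution_final
        hrun.subset
      have h6 := mul_nonneg (h1 _ h.start_isSolution h.start_subset).2
        (sub_nonneg.2 hrun.start_le)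
      linarith
  · refine queries_attempt_le hinv (fun run hrun => (htest _ (fun _ => Iff.rfl) run hrun).queries_le)
      (fun run hrun => ?_) tries h0
    exact queries_randomIterate_le hstep
      (fun run hrun => (randomStep_spec hE hP h ht' hs hsR hm hrun).1) K hrun

end runs

end OracleAlg

/-! ### The choice of the parameters -/

section parameters

/-- The requirements on the parameters of the search. -/
structure IsSearchParam (ε : ℝ) (ℓ : ℕ) (b η : ℝ) : Prop where
  ε_pos : 0 < ε
  ε_le : ε ≤ 1 / 2
  b_pos : 0 < b
  b_le : b ≤ searchCoeff ℓ (ℓ + 1)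
  le_singleCoeff : linearCoeff ℓ * (1 - 1 / Real.exp 1 - ε) ≤ singleCoeff ℓ - b
  slack : ε / 2 * singleCoeff ℓ ≤ singleCoeff ℓ - linearCoeff ℓ * (1 - 1 / Real.exp 1 - ε)
  η_pos : 0 < η
  η_le : η ≤ ε / 2
  η_mul_le : η * ∑ J : Finset (Fin (ℓ + 1)), searchCoeff ℓ J.card ≤ b / 2

theorem approx_ratio_nonneg {ε : ℝ} (hε : ε ≤ 1 / 2) : 0 ≤ 1 - 1 / Real.exp 1 - ε := by
  have h1 : 1 / Real.exp 1 ≤ 1 / 2 :=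
    one_div_le_one_div_of_le (by norm_num) (by linarith [Real.exp_one_gt_d9])
  linarith

theorem exists_isSearchParam {ε : ℝ} (hε : 0 < ε) (hε' : ε ≤ 1 / 2) :
    ∃ (ℓ : ℕ) (b η : ℝ), 1 ≤ ℓ ∧ IsSearchParam ε ℓ b η := by
  have he := Real.exp_pos 1
  have hlt : 1 / (1 / Real.exp 1 + ε / 2) < Real.exp 1 := by
    rw [div_lt_iff₀ (by positivity), mul_add, mul_one_div_cancel he.ne']
    have := mul_pos he (half_pos hε)
    linarith
  -- L = ℓ + 1 is taken so large that (1 + 1/L)^(-L) is below 1/e + ε/2. Half of ε is spent here,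
  -- and the rest leaves room for `b`.
  obtain ⟨n, hn, hn2⟩ := (((Real.tendsto_one_add_div_pow_exp 1).eventually_const_lt hlt).and
    (Filter.eventually_ge_atTop 2)).exists
  obtain ⟨ℓ, rfl⟩ : ∃ ℓ, n = ℓ + 1 := ⟨n - 1, by omega⟩
  have hS := sum_searchCoeff_pos ℓ
  have hc := linearCoeff_pos ℓ
  have ha : linearCoeff ℓ * (1 - 1 / Real.exp 1 - ε) + linearCoeff ℓ * (ε / 2) ≤
      singleCoeff ℓ := by
    rw [singleCoeff_eq]
    have h1 : (ℓ : ℝ) + 1 ≤ linearCoeff ℓ * (1 / Real.exp 1 + ε / 2) := by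
      rw [linearCoeff, mul_assoc]
      refine le_mul_of_one_le_right (by positivity) ?_
      rw [div_lt_iff₀ (by positivity)] at hn
      push_cast at hn
      exact hn.le
    linarith
  have hac : singleCoeff ℓ ≤ linearCoeff ℓ := by
    rw [singleCoeff_eq]
    have : (0 : ℝ) ≤ (ℓ : ℝ) + 1 := by positivity
    linarith
  have hb : 0 < min (linearCoeff ℓ * ε / 4) (searchCoeff ℓ (ℓ + 1)) :=
    lt_min (by positivity) (searchCoeff_pos ℓ (by simp) le_rfl)
  refine ⟨ℓ, min (linearCoeff ℓ * ε / 4) (searchCoeff ℓ (ℓ + 1)),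
    min (ε / 2) (min (linearCoeff ℓ * ε / 4) (searchCoeff ℓ (ℓ + 1)) /
      (2 * ∑ J : Finset (Fin (ℓ + 1)), searchCoeff ℓ J.card)), by omega, hε, hε', hb,
    min_le_right _ _, ?_, ?_, lt_min (by positivity) (by positivity), min_le_left _ _, ?_⟩
  · have h1 := min_le_left (linearCoeff ℓ * ε / 4) (searchCoeff ℓ (ℓ + 1))
    have h2 := mul_pos hc hε
    linarith
  · have := mul_le_mul_of_nonneg_left hac (half_pos hε).le
    linarith
  · refine (mul_le_mul_of_nonneg_right (min_le_right _ _) hS.le).trans (le_of_eq ?_)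
    field_simp

theorem natCast_clog_le {m : ℕ} (hm : 1 ≤ m) : (Nat.clog 2 m : ℝ) ≤ 1 + 2 * Real.log m := by
  have hlog : 0 ≤ Real.log m := Real.log_natCast_nonneg m
  rcases Nat.eq_zero_or_pos (Nat.clog 2 m) with h0 | h0
  · rw [h0, Nat.cast_zero]
    linarith
  · have h1 : 1 < m := by
      by_contra h
      have : m = 1 := by omega
      simp [this] at h0
    have h2 := Nat.pow_pred_clog_lt_self (b := 2) (by norm_num) h1
    have h3 : ((2 : ℝ)) ^ (Nat.clog 2 m - 1) ≤ m := by exact_mod_cast h2.le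
    have h4 := Real.log_le_log (by positivity) h3
    rw [Real.log_pow, Nat.cast_sub h0, Nat.cast_one] at h4
    have h5 := Real.log_two_gt_d9
    have h6 : (1 : ℝ) ≤ Nat.clog 2 m := by exact_mod_cast h0
    have h7 : ((Nat.clog 2 m : ℝ) - 1) * (1 / 2) ≤ ((Nat.clog 2 m : ℝ) - 1) * Real.log 2 :=
      mul_le_mul_of_nonneg_left (by linarith) (by linarith)
    linarith

/-- The exponent of a power of two of at least `Q n ^ 3`. -/
noncomputable def searchExponent (Q : ℝ) (n : ℕ) : ℕ := Nat.clog 2 ⌈Q * (n : ℝ) ^ 3⌉₊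

theorem le_two_pow_searchExponent (Q : ℝ) (n : ℕ) :
    Q * (n : ℝ) ^ 3 ≤ (2 : ℝ) ^ searchExponent Q n := by
  rw [searchExponent]
  refine (Nat.le_ceil _).trans ?_
  generalize ⌈Q * (n : ℝ) ^ 3⌉₊ = m
  have h := (Nat.cast_le (α := ℝ)).2 (Nat.le_pow_clog (b := 2) one_lt_two m)
  rwa [Nat.cast_pow, Nat.cast_ofNat] at h

theorem mul_pow_three_le {Q C : ℝ} (hQ : Q ≤ C) (n : ℕ) :
    Q * (n : ℝ) ^ 3 ≤ (2 : ℝ) ^ searchExponent C n :=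
  (mul_le_mul_of_nonneg_right hQ (by positivity)).trans (le_two_pow_searchExponent _ n)

theorem searchExponent_le {Q : ℝ} (hQ : 0 < Q) {n : ℕ} (hn : 1 ≤ n) :
    (searchExponent Q n : ℝ) + 1 ≤ (6 + 2 * Real.log (Q + 1)) * (1 + Real.log n) := by
  have hn' : (1 : ℝ) ≤ n := by exact_mod_cast hn
  have hn3 : (1 : ℝ) ≤ (n : ℝ) ^ 3 := one_le_pow₀ hn'
  have hpos : 0 < Q * (n : ℝ) ^ 3 := by positivity
  have h1 := natCast_clog_le (Nat.one_le_iff_ne_zero.2 (Nat.ceil_pos.2 hpos).ne')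
  have h2 : (⌈Q * (n : ℝ) ^ 3⌉₊ : ℝ) ≤ (Q + 1) * (n : ℝ) ^ 3 := by
    have := (Nat.ceil_lt_add_one hpos.le).le
    linarith
  have h3 := Real.log_le_log (by exact_mod_cast Nat.ceil_pos.2 hpos) h2
  rw [Real.log_mul (by positivity) (by positivity), Real.log_pow] at h3
  have h4 := Real.log_natCast_nonneg n
  have h5 : 0 ≤ Real.log (Q + 1) := Real.log_nonneg (by linarith)
  have h6 := mul_nonneg h5 h4
  rw [searchExponent]
  push_cast at h3
  linarith

variable {ε : ℝ} {ℓ : ℕ} {b η : ℝ}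

/-- A constant that is large enough for the number of repetitions. -/
noncomputable def searchConst (ε : ℝ) (ℓ : ℕ) (b η : ℝ) : ℝ :=
  -- The four summands serve `card_add_one_le`, `log_le`, `half_pow_le` and `loss_le`, in this
  -- order.
  (ℓ + 2) + (1 + 16 / (η * ε)) + 1 / ε +
    (1 + 32 * (singleCoeff ℓ + ∑ J : Finset (Fin (ℓ + 1)), searchCoeff ℓ J.card) *
      (∑ J : Finset (Fin (ℓ + 1)), searchCoeff ℓ J.card) / (b * ε * singleCoeff ℓ))

/-! ### Numerical consequences of the choice of the constants -/

namespace IsSearchParam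

theorem le_searchConst (h : IsSearchParam ε ℓ b η) :
    (ℓ : ℝ) + 2 ≤ searchConst ε ℓ b η ∧ 1 + 16 / (η * ε) ≤ searchConst ε ℓ b η ∧
      1 / ε ≤ searchConst ε ℓ b η ∧
      1 + 32 * (singleCoeff ℓ + ∑ J : Finset (Fin (ℓ + 1)), searchCoeff ℓ J.card) *
        (∑ J : Finset (Fin (ℓ + 1)), searchCoeff ℓ J.card) / (b * ε * singleCoeff ℓ) ≤
          searchConst ε ℓ b η := by
  have hS := sum_searchCoeff_pos ℓ
  have ha := singleCoeff_pos ℓ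
  have hη := h.η_pos
  have hε := h.ε_pos
  have hb := h.b_pos
  have h1 : 0 < 16 / (η * ε) := by positivity
  have h2 : 0 < 1 / ε := by positivity
  have h3 : 0 < 32 * (singleCoeff ℓ + ∑ J : Finset (Fin (ℓ + 1)), searchCoeff ℓ J.card) *
        (∑ J : Finset (Fin (ℓ + 1)), searchCoeff ℓ J.card) / (b * ε * singleCoeff ℓ) := by
    positivity
  have h4 : (0 : ℝ) ≤ ℓ := by positivity
  rw [searchConst]
  refine ⟨?_, ?_, ?_, ?_⟩ <;> linarith

theorem searchConst_pos (h : IsSearchParam ε ℓ b η) : 0 < searchConst ε ℓ b η :=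
  lt_of_lt_of_le (by positivity) h.le_searchConst.1

theorem card_add_one_le (h : IsSearchParam ε ℓ b η) {n : ℕ} (hn : 1 ≤ n) :
    n * (ℓ + 1) + 1 ≤ 2 ^ searchExponent (searchConst ε ℓ b η) n := by
  have h1 := mul_pow_three_le h.le_searchConst.1 n
  have h2 : n * (ℓ + 1) + 1 ≤ (ℓ + 2) * n ^ 3 := by
    have h3 : n ≤ n ^ 3 := Nat.le_self_pow (by norm_num) n
    nlinarith
  have h3 : (((n * (ℓ + 1) + 1 : ℕ)) : ℝ) ≤ (((ℓ + 2) * n ^ 3 : ℕ) : ℝ) := by exact_mod_cast h2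
  push_cast at h3
  exact_mod_cast h3.trans h1

/-- The argument of the logarithm is of order `n ^ 3`: two factors come from `R * (R + 2)` and one
from `1 / δ`. Hence the third power in `searchExponent`. -/
theorem log_le (h : IsSearchParam ε ℓ b η) {n R : ℕ} (hn : 1 ≤ n) (hR : R ≤ n + 1) :
    Real.log (1 + singleCoeff ℓ * ((R : ℝ) * ((R : ℝ) + 2)) /
      (η * (ε * singleCoeff ℓ / (2 * n)))) ≤ searchExponent (searchConst ε ℓ b η) n := by
  have hn' : (1 : ℝ) ≤ n := by exact_mod_cast hn
  have hR' : (R : ℝ) ≤ 2 * n := by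
    have : (R : ℝ) ≤ n + 1 := by exact_mod_cast hR
    linarith
  have ha := singleCoeff_pos ℓ
  have hη := h.η_pos
  have hε := h.ε_pos
  have h1 := mul_pow_three_le h.le_searchConst.2.1 n
  have h2 : 1 + singleCoeff ℓ * ((R : ℝ) * ((R : ℝ) + 2)) / (η * (ε * singleCoeff ℓ / (2 * n))) ≤
      (1 + 16 / (η * ε)) * (n : ℝ) ^ 3 := by
    have e : singleCoeff ℓ * ((R : ℝ) * ((R : ℝ) + 2)) / (η * (ε * singleCoeff ℓ / (2 * n))) =
        1 / (η * ε) * (2 * n * (R * (R + 2))) := by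
      field_simp
    have h3 : (R : ℝ) * (R + 2) ≤ 2 * n * (4 * n) :=
      mul_le_mul hR' (by linarith) (by positivity) (by positivity)
    have h4 : 1 / (η * ε) * (2 * n * (R * (R + 2))) ≤ 1 / (η * ε) * (16 * (n : ℝ) ^ 3) := by
      refine mul_le_mul_of_nonneg_left ?_ (by positivity)
      have := mul_le_mul_of_nonneg_left h3 (by positivity : (0 : ℝ) ≤ 2 * n)
      linarith
    have h5 : (1 : ℝ) ≤ (n : ℝ) ^ 3 := one_le_pow₀ hn'
    rw [e]
    have e2 : 16 / (η * ε) = 1 / (η * ε) * 16 := by ring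
    rw [e2]
    linarith
  refine (Real.log_le_log (by positivity) (h2.trans h1)).trans ?_
  rw [Real.log_pow]
  have := Real.log_two_lt_d9
  exact mul_le_of_le_one_right (by positivity) (by linarith)

theorem half_pow_le (h : IsSearchParam ε ℓ b η) {n : ℕ} (hn : 1 ≤ n) :
    (1 / 2 : ℝ) ^ searchExponent (searchConst ε ℓ b η) n ≤ ε := by
  have hn' : (1 : ℝ) ≤ (n : ℝ) ^ 3 := one_le_pow₀ (by exact_mod_cast hn)
  have hε := h.ε_pos
  have h1 := mul_pow_three_le h.le_searchConst.2.2.1 n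
  have h2 : 1 / ε ≤ (2 : ℝ) ^ searchExponent (searchConst ε ℓ b η) n :=
    (le_mul_of_one_le_right (by positivity) hn').trans h1
  rw [one_div_pow, one_div_le (by positivity) hε]
  exact h2

/-- The slack after success and the loss after failure are both multiples of `v` whose ratio is
polynomial in `n`, so a failure probability of `(1 / 2) ^ τ`, with τ the search exponent, makes the
expected loss smaller than the slack. -/
theorem loss_le (h : IsSearchParam ε ℓ b η) {n R : ℕ} (hn : 1 ≤ n) (hR : R ≤ n + 1) {v : ℝ}
    (hv : 0 ≤ v) :
    (b * (ε * singleCoeff ℓ / (2 * n) * v) /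
        (2 * (R + 2) * ∑ J : Finset (Fin (ℓ + 1)), searchCoeff ℓ J.card) +
      (singleCoeff ℓ + ∑ J : Finset (Fin (ℓ + 1)), searchCoeff ℓ J.card) * (R * v)) *
        (1 / 2) ^ searchExponent (searchConst ε ℓ b η) n ≤
      b * (ε * singleCoeff ℓ / (2 * n) * v) /
        (2 * (R + 2) * ∑ J : Finset (Fin (ℓ + 1)), searchCoeff ℓ J.card) := by
  have hn' : (1 : ℝ) ≤ n := by exact_mod_cast hn
  have hn3 : (1 : ℝ) ≤ (n : ℝ) ^ 3 := one_le_pow₀ hn'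
  have hR' : (R : ℝ) ≤ 2 * n := by
    have : (R : ℝ) ≤ n + 1 := by exact_mod_cast hR
    linarith
  have ha := singleCoeff_pos ℓ
  have hε := h.ε_pos
  have hb := h.b_pos
  have hS := sum_searchCoeff_pos ℓ
  have h1 := mul_pow_three_le h.le_searchConst.2.2.2 n
  generalize (∑ J : Finset (Fin (ℓ + 1)), searchCoeff ℓ J.card) = S at hS h1 ⊢
  generalize singleCoeff ℓ = a at ha h1 ⊢
  rw [one_div_pow, mul_one_div, div_le_iff₀ (by positivity)]
  set s := b * (ε * a / (2 * n) * v) / (2 * (R + 2) * S) with hs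
  have hs0 : 0 ≤ s := by positivity
  have h2 : s * ((1 + 32 * (a + S) * S / (b * ε * a)) * (n : ℝ) ^ 3) ≤
      s * 2 ^ searchExponent (searchConst ε ℓ b η) n := mul_le_mul_of_nonneg_left h1 hs0
  have e : s * (32 * (a + S) * S / (b * ε * a) * (n : ℝ) ^ 3) =
      (a + S) * v * (8 * (n : ℝ) ^ 2 / (R + 2)) := by
    rw [hs]
    field_simp
    ring
  have h3 : (R : ℝ) ≤ 8 * (n : ℝ) ^ 2 / (R + 2) := by
    rw [le_div_iff₀ (by positivity)]
    have : (R : ℝ) * (R + 2) ≤ 2 * n * (4 * n) :=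
      mul_le_mul hR' (by linarith) (by positivity) (by positivity)
    linarith
  have h4 : (a + S) * v * R ≤ (a + S) * v * (8 * (n : ℝ) ^ 2 / (R + 2)) :=
    mul_le_mul_of_nonneg_left h3 (by positivity)
  have h5 : s ≤ s * (n : ℝ) ^ 3 := le_mul_of_one_le_right hs0 hn3
  linarith

theorem searchSetting {N : Type u} [DecidableEq N] {f w : Finset N → ℝ} {M : Matroid N}
    (h : IsSearchParam ε ℓ b η) (hm : Monotone f) (hs : IsSubmodular f) (h0 : f ∅ = 0)
    (hw : IsLinearSetFun w) {R n : ℕ} (hR : ∀ X : Finset N, M.Indep (X : Set N) → X.card ≤ R)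
    {l part : List N} {start : Finset N} {v : ℝ} (hl : ∀ x, x ∈ l) (hn : l.length = n)
    (hn1 : 1 ≤ n)
    (hscale : OracleAlg.IsScale M (fun x => singleCoeff ℓ * f {x} + linearCoeff ℓ * w {x})
      (fun x => linearCoeff ℓ * w {x}) (fun x => f {x}) (ε * singleCoeff ℓ / (2 * n)) l part
        start v) :
    SearchSetting ℓ f w M (1 - 1 / Real.exp 1 - ε) ε η b (ε * singleCoeff ℓ / (2 * n)) R l part
      start v := by
  have hn' : (1 : ℝ) ≤ n := by exact_mod_cast hn1
  have ha := singleCoeff_pos ℓ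
  have hε := h.ε_pos
  -- `δ` is chosen so that `n` errors of the scan together cost the fraction `ε / 2`.
  have e : (l.length : ℝ) * (ε * singleCoeff ℓ / (2 * n)) = ε / 2 * singleCoeff ℓ := by
    rw [hn]
    field_simp
  exact
    { mono := hm
      submodular := hs
      empty := h0
      linear := hw
      card_le := hR
      mem_list := hl
      scale := hscale
      κ_nonneg := approx_ratio_nonneg h.ε_le
      b_nonneg := h.b_pos.le
      b_le := h.b_le
      κ_le := h.le_singleCoeff
      η_pos := h.η_pos
      η_le_one := by linarith [h.η_le, h.ε_le]
      η_le := h.η_le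
      η_mul_le := h.η_mul_le
      δ_le := by
        rw [div_le_iff₀ (by positivity), mul_comm]
        exact mul_le_mul_of_nonneg_left (by linarith [h.ε_le]) ha.le
      length_mul_le := e ▸ h.slack
      length_mul_le' := e.le }

end IsSearchParam

end parameters

namespace OracleAlg

/-! ### The algorithms for normalized functions -/

section algorithms

variable {N : Type u} [Fintype N] [DecidableEq N] {ε : ℝ} {ℓ : ℕ} {b η : ℝ}
  {f w : Finset N → ℝ} {M : Matroid N}

/-- The number of steps of the search. -/
noncomputable def stepCount (η : ℝ) (τ R : ℕ) : ℕ := ⌈12 / η⌉₊ * R * τ + 1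

noncomputable instance (η : ℝ) (τ R : ℕ) : NeZero (stepCount η τ R) := ⟨Nat.succ_ne_zero _⟩

/-- The number of slots that are considered in a random step. -/
def slotCount (n R : ℕ) : ℕ := min R (Nat.sqrt n + 1)

/-- The number of candidates that are considered in a random step. -/
def candidateCount (ℓ n R : ℕ) : ℕ := (n * (ℓ + 1) + R) / slotCount n R + 1

/-- The deterministic algorithm for normalized functions. -/
noncomputable def fullAlg (N : Type u) [Fintype N] [DecidableEq N] (ε : ℝ) (ℓ : ℕ) (η : ℝ)
    (τ : ℕ) : OracleAlg N (SearchRun N (ℓ + 1)) :=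
  (prepare ℓ τ (ε * singleCoeff ℓ / (2 * Fintype.card N))).bind fun P =>
    fullSearch ℓ τ η (stepCount η τ (P.rank + 1)) P

/-- The randomized algorithm for normalized functions. -/
noncomputable def randomAlg (N : Type u) [Fintype N] [DecidableEq N] (ε : ℝ) (ℓ : ℕ) (η : ℝ)
    (τ : ℕ) : OracleAlg N (SearchRun N (ℓ + 1)) :=
  (prepare ℓ τ (ε * singleCoeff ℓ / (2 * Fintype.card N))).bind fun P =>
    randomSearch ℓ τ η (slotCount (Fintype.card N) (P.rank + 1))
      (candidateCount ℓ (Fintype.card N) (P.rank + 1)) (stepCount η τ (P.rank + 1)) τ P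

/-- The run ends with an approximate local optimum that satisfies the approximation guarantee. -/
structure IsSuccessful (ℓ : ℕ) (f w : Finset N → ℝ) (M : Matroid N) (ε : ℝ)
    (run : SearchRun N (ℓ + 1)) : Prop where
  optimal : run.IsLocallyOptimal M (searchCoeff ℓ) (linearCoeff ℓ) f w ε
  guarantee : ∀ O : Finset N, M.Indep (O : Set N) →
    (1 - 1 / Real.exp 1 - ε) * f O + w O ≤ f run.result + w run.result

/-- The summand 1 in `stepCount` makes the inequality strict. The factor 12 is dictated by
`stepCount_random`, where the decrease `η / (6 R)` has to pay twice for the potential. -/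
theorem stepCount_full (hη : 0 < η) {τ R : ℕ} (hR : 1 ≤ R) {x : ℝ} (hx : x ≤ τ) :
    x < stepCount η τ R * (η / (3 * (R : ℝ))) := by
  have hR' : (1 : ℝ) ≤ R := by exact_mod_cast hR
  have h1 := Nat.le_ceil (12 / η)
  rw [div_le_iff₀ hη] at h1
  have h2 : (stepCount η τ R : ℝ) * (η / (3 * (R : ℝ))) =
      (⌈12 / η⌉₊ * η) * τ / 3 + η / (3 * (R : ℝ)) := by
    rw [stepCount]
    push_cast
    field_simp
  have h3 : 0 < η / (3 * (R : ℝ)) := by positivity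
  have h4 := mul_le_mul_of_nonneg_right h1 (Nat.cast_nonneg (α := ℝ) τ)
  have h5 : (0 : ℝ) ≤ τ := Nat.cast_nonneg τ
  linarith

theorem stepCount_random (hη : 0 < η) {τ R : ℕ} (hR : 1 ≤ R) {x : ℝ} (hx : x ≤ τ) :
    2 * x ≤ η / (6 * (R : ℝ)) * stepCount η τ R := by
  have hR' : (1 : ℝ) ≤ R := by exact_mod_cast hR
  have h1 := Nat.le_ceil (12 / η)
  rw [div_le_iff₀ hη] at h1
  have h2 : η / (6 * (R : ℝ)) * stepCount η τ R =
      (⌈12 / η⌉₊ * η) * τ / 6 + η / (6 * (R : ℝ)) := by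
    rw [stepCount]
    push_cast
    field_simp
  have h3 : 0 < η / (6 * (R : ℝ)) := by positivity
  have h4 := mul_le_mul_of_nonneg_right h1 (Nat.cast_nonneg (α := ℝ) τ)
  linarith

omit [Fintype N] in
theorem IsSearchState.indep_result {P : Preparation N} {run : SearchRun N (ℓ + 1)}
    (h : IsSearchState ℓ f w M P run) : M.Indep (run.result : Set N) :=
  h.improving.isSolution_final.2

theorem le_of_linearCoeff_mul_le {κ x y x' y' : ℝ}
    (h : linearCoeff ℓ * κ * x + linearCoeff ℓ * y ≤ linearCoeff ℓ * x' + linearCoeff ℓ * y') :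
    κ * x + y ≤ x' + y' := by
  refine le_of_mul_le_mul_left ?_ (linearCoeff_pos ℓ)
  linarith

theorem IsGoodRun.isSuccessful {δ v : ℝ} {R : ℕ} {l : List N} {P : Preparation N}
    (h : SearchSetting ℓ f w M (1 - 1 / Real.exp 1 - ε) ε η b δ R l P.part P.start v)
    {run : SearchRun N (ℓ + 1)} (hrun : IsSearchState ℓ f w M P run)
    (hgood : IsGoodRun ℓ f w M η P run) : IsSuccessful ℓ f w M ε run := by
  have hsol := hrun.improving.isSolution_final
  constructor
  · obtain ⟨B, hB, hle⟩ := h.locally_optimal hsol hgood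
    refine ⟨B, hB, fun T hT => le_trans (le_of_eq ?_) (hle T hT)⟩
    congr 1
    exact Finset.sum_congr rfl fun p hp => (marginal_of_mem hp).symm
  · intro O hO
    have h1 := h.guarantee hsol hgood hO
    have h2 := mul_nonneg (div_nonneg h.b_nonneg zero_le_two) (h.f_nonneg run.result)
    exact le_of_linearCoeff_mul_le ((le_add_of_nonneg_right h2).trans h1)

theorem slotCount_spec {n R : ℕ} (hR : 1 ≤ R) :
    1 ≤ slotCount n R ∧ slotCount n R ≤ R ∧
      n * (ℓ + 1) + R ≤ candidateCount ℓ n R * slotCount n R := by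
  have h1 : 1 ≤ slotCount n R := le_min hR (Nat.le_add_left 1 _)
  refine ⟨h1, min_le_left _ _, ?_⟩
  have := Nat.lt_div_mul_add (a := n * (ℓ + 1) + R) h1
  rw [candidateCount, add_mul, one_mul]
  exact this.le

theorem fullAlg_spec [Nonempty N] (h : IsSearchParam ε ℓ b η) (hm : Monotone f)
    (hs : IsSubmodular f) (h0 : f ∅ = 0) (hw : IsLinearSetFun w) (hE : M.E = Set.univ) {τ : ℕ}
    (hτ : τ = searchExponent (searchConst ε ℓ b η) (Fintype.card N)) :
    (∀ run ∈ (fullAlg N ε ℓ η τ).outcomes f w M,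
      run.IsImproving M (auxFun (searchCoeff ℓ) (linearCoeff ℓ) f w) ∧
        M.Indep (run.result : Set N) ∧ IsSuccessful ℓ f w M ε run) ∧
    ∃ R ≤ M.eRank.toNat + 1, 1 ≤ R ∧ R ≤ Fintype.card N + 1 ∧
      (fullAlg N ε ℓ η τ).queries f w M ≤ 5 * (Fintype.card N * (τ + 1)) +
        stepCount η τ R *
          (Fintype.card N * (ℓ + 1) * (2 * 2 ^ (ℓ + 1) + τ + 1) + 2 ^ (ℓ + 1) +
            (2 ^ (ℓ + 1) + R * 2 ^ (ℓ + 1) +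
              (Fintype.card N * (ℓ + 1) + R) * (2 ^ (ℓ + 1) + τ + 1))) := by
  have hn : 1 ≤ Fintype.card N := Fintype.card_pos
  have hn' : (0 : ℝ) < Fintype.card N := by exact_mod_cast hn
  have hδ : 0 < ε * singleCoeff ℓ / (2 * Fintype.card N) := by
    have := h.ε_pos
    have := singleCoeff_pos ℓ
    positivity
  have hcard : Fintype.card N * (ℓ + 1) + 1 ≤ 2 ^ τ := hτ ▸ h.card_add_one_le hn
  have hcard' : Fintype.card N + 1 ≤ 2 ^ τ := le_trans (by nlinarith) hcard
  obtain ⟨P, l, v, hP, hPw, hPR, hPr, hlen, hl, hscale⟩ :=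
    exists_computes_prepare (w := w) hE hm h0 ℓ hcard' hδ.le
  -- One slot more than the rank keeps the number of slots positive for matroids of rank zero.
  have hset := h.searchSetting hm hs h0 hw (R := P.rank + 1)
    (fun X hX => (hPR X hX).trans (Nat.le_succ _)) hl hlen hn hscale
  have hrank : P.rank + 1 ≤ Fintype.card N + 1 := by
    refine Nat.succ_le_succ (hPr.trans ?_)
    have h1 := M.eRank_le_encard_ground
    rw [hE, Set.encard_univ, ENat.card_eq_coe_fintype_card] at h1
    exact ENat.toNat_le_of_le_natCast h1
  obtain ⟨h1, h2⟩ := fullSearch_spec hE hPw hset hcard (hrank.trans hcard') hδ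
    (K := stepCount η τ (P.rank + 1))
    (stepCount_full h.η_pos (Nat.le_add_left 1 _) (hτ ▸ h.log_le hn hrank))
  refine ⟨fun run hrun => ?_, P.rank + 1, Nat.succ_le_succ hPr,
    Nat.le_add_left 1 _, hrank, hP.queries_bind h2⟩
  rw [fullAlg, hP.outcomes_bind] at hrun
  obtain ⟨h3, h4⟩ := h1 run hrun
  exact ⟨h3.improving, h3.indep_result, h4.isSuccessful hset h3⟩

theorem randomAlg_spec [Nonempty N] (h : IsSearchParam ε ℓ b η) (hm : Monotone f)
    (hs : IsSubmodular f) (h0 : f ∅ = 0) (hw : IsLinearSetFun w) (hE : M.E = Set.univ) {τ : ℕ}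
    (hτ : τ = searchExponent (searchConst ε ℓ b η) (Fintype.card N)) :
    (∀ run ∈ (randomAlg N ε ℓ η τ).outcomes f w M,
      run.IsImproving M (auxFun (searchCoeff ℓ) (linearCoeff ℓ) f w) ∧
        M.Indep (run.result : Set N)) ∧
    1 - ε ≤ (randomAlg N ε ℓ η τ).prob f w M (IsSuccessful ℓ f w M ε) ∧
    (∀ O : Finset N, M.Indep (O : Set N) →
      (1 - 1 / Real.exp 1 - ε) * f O + w O ≤
        (randomAlg N ε ℓ η τ).expect f w M fun run => f run.result + w run.result) ∧
    ∃ R ≤ M.eRank.toNat + 1, 1 ≤ R ∧ R ≤ Fintype.card N + 1 ∧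
      (randomAlg N ε ℓ η τ).queries f w M ≤ 5 * (Fintype.card N * (τ + 1)) +
        τ * (Fintype.card N * (ℓ + 1) * (2 * 2 ^ (ℓ + 1) + τ + 1) + 2 ^ (ℓ + 1) +
          stepCount η τ R * (2 ^ (ℓ + 1) + slotCount (Fintype.card N) R * 2 ^ (ℓ + 1) +
            candidateCount ℓ (Fintype.card N) R * (2 ^ (ℓ + 1) + τ + 1))) := by
  classical
  have hn : 1 ≤ Fintype.card N := Fintype.card_pos
  have hn' : (0 : ℝ) < Fintype.card N := by exact_mod_cast hn
  have hδ : 0 < ε * singleCoeff ℓ / (2 * Fintype.card N) := by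
    have := h.ε_pos
    have := singleCoeff_pos ℓ
    positivity
  have hcard : Fintype.card N * (ℓ + 1) + 1 ≤ 2 ^ τ := hτ ▸ h.card_add_one_le hn
  have hcard' : Fintype.card N + 1 ≤ 2 ^ τ := le_trans (by nlinarith) hcard
  obtain ⟨P, l, v, hP, hPw, hPR, hPr, hlen, hl, hscale⟩ :=
    exists_computes_prepare (w := w) hE hm h0 ℓ hcard' hδ.le
  have hset := h.searchSetting hm hs h0 hw (R := P.rank + 1)
    (fun X hX => (hPR X hX).trans (Nat.le_succ _)) hl hlen hn hscale
  have hrank : P.rank + 1 ≤ Fintype.card N + 1 := by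
    refine Nat.succ_le_succ (hPr.trans ?_)
    have h1 := M.eRank_le_encard_ground
    rw [hE, Set.encard_univ, ENat.card_eq_coe_fintype_card] at h1
    exact ENat.toNat_le_of_le_natCast h1
  obtain ⟨hs1, hs2, hs3⟩ := slotCount_spec (ℓ := ℓ) (n := Fintype.card N) (R := P.rank + 1)
    (Nat.le_add_left 1 _)
  obtain ⟨h1, h2, h3⟩ := randomSearch_spec hE hPw hset hcard (hrank.trans hcard') hδ hs1 hs2 hs3
    (K := stepCount η τ (P.rank + 1))
    (stepCount_random h.η_pos (Nat.le_add_left 1 _) (hτ ▸ h.log_le hn hrank)) τ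
  have hexp : ∀ φ, (randomAlg N ε ℓ η τ).expect f w M φ = _ := fun φ => hP.expect_bind _ φ
  refine ⟨fun run hrun => ?_, ?_, fun O hO => ?_, P.rank + 1, Nat.succ_le_succ hPr,
    Nat.le_add_left 1 _, hrank, hP.queries_bind h3⟩
  · rw [randomAlg, hP.outcomes_bind] at hrun
    exact ⟨(h1 run hrun).improving, (h1 run hrun).indep_result⟩
  · rw [prob, hexp]
    have h4 := h.half_pow_le hn
    rw [← hτ] at h4
    have h5 := prob_compl (f := f) (w := w) (M := M) (randomSearch ℓ τ η
      (slotCount (Fintype.card N) (P.rank + 1))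
      (candidateCount ℓ (Fintype.card N) (P.rank + 1)) (stepCount η τ (P.rank + 1)) τ P)
      (IsGoodRun ℓ f w M η P)
    have h6 : 1 - ε ≤ (randomSearch ℓ τ η (slotCount (Fintype.card N) (P.rank + 1))
      (candidateCount ℓ (Fintype.card N) (P.rank + 1)) (stepCount η τ (P.rank + 1)) τ P).prob
        f w M (IsGoodRun ℓ f w M η P) := by linarith
    refine h6.trans (expect_mono fun run hrun => ?_)
    split_ifs with hg hs' hs'
    · exact le_rfl
    · exact absurd (hg.isSuccessful hset (h1 run hrun)) hs'
    · exact zero_le_one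
    · exact le_rfl
  · rw [hexp]
    have hloss := h.loss_le hn hrank hset.scale.scale_nonneg
    rw [← hτ] at hloss
    set s := b * (ε * singleCoeff ℓ / (2 * Fintype.card N) * v) /
        (2 * (((P.rank + 1 : ℕ) : ℝ) + 2) * ∑ J : Finset (Fin (ℓ + 1)), searchCoeff ℓ J.card)
      with hs_def
    set W := (singleCoeff ℓ + ∑ J : Finset (Fin (ℓ + 1)), searchCoeff ℓ J.card) *
      (((P.rank + 1 : ℕ) : ℝ) * v) with hW
    have hv := hset.scale.scale_nonneg
    have hS := sum_searchCoeff_pos ℓ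
    have hsW : 0 ≤ s + W := by
      have := h.b_pos
      have := singleCoeff_pos ℓ
      positivity
    obtain ⟨bad, hbad⟩ : ∃ bad, bad = fun run => ¬ IsGoodRun ℓ f w M η P run := ⟨_, rfl⟩
    rw [← hbad] at h2
    have h6 := mul_le_mul_of_nonneg_left h2 hsW
    set A := randomSearch ℓ τ η (slotCount (Fintype.card N) (P.rank + 1))
      (candidateCount ℓ (Fintype.card N) (P.rank + 1)) (stepCount η τ (P.rank + 1)) τ P with hA
    refine le_of_mul_le_mul_left ?_ (linearCoeff_pos ℓ)
    rw [← expect_const_mul]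
    -- A good run exceeds the target by `s`, and a bad one falls short of it by at most `W`. As `(s
    -- + W) * (1 / 2) ^ τ ≤ s`, the expectation reaches the target.
    refine le_trans ?_ (expect_mono (φ := fun run =>
      (linearCoeff ℓ * (1 - 1 / Real.exp 1 - ε) * f O + linearCoeff ℓ * w O + s) +
        -(s + W) * if bad run then 1 else 0) fun run hrun => ?_)
    · rw [expect_add, expect_const, expect_const_mul]
      rw [prob] at h6
      generalize A.expect f w M (fun run => if bad run then 1 else 0) = p at h6 ⊢
      generalize 1 - 1 / Real.exp 1 - ε = κ
      linarith
    · have hrun' := h1 run hrun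
      have hsol := hrun'.improving.isSolution_final
      by_cases hg : IsGoodRun ℓ f w M η P run
      · have := hset.guarantee_of_scale hsol hrun'.subset hg hO
        rw [if_neg (by simpa [hbad] using hg), mul_zero, add_zero, mul_add]
        exact this
      · have := hset.weak_guarantee hsol hrun'.subset hrun'.start_le hO
        rw [if_pos (by simpa [hbad] using hg), mul_one, mul_add]
        change _ ≤ linearCoeff ℓ * f run.result + linearCoeff ℓ * w run.result + W at this
        generalize 1 - 1 / Real.exp 1 - ε = κ at this ⊢
        linarith

end algorithms

end OracleAlg

/-! ### Counting queries -/

section counting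

open OracleAlg

theorem full_count_le {n R τ D V q : ℕ} (hn : 1 ≤ n) (hR : 1 ≤ R) (hRn : R ≤ n + 1) :
    5 * (n * (τ + 1)) + (q * R * τ + 1) * (n * D * (2 * V + τ + 1) + V +
      (V + R * V + (n * D + R) * (V + τ + 1))) + 1 ≤
    (6 + (q + 1) * (D * (2 * V + 1) + 4 * V + (D + 2) * (V + 1))) * (n * R * (τ + 1) ^ 2) := by
  have hnx : 1 ≤ n * (τ + 1) := Nat.mul_pos hn (Nat.succ_pos _)
  have hV : V ≤ V * (n * (τ + 1)) := Nat.le_mul_of_pos_right _ hnx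
  have hR2 : R ≤ 2 * n := by omega
  have h1 : n * D * (2 * V + τ + 1) ≤ D * (2 * V + 1) * (n * (τ + 1)) := by
    have : 2 * V + τ + 1 ≤ (2 * V + 1) * (τ + 1) := by nlinarith [Nat.zero_le (V * τ)]
    calc n * D * (2 * V + τ + 1) ≤ n * D * ((2 * V + 1) * (τ + 1)) := Nat.mul_le_mul_left _ this
      _ = _ := by ring
  have h2 : R * V ≤ 2 * V * (n * (τ + 1)) := by
    calc R * V ≤ 2 * n * V := Nat.mul_le_mul_right _ hR2
      _ ≤ 2 * n * V * (τ + 1) := Nat.le_mul_of_pos_right _ (Nat.succ_pos _)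
      _ = _ := by ring
  have h3 : (n * D + R) * (V + τ + 1) ≤ (D + 2) * (V + 1) * (n * (τ + 1)) := by
    have : V + τ + 1 ≤ (V + 1) * (τ + 1) := by nlinarith [Nat.zero_le (V * τ)]
    calc (n * D + R) * (V + τ + 1) ≤ (n * D + 2 * n) * ((V + 1) * (τ + 1)) :=
          Nat.mul_le_mul (Nat.add_le_add_left hR2 _) this
      _ = _ := by ring
  have h4 : q * R * τ + 1 ≤ (q + 1) * (R * (τ + 1)) := by
    have : 1 ≤ R * (τ + 1) := Nat.mul_pos hR (Nat.succ_pos _)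
    have h : q * R * τ ≤ q * (R * (τ + 1)) := by
      rw [mul_assoc]
      exact Nat.mul_le_mul_left _ (Nat.mul_le_mul_left _ (Nat.le_succ _))
    linarith
  have h5 : n * D * (2 * V + τ + 1) + V + (V + R * V + (n * D + R) * (V + τ + 1)) ≤
      (D * (2 * V + 1) + 4 * V + (D + 2) * (V + 1)) * (n * (τ + 1)) := by linarith
  have h6 := Nat.mul_le_mul h4 h5
  have h7 : n * (τ + 1) ≤ n * R * (τ + 1) ^ 2 := by
    calc n * (τ + 1) ≤ n * (τ + 1) * (R * (τ + 1)) :=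
          Nat.le_mul_of_pos_right _ (Nat.mul_pos hR (Nat.succ_pos _))
      _ = _ := by ring
  have h8 : (q + 1) * (R * (τ + 1)) *
      ((D * (2 * V + 1) + 4 * V + (D + 2) * (V + 1)) * (n * (τ + 1))) =
      (q + 1) * (D * (2 * V + 1) + 4 * V + (D + 2) * (V + 1)) * (n * R * (τ + 1) ^ 2) := by ring
  rw [h8] at h6
  linarith

theorem mul_slotCount_le {n R : ℕ} (hn : 1 ≤ n) :
    (R : ℝ) * slotCount n R ≤ 2 * (R * √n) := by
  have h1 : (slotCount n R : ℝ) ≤ √n + 1 := by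
    have h2 : (slotCount n R : ℝ) ≤ (Nat.sqrt n + 1 : ℕ) := by exact_mod_cast min_le_right _ _
    push_cast at h2
    linarith [Real.nat_sqrt_le_real_sqrt (a := n)]
  have h3 : 1 ≤ √(n : ℝ) := Real.one_le_sqrt.2 (by exact_mod_cast hn)
  have h4 : (R : ℝ) * slotCount n R ≤ R * (2 * √n) :=
    mul_le_mul_of_nonneg_left (by linarith) (Nat.cast_nonneg _)
  linarith

/-- If all `R` slots are used, about `n / R` candidates per step suffice, in total order `n`.
Otherwise about `√n` slots are used and order `√n` candidates per step suffice. -/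
theorem mul_candidateCount_le {ℓ n R : ℕ} (hn : 1 ≤ n) (hR : 1 ≤ R) (hRn : R ≤ n + 1) :
    (R : ℝ) * candidateCount ℓ n R ≤ ((ℓ : ℝ) + 3) * (R * √n) + ((ℓ : ℝ) + 1) * n + 2 * R := by
  have hn' : (1 : ℝ) ≤ n := by exact_mod_cast hn
  have hR' : (1 : ℝ) ≤ R := by exact_mod_cast hR
  have hR2 : (R : ℝ) ≤ 2 * n := by
    have : (R : ℝ) ≤ n + 1 := by exact_mod_cast hRn
    linarith
  have hs : 0 < √(n : ℝ) := Real.sqrt_pos.2 (by linarith)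
  have h1 : (candidateCount ℓ n R : ℝ) ≤ (n * (ℓ + 1) + R) / slotCount n R + 1 := by
    rw [candidateCount]
    push_cast
    have := Nat.cast_div_le (α := ℝ) (m := n * (ℓ + 1) + R) (n := slotCount n R)
    push_cast at this
    linarith
  have h2 : (R : ℝ) * ((n * (ℓ + 1) + R) / slotCount n R) ≤
      ((ℓ : ℝ) + 3) * (R * √n) + ((ℓ : ℝ) + 1) * n + R := by
    rcases min_choice R (Nat.sqrt n + 1) with h | h
    · rw [slotCount, h, mul_div_cancel₀ _ (by positivity)]
      have : 0 ≤ ((ℓ : ℝ) + 3) * (R * √n) := by positivity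
      linarith
    · have h3 : √(n : ℝ) ≤ slotCount n R := by
        rw [slotCount, h]
        push_cast
        exact Real.real_sqrt_le_nat_sqrt_succ
      have h4 : ((n : ℝ) * (ℓ + 1) + R) / slotCount n R ≤ ((ℓ : ℝ) + 3) * √n := by
        rw [div_le_iff₀ (hs.trans_le h3)]
        have h5 : ((ℓ : ℝ) + 3) * √n * √n ≤ ((ℓ : ℝ) + 3) * √n * slotCount n R :=
          mul_le_mul_of_nonneg_left h3 (by positivity)
        rw [mul_assoc, Real.mul_self_sqrt (by linarith)] at h5
        linarith
      have h5 := mul_le_mul_of_nonneg_left h4 (Nat.cast_nonneg (α := ℝ) R)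
      have h6 : 0 ≤ ((ℓ : ℝ) + 1) * n + R := by positivity
      linarith
  have h3 := mul_le_mul_of_nonneg_left h1 (Nat.cast_nonneg (α := ℝ) R)
  linarith

theorem random_count_le {ℓ n R τ q V : ℕ} {Y : ℝ} (hn : 1 ≤ n) (hR : 1 ≤ R) (hRn : R ≤ n + 1)
    (hnY : (n : ℝ) ≤ Y) (hRY : (R : ℝ) * √n ≤ Y) :
    5 * ((n : ℝ) * (τ + 1)) + τ * (n * (ℓ + 1) * (2 * V + τ + 1) + V +
      (q * R * τ + 1) * (V + slotCount n R * V + candidateCount ℓ n R * (V + τ + 1))) + 1 ≤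
    (6 + ((ℓ + 1) * (2 * V + 1) + V + (q + 1) * (3 * V + (2 * ℓ + 6) * (V + 1)))) *
      (Y * ((τ : ℝ) + 1) ^ 3) := by
  have hn' : (1 : ℝ) ≤ n := by exact_mod_cast hn
  have hR' : (1 : ℝ) ≤ R := by exact_mod_cast hR
  have hV : (0 : ℝ) ≤ V := Nat.cast_nonneg V
  have hq : (0 : ℝ) ≤ q := Nat.cast_nonneg q
  have hl : (0 : ℝ) ≤ ℓ := Nat.cast_nonneg ℓ
  have hτ : (0 : ℝ) ≤ τ := Nat.cast_nonneg τ
  have hs : 1 ≤ √(n : ℝ) := Real.one_le_sqrt.2 hn'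
  have hRs : (R : ℝ) ≤ R * √n := le_mul_of_one_le_right (by positivity) hs
  have hs1 := mul_slotCount_le (R := R) hn
  have hm1 := mul_candidateCount_le (ℓ := ℓ) hn hR hRn
  have hS : (0 : ℝ) ≤ slotCount n R := Nat.cast_nonneg _
  have hC : (0 : ℝ) ≤ candidateCount ℓ n R := Nat.cast_nonneg _
  generalize (slotCount n R : ℝ) = s at *
  generalize (candidateCount ℓ n R : ℝ) = m at *
  obtain ⟨x, hx⟩ : ∃ x : ℝ, x = (τ : ℝ) + 1 := ⟨_, rfl⟩
  have hx1 : 1 ≤ x := by linarith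
  have hY : 1 ≤ Y := hn'.trans hnY
  have hRm : (R : ℝ) * m ≤ (2 * ℓ + 6) * Y := by
    have h1 : ((ℓ : ℝ) + 3) * (R * √n) ≤ ((ℓ : ℝ) + 3) * Y :=
      mul_le_mul_of_nonneg_left hRY (by positivity)
    have h2 : ((ℓ : ℝ) + 1) * n ≤ ((ℓ : ℝ) + 1) * Y :=
      mul_le_mul_of_nonneg_left hnY (by positivity)
    linarith
  have hVx : (V : ℝ) + τ + 1 ≤ (V + 1) * x := by
    have := mul_le_mul_of_nonneg_left hx1 hV
    linarith
  have hVx2 : 2 * (V : ℝ) + τ + 1 ≤ (2 * V + 1) * x := by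
    have := mul_le_mul_of_nonneg_left hx1 hV
    linarith
  have h1 : (q : ℝ) * R * τ + 1 ≤ (q + 1) * x * R := by
    have h2 : 1 ≤ x * R := one_le_mul_of_one_le_of_one_le hx1 hR'
    have h3 : (q : ℝ) * R * τ ≤ q * R * x := mul_le_mul_of_nonneg_left (by linarith) (by positivity)
    linarith
  have h2 : (R : ℝ) * (V + s * V + m * (V + τ + 1)) ≤
      (3 * V + (2 * ℓ + 6) * (V + 1)) * (Y * x) := by
    have h3 : (V : ℝ) * R ≤ V * Y := mul_le_mul_of_nonneg_left (hRs.trans hRY) hV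
    have h4 : (V : ℝ) * (R * s) ≤ V * (2 * Y) :=
      mul_le_mul_of_nonneg_left (by linarith) hV
    have h5 : (R : ℝ) * m * (V + τ + 1) ≤ (2 * ℓ + 6) * Y * ((V + 1) * x) :=
      mul_le_mul hRm hVx (by positivity) (by positivity)
    have h6 : 3 * (V : ℝ) * Y ≤ 3 * V * Y * x := le_mul_of_one_le_right (by positivity) hx1
    linarith
  have h3 : ((q : ℝ) * R * τ + 1) * (V + s * V + m * (V + τ + 1)) ≤
      (q + 1) * (3 * V + (2 * ℓ + 6) * (V + 1)) * (Y * x ^ 2) := by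
    have h4 : 0 ≤ (V : ℝ) + s * V + m * (V + τ + 1) := by positivity
    have h5 := mul_le_mul_of_nonneg_right h1 h4
    have h6 := mul_le_mul_of_nonneg_left h2 (by positivity : 0 ≤ ((q : ℝ) + 1) * x)
    linarith
  have hYx : Y ≤ Y * x ^ 2 := le_mul_of_one_le_right (by linarith) (one_le_pow₀ hx1)
  have h4 : (n : ℝ) * (ℓ + 1) * (2 * V + τ + 1) + V ≤
      ((ℓ + 1) * (2 * V + 1) + V) * (Y * x ^ 2) := by
    have h5 : (n : ℝ) * (ℓ + 1) * (2 * V + τ + 1) ≤ Y * (ℓ + 1) * ((2 * V + 1) * x) :=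
      mul_le_mul (mul_le_mul_of_nonneg_right hnY (by positivity)) hVx2 (by positivity)
        (by positivity)
    have h6 : (V : ℝ) * 1 ≤ V * (Y * x ^ 2) := mul_le_mul_of_nonneg_left (hY.trans hYx) hV
    have h7 : Y * (ℓ + 1) * (2 * V + 1) * x ≤ Y * (ℓ + 1) * (2 * V + 1) * x ^ 2 :=
      mul_le_mul_of_nonneg_left (le_self_pow₀ hx1 two_ne_zero) (by positivity)
    linarith
  have h5 := mul_le_mul (by linarith : (τ : ℝ) ≤ x) (add_le_add h4 h3) (by positivity)
    (by positivity)
  have h6 : Y * x ≤ Y * x ^ 3 :=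
    mul_le_mul_of_nonneg_left (le_self_pow₀ hx1 three_ne_zero) (by linarith)
  have h7 : (n : ℝ) * x ≤ Y * x := mul_le_mul_of_nonneg_right hnY (by linarith)
  have h8 : 1 ≤ Y * x := one_le_mul_of_one_le_of_one_le hY hx1
  rw [← hx]
  linarith

end counting

/-! ### Subtracting a constant from the submodular function -/

section normalization

variable {N : Type u} [DecidableEq N] {L : ℕ} {M : Matroid N}

theorem auxSubmodular_sub_const (α : ℕ → ℝ) (f : Finset N → ℝ) (y : ℝ)
    (A : Finset (N × Fin L)) :
    auxSubmodular α (fun S => f S - y) A =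
      auxSubmodular α f A - (∑ J : Finset (Fin L), α J.card) * y := by
  simp only [auxSubmodular, mul_sub, Finset.sum_sub_distrib, Finset.sum_mul]

theorem auxFun_sub_const (α : ℕ → ℝ) (c : ℝ) (f w : Finset N → ℝ) (y : ℝ)
    (A : Finset (N × Fin L)) :
    auxFun α c (fun S => f S - y) w A =
      auxFun α c f w A - (∑ J : Finset (Fin L), α J.card) * y := by
  rw [auxFun, auxFun, auxSubmodular_sub_const]
  ring

theorem IsSubmodular.sub_const {f : Finset N → ℝ} (hf : IsSubmodular f) (y : ℝ) :
    IsSubmodular fun S => f S - y := fun S T => by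
  have := hf S T
  linarith

theorem SearchRun.IsImproving.of_sub_const {α : ℕ → ℝ} {c : ℝ} {f w : Finset N → ℝ} {y : ℝ}
    {run : SearchRun N L} (h : run.IsImproving M (auxFun α c (fun S => f S - y) w)) :
    run.IsImproving M (auxFun α c f w) := by
  refine ⟨h.1, h.2.imp fun A B hAB => ⟨hAB.1, ?_⟩⟩
  have := hAB.2
  rwa [auxFun_sub_const, auxFun_sub_const, sub_lt_sub_iff_right] at this

/-- Marginal values do not feel the constant, and restoring it only increases the permitted
violation. -/
theorem SearchRun.IsLocallyOptimal.of_sub_const {α : ℕ → ℝ} (hα : ∀ i, 0 ≤ α i) {c : ℝ}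
    {f w : Finset N → ℝ} (hf : ∀ S, 0 ≤ f S) {y : ℝ} (hy : 0 ≤ y) {ε ε' : ℝ} (hε : 0 ≤ ε)
    (hε' : ε ≤ ε') {run : SearchRun N L}
    (h : run.IsLocallyOptimal M α c (fun S => f S - y) w ε) :
    run.IsLocallyOptimal M α c f w ε' := by
  obtain ⟨B, hB, hle⟩ := h
  refine ⟨B, hB, fun T hT => ?_⟩
  have h1 := hle T hT
  simp only [auxFun_sub_const, sub_sub_sub_cancel_right] at h1
  rw [auxSubmodular_sub_const] at h1
  have h2 : 0 ≤ (∑ J : Finset (Fin L), α J.card) * y :=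
    mul_nonneg (Finset.sum_nonneg fun J _ => hα _) hy
  have h3 := mul_nonneg hε h2
  have h4 := mul_le_mul_of_nonneg_right hε' (auxSubmodular_nonneg hα hf B)
  linarith

end normalization

namespace OracleAlg

/-- Run an algorithm for the value oracle normalized by its value at the empty set. -/
def normalize {N : Type u} {β : Type v} (A : OracleAlg N β) : OracleAlg N β :=
  queryValue ∅ fun y => A.shiftValue y

section normalize

variable {N : Type u} {β : Type v} (A : OracleAlg N β) (f w : Finset N → ℝ) (M : Matroid N)

theorem outcomes_normalize :
    A.normalize.outcomes f w M = A.outcomes (fun S => f S - f ∅) w M :=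
  outcomes_shiftValue ..

theorem queries_normalize :
    A.normalize.queries f w M = A.queries (fun S => f S - f ∅) w M + 1 :=
  congrArg (· + 1) (queries_shiftValue ..)

theorem expect_normalize (φ : β → ℝ) :
    A.normalize.expect f w M φ = A.expect (fun S => f S - f ∅) w M φ :=
  expect_shiftValue ..

end normalize

/-! ### Transfer of success from the normalized function -/

section successful

variable {N : Type u} [DecidableEq N] {ℓ : ℕ} {f w : Finset N → ℝ} {M : Matroid N} {ε ε' : ℝ}

omit [DecidableEq N] in
-- The constant returns with factor 1 on the right, but is needed only with the approximation
-- factor, which is below 1.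
theorem le_of_sub_const (hf : ∀ S, 0 ≤ f S) (hε : 0 < ε) (hε' : ε ≤ ε') {y z : ℝ} (hy : 0 ≤ y)
    {O : Finset N} (h : (1 - 1 / Real.exp 1 - ε) * (f O - y) + w O ≤ z) :
    (1 - 1 / Real.exp 1 - ε') * f O + w O ≤ z + y := by
  have h1 : 0 ≤ 1 / Real.exp 1 := by positivity
  generalize 1 / Real.exp 1 = x at *
  have h2 := mul_le_mul_of_nonneg_right hε' (hf O)
  have h3 := mul_nonneg h1 hy
  have h4 := mul_nonneg hε.le hy
  linarith

theorem IsSuccessful.of_sub_const {y : ℝ} {run : SearchRun N (ℓ + 1)}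
    (h : IsSuccessful ℓ (fun S => f S - y) w M ε run) (hf : ∀ S, 0 ≤ f S) (hy : 0 ≤ y)
    (hε : 0 < ε) (hε' : ε ≤ ε') :
    IsSuccessful ℓ f w M ε' run := by
  refine ⟨h.optimal.of_sub_const (searchCoeff_nonneg ℓ) hf hy hε.le hε', fun O hO => ?_⟩
  have := le_of_sub_const (f := f) (w := w) hf hε hε' hy (h.guarantee O hO)
  linarith

end successful

/-! ### The empty ground set -/

section empty

variable {N : Type u} [DecidableEq N] [IsEmpty N] {f w : Finset N → ℝ} {M : Matroid N}

omit [IsEmpty N] in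
theorem isImproving_empty {L : ℕ} (Φ : Finset (N × Fin L) → ℝ) :
    (⟨∅, []⟩ : SearchRun N L).IsImproving M Φ := by
  refine ⟨?_, List.isChain_singleton _⟩
  intro A hA
  obtain rfl : A = ∅ := by simpa using hA
  exact ⟨by simp, by simp [unionPart_of_empty]⟩

theorem isSuccessful_of_isEmpty (ℓ : ℕ) (hf : ∀ S, 0 ≤ f S) {ε : ℝ} (hε : 0 < ε) :
    IsSuccessful ℓ f w M ε (⟨∅, []⟩ : SearchRun N (ℓ + 1)) := by
  refine ⟨⟨∅, (isImproving_empty (M := M) fun _ => 0).1 _ (by simp), fun T _ => ?_⟩,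
    fun O _ => ?_⟩
  · rw [Finset.eq_empty_of_isEmpty T]
    have := auxSubmodular_nonneg (searchCoeff_nonneg ℓ) hf (∅ : Finset (N × Fin (ℓ + 1)))
    simpa [SearchRun.final] using mul_nonneg hε.le this
  · rw [Finset.eq_empty_of_isEmpty O, Finset.eq_empty_of_isEmpty (SearchRun.result _)]
    have := le_of_sub_const (f := f) (w := w) (O := ∅) hf hε le_rfl (hf ∅) le_rfl
    simp at this ⊢
    linarith

end empty

end OracleAlg

/-! ### The theorem -/

section main

open OracleAlg

variable {ε ε₀ : ℝ} {ℓ : ℕ} {b η : ℝ}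

/-- A bound for the number of repetitions in terms of the logarithm. -/
noncomputable def logConst (ε : ℝ) (ℓ : ℕ) (b η : ℝ) : ℝ :=
  6 + 2 * Real.log (searchConst ε ℓ b η + 1)

theorem IsSearchParam.logConst_nonneg (h : IsSearchParam ε ℓ b η) : 0 ≤ logConst ε ℓ b η := by
  have := Real.log_nonneg (by linarith [h.searchConst_pos] : 1 ≤ searchConst ε ℓ b η + 1)
  rw [logConst]
  linarith

/-- The constant in the bounds for the numbers of queries. -/
noncomputable def queryConst (ε : ℝ) (ℓ : ℕ) (b η : ℝ) : ℝ :=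
  2 * ((6 + ((⌈12 / η⌉₊ : ℝ) + 1) * (((ℓ : ℝ) + 1) * (2 * 2 ^ (ℓ + 1) + 1) + 4 * 2 ^ (ℓ + 1) +
      (((ℓ : ℝ) + 1) + 2) * (2 ^ (ℓ + 1) + 1))) * logConst ε ℓ b η ^ 2) +
    (6 + (((ℓ : ℝ) + 1) * (2 * 2 ^ (ℓ + 1) + 1) + 2 ^ (ℓ + 1) + ((⌈12 / η⌉₊ : ℝ) + 1) *
      (3 * 2 ^ (ℓ + 1) + (2 * (ℓ : ℝ) + 6) * (2 ^ (ℓ + 1) + 1)))) * logConst ε ℓ b η ^ 3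

theorem full_bound_le {p p' n R r x c z : ℝ} (hp : 0 ≤ p) (hp' : 0 ≤ p') (hn : 0 ≤ n)
    (hR : R ≤ 2 * r) (hx : 0 ≤ x) (hxc : x ≤ c * z) (hz : 1 ≤ z) (hr : 0 ≤ r) :
    p * (n * R * x ^ 2) ≤ (2 * (p * c ^ 2) + p') * (n * r) * z ^ 3 := by
  have h1 : x ^ 2 ≤ c ^ 2 * z ^ 3 := by
    calc x ^ 2 ≤ (c * z) ^ 2 := pow_le_pow_left₀ hx hxc 2
      _ = c ^ 2 * z ^ 2 := by ring
      _ ≤ c ^ 2 * z ^ 3 :=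
        mul_le_mul_of_nonneg_left (pow_le_pow_right₀ hz (by norm_num)) (sq_nonneg c)
  calc p * (n * R * x ^ 2) ≤ p * (n * (2 * r) * (c ^ 2 * z ^ 3)) := by gcongr
    _ = 2 * (p * c ^ 2) * (n * r) * z ^ 3 := by ring
    _ ≤ (2 * (p * c ^ 2) + p') * (n * r) * z ^ 3 := by
      gcongr
      exact le_add_of_nonneg_right hp'

theorem random_bound_le {p p' Y x c z : ℝ} (hp : 0 ≤ p) (hp' : 0 ≤ p') (hY : 0 ≤ Y)
    (hx : 0 ≤ x) (hxc : x ≤ c * z) (hz : 0 ≤ z) :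
    p * (Y * x ^ 3) ≤ (p' + p * c ^ 3) * Y * z ^ 3 := by
  calc p * (Y * x ^ 3) ≤ p * (Y * (c * z) ^ 3) := by gcongr
    _ = p * c ^ 3 * Y * z ^ 3 := by ring
    _ ≤ (p' + p * c ^ 3) * Y * z ^ 3 := by
      gcongr
      exact le_add_of_nonneg_left hp'

theorem IsSearchParam.exists_deterministic (h : IsSearchParam ε₀ ℓ b η) (hε : ε₀ ≤ ε)
    (N : Type u) [Fintype N] [DecidableEq N] :
    ∃ A : OracleAlg N (SearchRun N (ℓ + 1)), A.Deterministic ∧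
      ∀ (f w : Finset N → ℝ) (M : Matroid N),
        (∀ S, 0 ≤ f S) → Monotone f → IsSubmodular f → IsLinearSetFun w → M.E = Set.univ →
        ∃ R : SearchRun N (ℓ + 1), A.outcomes f w M = {R} ∧
          R.IsImproving M (auxFun (searchCoeff ℓ) (linearCoeff ℓ) f w) ∧
          M.Indep (R.result : Set N) ∧ IsSuccessful ℓ f w M ε R ∧
          (A.queries f w M : ℝ) ≤
            queryConst ε₀ ℓ b η * ((Fintype.card N : ℝ) * max 1 (M.eRank.toNat : ℝ)) *
              (1 + Real.log (Fintype.card N)) ^ 3 := by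
  have hε₀ := h.ε_pos
  rcases isEmpty_or_nonempty N with hN | hN
  · refine ⟨output ⟨∅, []⟩, trivial, fun f w M hf _ _ _ _ => ⟨_, rfl, isImproving_empty _, ?_,
      isSuccessful_of_isEmpty ℓ hf (hε₀.trans_le hε), ?_⟩⟩
    · rw [Finset.eq_empty_of_isEmpty (SearchRun.result _)]
      simp
    · simp [queries]
  -- Derandomizing yields determinism without inspection of the algorithm; the result is one of its
  -- outcomes, and all of them are successful.
  · refine ⟨(fullAlg N ε₀ ℓ η (searchExponent (searchConst ε₀ ℓ b η) (Fintype.card N))).normalize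
      |>.derandomize, deterministic_derandomize _, fun f w M hf hm hs hw hE => ?_⟩
    obtain ⟨h1, R, hRr, hR1, hRn, h2⟩ := fullAlg_spec (N := N) (w := w) (M := M) h
      (f := fun S => f S - f ∅) (fun S T hST => sub_le_sub_right (hm hST) _) (hs.sub_const _)
      (sub_self _) hw hE rfl
    obtain ⟨run, hrun, hout⟩ := exists_outcomes_derandomize_eq (f := f) (w := w) (M := M)
      (fullAlg N ε₀ ℓ η (searchExponent (searchConst ε₀ ℓ b η) (Fintype.card N))).normalize
    rw [outcomes_normalize] at hrun
    obtain ⟨h3, h4, h5⟩ := h1 run hrun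
    refine ⟨run, hout, h3.of_sub_const, h4, h5.of_sub_const hf (hf ∅) hε₀ hε, ?_⟩
    have hn : 1 ≤ Fintype.card N := Fintype.card_pos
    have h6 := (queries_derandomize_le (f := f) (w := w) (M := M) _).trans
      ((queries_normalize
        (fullAlg N ε₀ ℓ η (searchExponent (searchConst ε₀ ℓ b η) (Fintype.card N))) f w M).le.trans
          (Nat.add_le_add_right h2 1))
    have h7 := h6.trans (full_count_le (V := 2 ^ (ℓ + 1)) (D := ℓ + 1) (q := ⌈12 / η⌉₊) hn hR1 hRn)
    refine ((Nat.cast_le (α := ℝ)).2 h7).trans ?_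
    have hlog := searchExponent_le h.searchConst_pos hn
    rw [← logConst] at hlog
    generalize searchExponent (searchConst ε₀ ℓ b η) (Fintype.card N) = τ at hlog
    have hlam : 1 ≤ 1 + Real.log (Fintype.card N) := by
      linarith [Real.log_natCast_nonneg (Fintype.card N)]
    have hR : (R : ℝ) ≤ 2 * max 1 (M.eRank.toNat : ℝ) := by
      have h8 : (R : ℝ) ≤ (M.eRank.toNat : ℝ) + 1 := by exact_mod_cast hRr
      linarith [le_max_left (1 : ℝ) (M.eRank.toNat : ℝ), le_max_right (1 : ℝ) (M.eRank.toNat : ℝ)]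
    have hC := h.logConst_nonneg
    rw [queryConst]
    push_cast
    refine full_bound_le (by positivity) (by positivity) (by positivity) hR
      (by positivity) hlog hlam (le_max_of_le_left zero_le_one)

theorem IsSearchParam.exists_randomized (h : IsSearchParam ε₀ ℓ b η) (hε : ε₀ ≤ ε)
    (N : Type u) [Fintype N] [DecidableEq N] :
    ∃ A : OracleAlg N (SearchRun N (ℓ + 1)),
      ∀ (f w : Finset N → ℝ) (M : Matroid N),
        (∀ S, 0 ≤ f S) → Monotone f → IsSubmodular f → IsLinearSetFun w → M.E = Set.univ →
        (∀ R ∈ A.outcomes f w M,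
          R.IsImproving M (auxFun (searchCoeff ℓ) (linearCoeff ℓ) f w) ∧
            M.Indep (R.result : Set N)) ∧
        1 - ε ≤ A.prob f w M (IsSuccessful ℓ f w M ε) ∧
        (∀ OPT : Finset N, M.Indep (OPT : Set N) →
          (1 - 1 / Real.exp 1 - ε) * f OPT + w OPT ≤
            A.expect f w M (fun R => f R.result + w R.result)) ∧
        (A.queries f w M : ℝ) ≤
          queryConst ε₀ ℓ b η * ((Fintype.card N : ℝ) +
              (M.eRank.toNat : ℝ) * √(Fintype.card N)) *
            (1 + Real.log (Fintype.card N)) ^ 3 := by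
  classical
  have hε₀ := h.ε_pos
  rcases isEmpty_or_nonempty N with hN | hN
  · refine ⟨output ⟨∅, []⟩, fun f w M hf _ _ _ _ => ⟨?_, ?_, fun O hO => ?_, ?_⟩⟩
    · rintro _ rfl
      refine ⟨isImproving_empty _, ?_⟩
      rw [Finset.eq_empty_of_isEmpty (SearchRun.result _)]
      simp
    · rw [prob, expect, if_pos (isSuccessful_of_isEmpty ℓ hf (hε₀.trans_le hε))]
      linarith
    · exact (isSuccessful_of_isEmpty ℓ hf (hε₀.trans_le hε)).guarantee O hO
    · simp [queries]
  · refine ⟨(randomAlg N ε₀ ℓ η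
      (searchExponent (searchConst ε₀ ℓ b η) (Fintype.card N))).normalize,
        fun f w M hf hm hs hw hE => ?_⟩
    obtain ⟨h1, h2, h3, R, hRr, hR1, hRn, h4⟩ := randomAlg_spec (N := N) (w := w) (M := M) h
      (f := fun S => f S - f ∅) (fun S T hST => sub_le_sub_right (hm hST) _) (hs.sub_const _)
      (sub_self _) hw hE rfl
    refine ⟨fun run hrun => ?_, ?_, fun O hO => ?_, ?_⟩
    · rw [outcomes_normalize] at hrun
      exact ⟨(h1 run hrun).1.of_sub_const, (h1 run hrun).2⟩
    · rw [prob, expect_normalize]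
      refine (sub_le_sub_left hε 1).trans (h2.trans (expect_mono fun run _ => ?_))
      split_ifs with hg hg' hg'
      · exact le_rfl
      · exact absurd (hg.of_sub_const hf (hf ∅) hε₀ hε) hg'
      · exact zero_le_one
      · exact le_rfl
    · rw [expect_normalize]
      refine (le_of_sub_const (w := w) hf hε₀ hε (hf ∅) (h3 O hO)).trans (le_of_eq ?_)
      have e := expect_add (f := fun S => f S - f ∅) (w := w) (M := M) (randomAlg N ε₀ ℓ η
        (searchExponent (searchConst ε₀ ℓ b η) (Fintype.card N)))
        (fun R => f R.result - f ∅ + w R.result) fun _ => f ∅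
      rw [expect_const] at e
      exact e.symm.trans (expect_congr fun R _ => by ring)
    · have hn : 1 ≤ Fintype.card N := Fintype.card_pos
      have h5 := (queries_normalize
        (randomAlg N ε₀ ℓ η (searchExponent (searchConst ε₀ ℓ b η) (Fintype.card N))) f w M).le.trans
          (Nat.add_le_add_right h4 1)
      have hn' : (1 : ℝ) ≤ Fintype.card N := by exact_mod_cast hn
      -- The extra slot costs `√n`, which the summand `n` absorbs.
      have hRY : (R : ℝ) * √(Fintype.card N) ≤
          (Fintype.card N : ℝ) + (M.eRank.toNat : ℝ) * √(Fintype.card N) := by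
        have h6 : (R : ℝ) ≤ (M.eRank.toNat : ℝ) + 1 := by exact_mod_cast hRr
        have h7 := mul_le_mul_of_nonneg_right h6 (Real.sqrt_nonneg (Fintype.card N))
        have h8 : √(Fintype.card N : ℝ) ≤ Fintype.card N :=
          Real.sqrt_le_iff.2 ⟨by linarith, le_self_pow₀ hn' two_ne_zero⟩
        linarith
      have h6 := (Nat.cast_le (α := ℝ)).2 h5
      rw [stepCount] at h6
      push_cast at h6
      have h7 := random_count_le (ℓ := ℓ) (V := 2 ^ (ℓ + 1))
        (τ := searchExponent (searchConst ε₀ ℓ b η) (Fintype.card N)) (q := ⌈12 / η⌉₊) hn hR1 hRn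
        (le_add_of_nonneg_right (by positivity)) hRY
      push_cast at h7
      refine h6.trans (h7.trans ?_)
      have hlog := searchExponent_le h.searchConst_pos hn
      rw [← logConst] at hlog
      have hlam : 1 ≤ 1 + Real.log (Fintype.card N) := by
        linarith [Real.log_natCast_nonneg (Fintype.card N)]
      have hC := h.logConst_nonneg
      rw [queryConst]
      exact random_bound_le (by positivity) (by positivity) (by positivity) (by positivity) hlog
        (zero_le_one.trans hlam)

end main

theorem mainTheorem4 :
    ∃ k : ℕ, ∀ ε : ℝ, 0 < ε →
      -- the parameters of the local search and the constant depend on `ε` only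
      ∃ (L : ℕ) (α : ℕ → ℝ) (c C : ℝ),
        2 ≤ L ∧ α 0 = 0 ∧ (∀ i, 1 ≤ i → i ≤ L → 0 < α i) ∧ 0 < c ∧
        ∀ (N : Type u) [Fintype N] [DecidableEq N],
          -- the deterministic algorithm
          (∃ A : OracleAlg N (SearchRun N L), A.Deterministic ∧
            ∀ (f w : Finset N → ℝ) (M : Matroid N),
              (∀ S, 0 ≤ f S) → Monotone f → IsSubmodular f → IsLinearSetFun w →
              M.E = Set.univ →
              ∃ R : SearchRun N L, A.outcomes f w M = {R} ∧
                R.IsImproving M (auxFun α c f w) ∧ R.IsLocallyOptimal M α c f w ε ∧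
                M.Indep (R.result : Set N) ∧
                (∀ OPT : Finset N, M.Indep (OPT : Set N) →
                  (1 - 1 / Real.exp 1 - ε) * f OPT + w OPT ≤ f R.result + w R.result) ∧
                (A.queries f w M : ℝ) ≤
                  C * ((Fintype.card N : ℝ) * max 1 (M.eRank.toNat : ℝ)) *
                    (1 + Real.log (Fintype.card N)) ^ k) ∧
          -- the randomized algorithm
          (∃ A : OracleAlg N (SearchRun N L),
            ∀ (f w : Finset N → ℝ) (M : Matroid N),
              (∀ S, 0 ≤ f S) → Monotone f → IsSubmodular f → IsLinearSetFun w →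
              M.E = Set.univ →
              (∀ R ∈ A.outcomes f w M,
                R.IsImproving M (auxFun α c f w) ∧ M.Indep (R.result : Set N)) ∧
              1 - ε ≤ A.prob f w M (fun R => R.IsLocallyOptimal M α c f w ε ∧
                ∀ OPT : Finset N, M.Indep (OPT : Set N) →
                  (1 - 1 / Real.exp 1 - ε) * f OPT + w OPT ≤ f R.result + w R.result) ∧
              (∀ OPT : Finset N, M.Indep (OPT : Set N) →
                (1 - 1 / Real.exp 1 - ε) * f OPT + w OPT ≤
                  A.expect f w M (fun R => f R.result + w R.result)) ∧
              (A.queries f w M : ℝ) ≤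
                C * ((Fintype.card N : ℝ) +
                    (M.eRank.toNat : ℝ) * Real.sqrt (Fintype.card N)) *
                  (1 + Real.log (Fintype.card N)) ^ k) := by
  classical
  -- In the randomized algorithm three logarithms multiply: rounds, steps per slot, and binary
  -- search. The deterministic one needs only two.
  refine ⟨3, fun ε hε => ?_⟩
  -- Capping ε at 1/2 keeps the approximation factor nonnegative; the claims for larger ε follow.
  obtain ⟨ℓ, b, η, hℓ, h⟩ := exists_isSearchParam (lt_min hε one_half_pos) (min_le_right ε _)
  refine ⟨ℓ + 1, searchCoeff ℓ, linearCoeff ℓ, queryConst (min ε (1 / 2)) ℓ b η, by omega, rfl,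
    fun i h1 h2 => searchCoeff_pos ℓ h1 h2, linearCoeff_pos ℓ, fun N _ _ => ⟨?_, ?_⟩⟩
  · obtain ⟨A, hA, hspec⟩ := h.exists_deterministic (min_le_left _ _) N
    refine ⟨A, hA, fun f w M hf hm hs hw hE => ?_⟩
    obtain ⟨R, h1, h2, h3, h4, h5⟩ := hspec f w M hf hm hs hw hE
    exact ⟨R, h1, h2, h4.optimal, h3, h4.guarantee, h5⟩
  · obtain ⟨A, hspec⟩ := h.exists_randomized (min_le_left _ _) N
    refine ⟨A, fun f w M hf hm hs hw hE => ?_⟩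
    obtain ⟨h1, h2, h3, h4⟩ := hspec f w M hf hm hs hw hE
    refine ⟨h1, h2.trans (le_of_eq ?_), h3, h4⟩
    congr 1
    exact funext fun R => propext ⟨fun h => ⟨h.1, h.2⟩, fun h => ⟨h.1, h.2⟩⟩
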